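/- Fix $\mu_X,\mu_Y>0$ and real constants $L_X,L_Y,L_{GX},L_{GY},L_{XY},L_{YX},L_H$, and put $\mu=\min(\mu_X,\mu_Y)$. There is a constant $C>0$ that depends only on these numbers (not on the dimensions, the horizon, the noise level, the functions or the starting point) such that the following holds for all $d_X,d_Y\ge 1$ and all $T\ge 1$. **Functions.** Let $\xi$ be a random variable with law $P$, let $F_t:\mathbb R^{d_X}\times\mathbb R^{d_Y}\times\Xi\to\mathbb R$ ($1\le t\le T$) be measurable with $F_t(x,y,\cdot)$ integrable, and put $f_t(x,y)=\mathbb E_\xi[F_t(x,y,\xi)]$, $\mathcal J_t=\frac1t\sum_{i=1}^t f_i$. Let $(u^*_{t+1},v^*_{t+1})$ be the saddle point of $\mathcal J_t$ on $\mathbb R^{d_X}\times\mathbb R^{d_Y}$ ($\min$ in $x$, $\max$ in $y$). Assume, for every $t$: 1. $F_t(\cdot,\cdot,\xi)$ is $C^1$ on $\mathbb R^{d_X}\times\mathbb R^{d_Y}$, $\mu_X$-strongly convex in $x$ and $\mu_Y$-strongly concave in $y$; 2. for some open convex sets $S_X\subseteq\mathbb R^{d_X}$, $S_Y\subseteq\mathbb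 R^{d_Y}$, the same for all $t$, with $(x_0,y_0)\in S_X\times S_Y$ and $(u^*_{t+1},v^*_{t+1})\in S_X\times S_Y$ for $1\le t\le T$, almost surely $F_t$ is $L_X$-Lipschitz in $x$ and $L_Y$-Lipschitz in $y$ on $S_X\times S_Y$; 3. almost surely, on the whole space, $\nabla_xF_t$ is $L_{GX}$-Lipschitz in $x$ and $L_{XY}$-Lipschitz in $y$, and $\nabla_yF_t$ is $L_{GY}$-Lipschitz in $y$ and $L_{YX}$-Lipschitz in $x$; 4. almost surely $F_t(\cdot,\cdot,\xi)$ is $C^3$ and all blocks $\nabla^3_{xxx}F_t,\nabla^3_{xxy}F_t,\dots,\nabla^3_{yyy}F_t$ of its third derivative have tensor operator norm at most $L_H$; 5. (oracle) $\mathbb E[\nabla_xF_t(x,y,\xi)]=\nabla_xf_t(x,y)$, $\mathbb E\|\nabla_xF_t(x,y,\xi)-\nabla_xf_t(x,y)\|^2\le\sigma^2$ for all $x,y$, and likewise for $\nabla_y$, where $\sigma\ge0$. **Algorithm.** From the point $(x_0,y_0)$ and with a constant step $\eta$, for $t=0,\dots,T-1$, $$x_{t+\frac12}=x_t-\eta\,\bar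 G^x_t(x_t,y_t),\quad y_{t+\frac12}=y_t+\eta\,\bar G^y_t(x_t,y_t),$$ $$x_{t+1}=x_t-\eta\,\bar G^x_t(x_{t+\frac12},y_{t+\frac12}),\quad y_{t+1}=y_t+\eta\,\bar G^y_t(x_{t+\frac12},y_{t+\frac12}),$$ where each evaluation of $\bar G_t=(\bar G^x_t,\bar G^y_t)$ uses fresh independent samples. In the zeroth-order setting $$\bar G^x_t(x,y)=\frac1{t\,m_X}\sum_{i=1}^t\sum_{j=1}^{m_X}\frac{F_i(x+\nu_Xu_{ij},y,\xi_{ij})-F_i(x,y,\xi_{ij})}{\nu_X}\,u_{ij},\qquad u_{ij}\sim N(0,I_{d_X}),\ \xi_{ij}\sim P,$$ and $\bar G^y_t$ is the analogous expression with $\nu_Y,m_Y$, perturbations of $y$ and its own samples. In the first-order setting $\bar G_t(x,y)=\frac1{tm}\sum_{i=1}^t\sum_{j=1}^{m}\nabla F_i(x,y,\xi_{ij})$, both blocks using the same $\xi_{ij}\sim P$. For $t=0$ no function is available and $\bar G_0=0$. **Parameters.** $\eta=4T^{-1/4}/\mu$ and, for $p\in\{2,4\}$: $\nu_X=\eta^p(d_X+3)^{-3/2}$,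 $m_X=\lceil(d_X+5)/\eta^p\rceil$, and similarly $\nu_Y,m_Y$ with $d_Y$ (zeroth-order); $m=\lceil1/\eta^p\rceil$ (first-order). **Conclusion.** The static regret $$\mathfrak R=\mathbb E\Big|\sum_{t=1}^Tf_t(x_t,y_t)-\sum_{t=1}^Tf_t(u^*_{T+1},v^*_{T+1})\Big|$$ is finite and, in both the zeroth-order and the first-order setting, $$\mathfrak R\le C(\sigma+1)T^{3/4}\quad(p=2),\qquad \mathfrak R\le C\big(\sigma T^{1/2}+T^{3/4}\big)\quad(p=4).$$ In the zeroth-order setting the total number of function evaluations is at most $C(d_X+d_Y)T^{5/2}$ for $p=2$ and at most $C(d_X+d_Y)T^{3}$ for $p=4$. -/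

import Mathlib

open MeasureTheory ProbabilityTheory Set

noncomputable section

namespace OnlineSaddle

/-- The Euclidean space `ℝ^d` with its `ℓ²` norm. -/
abbrev Vec (d : ℕ) : Type := EuclideanSpace ℝ (Fin d)

variable {dX dY : ℕ} {Ξ : Type*} [MeasurableSpace Ξ]

/-! ### The functions -/

/-- The partial gradient `∇ₓ F_i(x, y, ξ)`. -/
def gradX (F : ℕ → Vec dX → Vec dY → Ξ → ℝ) (i : ℕ) (x : Vec dX) (y : Vec dY) (ξ : Ξ) : Vec dX :=
  gradient (fun x' => F i x' y ξ) x

/-- The partial gradient `∇_y F_i(x, y, ξ)`. -/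
def gradY (F : ℕ → Vec dX → Vec dY → Ξ → ℝ) (i : ℕ) (x : Vec dX) (y : Vec dY) (ξ : Ξ) : Vec dY :=
  gradient (fun y' => F i x y' ξ) y

/-- The expected function `f_i(x, y) = E_ξ[F_i(x, y, ξ)]`, where `ξ` has law `P`. -/
def meanF (P : Measure Ξ) (F : ℕ → Vec dX → Vec dY → Ξ → ℝ) (i : ℕ) (x : Vec dX) (y : Vec dY) : ℝ :=
  ∫ ξ, F i x y ξ ∂P

/-- The averaged function `J_t(x, y) = (1/t) ∑_{i=1}^t f_i(x, y)`. -/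
def avgF (P : Measure Ξ) (F : ℕ → Vec dX → Vec dY → Ξ → ℝ) (t : ℕ) (x : Vec dX) (y : Vec dY) : ℝ :=
  (1 / (t : ℝ)) * ∑ i ∈ Finset.Icc 1 t, meanF P F i x y

/-! ### The assumptions on `F_1, …, F_T` -/

/-- Each `F_i(·, ·, ξ)` is continuously differentiable on `ℝ^{d_X} × ℝ^{d_Y}`, `μX`-strongly convex
in `x` and `μY`-strongly concave in `y`. -/
structure StronglyConvexConcave (T : ℕ) (F : ℕ → Vec dX → Vec dY → Ξ → ℝ) (μX μY : ℝ) : Prop where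
  contDiff : ∀ i, 1 ≤ i → i ≤ T → ∀ ξ,
    ContDiff ℝ 1 (fun z : Vec dX × Vec dY => F i z.1 z.2 ξ)
  convex : ∀ i, 1 ≤ i → i ≤ T → ∀ y ξ, StrongConvexOn univ μX (fun x => F i x y ξ)
  concave : ∀ i, 1 ≤ i → i ≤ T → ∀ x ξ, StrongConcaveOn univ μY (fun y => F i x y ξ)

/-- Almost surely, `F_i` is `LX`-Lipschitz in `x` and `LY`-Lipschitz in `y` on `SX × SY`.
For `SX = univ`, `SY = univ` this is the global Lipschitz condition. -/
structure LipschitzOnRegion (T : ℕ) (P : Measure Ξ) (F : ℕ → Vec dX → Vec dY → Ξ → ℝ)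
    (SX : Set (Vec dX)) (SY : Set (Vec dY)) (LX LY : ℝ) : Prop where
  lipX : ∀ i, 1 ≤ i → i ≤ T → ∀ᵐ ξ ∂P, ∀ x₁ ∈ SX, ∀ x₂ ∈ SX, ∀ y ∈ SY,
    |F i x₁ y ξ - F i x₂ y ξ| ≤ LX * ‖x₁ - x₂‖
  lipY : ∀ i, 1 ≤ i → i ≤ T → ∀ᵐ ξ ∂P, ∀ x ∈ SX, ∀ y₁ ∈ SY, ∀ y₂ ∈ SY,
    |F i x y₁ ξ - F i x y₂ ξ| ≤ LY * ‖y₁ - y₂‖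

/-- Almost surely, `∇ₓ F_i` is `LGX`-Lipschitz in `x` and `∇_y F_i` is `LGY`-Lipschitz in `y`. -/
structure LipschitzGradient (T : ℕ) (P : Measure Ξ) (F : ℕ → Vec dX → Vec dY → Ξ → ℝ)
    (LGX LGY : ℝ) : Prop where
  lipX : ∀ i, 1 ≤ i → i ≤ T → ∀ᵐ ξ ∂P, ∀ x₁ x₂ y,
    ‖gradX F i x₁ y ξ - gradX F i x₂ y ξ‖ ≤ LGX * ‖x₁ - x₂‖
  lipY : ∀ i, 1 ≤ i → i ≤ T → ∀ᵐ ξ ∂P, ∀ x y₁ y₂,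
    ‖gradY F i x y₁ ξ - gradY F i x y₂ ξ‖ ≤ LGY * ‖y₁ - y₂‖

/-- Almost surely, `∇ₓ F_i` is `LXY`-Lipschitz in `y` and `∇_y F_i` is `LYX`-Lipschitz in `x`. -/
structure LipschitzPartialGradient (T : ℕ) (P : Measure Ξ) (F : ℕ → Vec dX → Vec dY → Ξ → ℝ)
    (LXY LYX : ℝ) : Prop where
  lipXY : ∀ i, 1 ≤ i → i ≤ T → ∀ᵐ ξ ∂P, ∀ x y₁ y₂,
    ‖gradX F i x y₁ ξ - gradX F i x y₂ ξ‖ ≤ LXY * ‖y₁ - y₂‖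
  lipYX : ∀ i, 1 ≤ i → i ≤ T → ∀ᵐ ξ ∂P, ∀ x₁ x₂ y,
    ‖gradY F i x₁ y ξ - gradY F i x₂ y ξ‖ ≤ LYX * ‖x₁ - x₂‖

/-- Almost surely, `F_i(·, ·, ξ)` is three times continuously differentiable and each of the eight
blocks `∇³_{xxx}, ∇³_{xxy}, …, ∇³_{yyy}` of its third derivative has tensor operator norm at most
`LH`: the third differential is evaluated on vectors each of which lies in one of the two factors
of `ℝ^{d_X} × ℝ^{d_Y}` (on such vectors the product norm is the Euclidean norm of the nonzero
component). -/
def BoundedThirdDerivative (T : ℕ) (P : Measure Ξ) (F : ℕ → Vec dX → Vec dY → Ξ → ℝ)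
    (LH : ℝ) : Prop :=
  ∀ i, 1 ≤ i → i ≤ T → ∀ᵐ ξ ∂P,
    ContDiff ℝ 3 (fun z : Vec dX × Vec dY => F i z.1 z.2 ξ) ∧
    ∀ (z : Vec dX × Vec dY) (h : Fin 3 → Vec dX × Vec dY),
      (∀ k, (h k).1 = 0 ∨ (h k).2 = 0) →
      |iteratedFDeriv ℝ 3 (fun z : Vec dX × Vec dY => F i z.1 z.2 ξ) z h| ≤ LH * ∏ k, ‖h k‖

/-- The stochastic oracle: `F_i(x, y, ξ)` and `∇F_i(x, y, ξ)`, with `ξ` of law `P`, are unbiased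
estimators of `f_i(x, y)` and `∇f_i(x, y)` (the first by the definition of `f_i`), and the variance
of each partial gradient is at most `σ²`. -/
structure StochasticOracle (T : ℕ) (P : Measure Ξ) (F : ℕ → Vec dX → Vec dY → Ξ → ℝ)
    (σ : ℝ) : Prop where
  measurable : ∀ i, 1 ≤ i → i ≤ T →
    Measurable (fun p : (Vec dX × Vec dY) × Ξ => F i p.1.1 p.1.2 p.2)
  integrable : ∀ i, 1 ≤ i → i ≤ T → ∀ x y, Integrable (F i x y) P
  integrable_gradX : ∀ i, 1 ≤ i → i ≤ T → ∀ x y, Integrable (gradX F i x y) P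
  integrable_gradY : ∀ i, 1 ≤ i → i ≤ T → ∀ x y, Integrable (gradY F i x y) P
  mean_gradX : ∀ i, 1 ≤ i → i ≤ T → ∀ x y,
    HasGradientAt (fun x' => meanF P F i x' y) (∫ ξ, gradX F i x y ξ ∂P) x
  mean_gradY : ∀ i, 1 ≤ i → i ≤ T → ∀ x y,
    HasGradientAt (fun y' => meanF P F i x y') (∫ ξ, gradY F i x y ξ ∂P) y
  integrable_varX : ∀ i, 1 ≤ i → i ≤ T → ∀ x y,
    Integrable (fun ξ => ‖gradX F i x y ξ - gradient (fun x' => meanF P F i x' y) x‖ ^ 2) P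
  integrable_varY : ∀ i, 1 ≤ i → i ≤ T → ∀ x y,
    Integrable (fun ξ => ‖gradY F i x y ξ - gradient (fun y' => meanF P F i x y') y‖ ^ 2) P
  varX : ∀ i, 1 ≤ i → i ≤ T → ∀ x y,
    ∫ ξ, ‖gradX F i x y ξ - gradient (fun x' => meanF P F i x' y) x‖ ^ 2 ∂P ≤ σ ^ 2
  varY : ∀ i, 1 ≤ i → i ≤ T → ∀ x y,
    ∫ ξ, ‖gradY F i x y ξ - gradient (fun y' => meanF P F i x y') y‖ ^ 2 ∂P ≤ σ ^ 2

/-! ### Gradient estimators (static regret) -/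

/-- The zeroth-order estimator at round `t`,
`(1/(t m_X)) ∑_{i=1}^t ∑_{j<m_X} ((F_i(x + ν_X u_{ij}, y, ξ_{ij}) - F_i(x, y, ξ_{ij})) / ν_X) u_{ij}`
for the `x`-block and likewise for the `y`-block. The sample `s i j` is
`((ξ_{ijx}, u_{ijx}), (ξ_{ijy}, u_{ijy}))`. For `t = 0` the sums are empty and the estimate is `0`.
-/
def gradestZeroth (F : ℕ → Vec dX → Vec dY → Ξ → ℝ) (t mX mY : ℕ) (νX νY : ℝ)
    (s : ℕ → ℕ → (Ξ × Vec dX) × (Ξ × Vec dY)) (z : Vec dX × Vec dY) : Vec dX × Vec dY :=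
  ((1 / ((t : ℝ) * mX)) • ∑ i ∈ Finset.Icc 1 t, ∑ j ∈ Finset.range mX,
      ((F i (z.1 + νX • (s i j).1.2) z.2 (s i j).1.1 - F i z.1 z.2 (s i j).1.1) / νX) •
        (s i j).1.2,
   (1 / ((t : ℝ) * mY)) • ∑ i ∈ Finset.Icc 1 t, ∑ j ∈ Finset.range mY,
      ((F i z.1 (z.2 + νY • (s i j).2.2) (s i j).2.1 - F i z.1 z.2 (s i j).2.1) / νY) •
        (s i j).2.2)

/-- The first-order estimator at round `t`, `(1/(t m)) ∑_{i=1}^t ∑_{j<m} ∇F_i(x, y, ξ_{ij})`.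
For `t = 0` the sum is empty and the estimate is `0`. -/
def gradestFirst (F : ℕ → Vec dX → Vec dY → Ξ → ℝ) (t m : ℕ)
    (s : ℕ → ℕ → Ξ) (z : Vec dX × Vec dY) : Vec dX × Vec dY :=
  ((1 / ((t : ℝ) * m)) • ∑ i ∈ Finset.Icc 1 t, ∑ j ∈ Finset.range m, gradX F i z.1 z.2 (s i j),
   (1 / ((t : ℝ) * m)) • ∑ i ∈ Finset.Icc 1 t, ∑ j ∈ Finset.range m, gradY F i z.1 z.2 (s i j))

/-! ### The extragradient method -/

/-- A descent step in `x` and an ascent step in `y` from `z`, with direction `g`. -/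
def gdaStep (η : ℝ) (z g : Vec dX × Vec dY) : Vec dX × Vec dY := (z.1 - η • g.1, z.2 + η • g.2)

/-- The extragradient iterates `(x_t, y_t)`. In round `t` the estimator is called twice: `G t 0` at
`(x_t, y_t)`, which gives `(x_{t+1/2}, y_{t+1/2})`, and `G t 1` at that point, which gives
`(x_{t+1}, y_{t+1})`. -/
def egIter (η : ℝ) (G : ℕ → Fin 2 → Vec dX × Vec dY → Vec dX × Vec dY) (z₀ : Vec dX × Vec dY) :
    ℕ → Vec dX × Vec dY
  | 0 => z₀
  | t + 1 => gdaStep η (egIter η G z₀ t) (G t 1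
      (gdaStep η (egIter η G z₀ t) (G t 0 (egIter η G z₀ t))))

/-- Index of a sample: round `t`, call `k` of the estimator in that round, function `i`,
mini-batch position `j`. -/
abbrev SampleIdx : Type := ℕ × Fin 2 × ℕ × ℕ

/-- The independent samples of the zeroth-order method: all `ξ_{ijx}, ξ_{ijy}` have law `P`, all
`u_{ijx}, u_{ijy}` are standard Gaussian vectors, and all of them, over all rounds and all calls of
the estimator, are independent. -/
structure IsZerothSample {Ω : Type*} [MeasurableSpace Ω] (Pr : Measure Ω) (P : Measure Ξ)
    (s : SampleIdx → Ω → (Ξ × Vec dX) × (Ξ × Vec dY)) : Prop where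
  measurable : ∀ a, Measurable (s a)
  law : ∀ a, Measure.map (s a) Pr =
    (P.prod (stdGaussian (Vec dX))).prod (P.prod (stdGaussian (Vec dY)))
  indep : iIndepFun s Pr

/-- The independent samples `ξ_{ij}` of law `P` of the first-order method. -/
structure IsFirstSample {Ω : Type*} [MeasurableSpace Ω] (Pr : Measure Ω) (P : Measure Ξ)
    (s : SampleIdx → Ω → Ξ) : Prop where
  measurable : ∀ a, Measurable (s a)
  law : ∀ a, Measure.map (s a) Pr = P
  indep : iIndepFun s Pr

/-! ### Parameters -/

/-- The step size `η_t = 4 T^{-1/4} / μ`. -/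
def stepSize (μ : ℝ) (T : ℕ) : ℝ := 4 * (T : ℝ) ^ (-(1 / 4) : ℝ) / μ

/-- The smoothing parameter `ν = η^p (d + 3)^{-3/2}`. -/
def smoothing (p : ℕ) (η : ℝ) (d : ℕ) : ℝ := η ^ p * ((d : ℝ) + 3) ^ (-(3 / 2) : ℝ)

/-- The zeroth-order batch size `m = (d + 5) / η^p`, rounded up to an integer. -/
def batchZeroth (p : ℕ) (η : ℝ) (d : ℕ) : ℕ := ⌈((d : ℝ) + 5) / η ^ p⌉₊

/-- The first-order batch size `m = 1 / η^p`, rounded up to an integer. -/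
def batchFirst (p : ℕ) (η : ℝ) : ℕ := ⌈1 / η ^ p⌉₊

/-- The iterates of the zeroth-order extragradient method with horizon `T` on the outcome `ω`. -/
def zerothIter {Ω : Type*} (p : ℕ) (μ : ℝ) (T : ℕ) (F : ℕ → Vec dX → Vec dY → Ξ → ℝ)
    (z₀ : Vec dX × Vec dY) (s : SampleIdx → Ω → (Ξ × Vec dX) × (Ξ × Vec dY)) (ω : Ω) :
    ℕ → Vec dX × Vec dY :=
  let η := stepSize μ T
  egIter η (fun t k => gradestZeroth F t (batchZeroth p η dX) (batchZeroth p η dY)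
    (smoothing p η dX) (smoothing p η dY) (fun i j => s (t, k, i, j) ω)) z₀

/-- The iterates of the first-order extragradient method with horizon `T` on the outcome `ω`. -/
def firstIter {Ω : Type*} (p : ℕ) (μ : ℝ) (T : ℕ) (F : ℕ → Vec dX → Vec dY → Ξ → ℝ)
    (z₀ : Vec dX × Vec dY) (s : SampleIdx → Ω → Ξ) (ω : Ω) : ℕ → Vec dX × Vec dY :=
  let η := stepSize μ T
  egIter η (fun t k => gradestFirst F t (batchFirst p η) (fun i j => s (t, k, i, j) ω)) z₀

/-- The number of evaluations of the zeroth-order oracle in one call of `gradestZeroth` at round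
`t`: two for each function `i`, each block and each mini-batch position. -/
def zerothQueries (t mX mY : ℕ) : ℕ :=
  (∑ _i ∈ Finset.Icc 1 t, ∑ _j ∈ Finset.range mX, 2) +
    ∑ _i ∈ Finset.Icc 1 t, ∑ _j ∈ Finset.range mY, 2

/-- The number of oracle evaluations of the zeroth-order extragradient method in the rounds
`t = 0, …, T - 1`; in each of them the estimator is called twice. -/
def totalZerothQueries (p : ℕ) (μ : ℝ) (T dX dY : ℕ) : ℕ :=
  ∑ t ∈ Finset.range T, ∑ _k : Fin 2,
    zerothQueries t (batchZeroth p (stepSize μ T) dX) (batchZeroth p (stepSize μ T) dY)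

/-! ### Regret -/

/-- `|∑_{t=1}^T f_t(x_t, y_t) - ∑_{t=1}^T f_t(u, v)|`. -/
def regretVar (P : Measure Ξ) (F : ℕ → Vec dX → Vec dY → Ξ → ℝ) (T : ℕ)
    (z : ℕ → Vec dX × Vec dY) (u : Vec dX) (v : Vec dY) : ℝ :=
  |∑ t ∈ Finset.Icc 1 T, meanF P F t (z t).1 (z t).2 - ∑ t ∈ Finset.Icc 1 T, meanF P F t u v|

/-- The static saddle-point regret, the expectation of `regretVar` along the random iterates `z`,
is finite and at most `B`. -/
def RegretLE {Ω : Type*} [MeasurableSpace Ω] (Pr : Measure Ω) (P : Measure Ξ)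
    (F : ℕ → Vec dX → Vec dY → Ξ → ℝ) (T : ℕ) (z : Ω → ℕ → Vec dX × Vec dY)
    (u : Vec dX) (v : Vec dY) (B : ℝ) : Prop :=
  Integrable (fun ω => regretVar P F T (z ω) u v) Pr ∧
    ∫ ω, regretVar P F T (z ω) u v ∂Pr ≤ B

end OnlineSaddle

end

set_option linter.unusedSectionVars false

namespace OnlineSaddle

open scoped RealInnerProductSpace

/-! ### Convexity and smoothness along partial gradients -/

section Smooth

variable {X Y : Type*} [NormedAddCommGroup X] [InnerProductSpace ℝ X] [CompleteSpace X]
  [NormedAddCommGroup Y] [InnerProductSpace ℝ Y] [CompleteSpace Y]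

/-! Write `z_t` for the iterate, `w_t` for the saddle point of `J_t` (index `t + 1` in `u`, `v`),
`a_i = (∇ₓ f_i, -∇_y f_i)`, `A_t` for the average of `a_1, …, a_t`, and `m = min μX μY`.

Strong convexity-concavity makes these operators `m`-strongly monotone, the Lipschitz bounds on the
partial gradients make them `4L`-Lipschitz, and, since the start lies in the open set `SX × SY`, the
partial gradients there are bounded by `B`. All three properties hold for almost every `F_i(·, ·,
ξ)` and survive expectations and averages (`RegularSaddle`). Consequently `‖z_0 - w_t‖ ≤ 2B/m`, and
`‖a_i(w_t)‖ ≤ G := 2B + 4L·2B/m` for all `i`, `t`.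

The saddle path moves slowly: `a_1 + … + a_t` vanishes at `w_t`, so `A_{t+1}(w_t) =
a_{t+1}(w_t)/(t+1)`, and strong monotonicity gives `‖w_t - w_{t+1}‖ ≤ (G/m)/(t+1)`
(`SaddlePath.drift_le`). As `J_t` is stationary at `w_t`, its value changes only quadratically, so
`t |J_t(w_{t+1}) - J_t(w_t)| = O(1/t)`. A follow-the-leader induction then shows that playing `w_t`
in round `t` differs from playing `w_T` throughout by `O(∑ 1/t)` (`SaddlePath.follow_the_leader`).
What remains is to sum `E d_t` and `E d_t²`, where `d_t = ‖z_t - w_t‖` (`SaddlePath.regret_le`).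

Noise: at a fixed `z` the stochastic gradients are almost surely at most `(B + 2L)(1 + ‖z - z_0‖)`.
A batch of size about `η^{-p}` (times the dimension for Gaussian differences) thus has an `L²`
deviation `O(η (1 + ‖z - z_0‖))`, and the finite-difference error, of order `ν d^{3/2}`, is `O(η)`.
Each call uses samples independent of its query point, so the bound transfers to the random iterates
(`eLpNorm_indep_le`).

An extragradient step is a plain gradient step up to second order in `η`, and the noise enters
multiplied by `η`. By Minkowski, one round sends an `L²` bound `α` on the distance to `(1 - ηm +
O(η²)) α + O(η²)` (`NoiseBound.step`), and the drift adds `O(1/t)`. With `η = 4T^{-1/4}/m` the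
contraction rate is of order `T^{-1/4}`. Summing the recursion and dividing by the rate gives
`T^{1/4} (T · T^{-1/2} + ∑ 1/t) = O(T^{3/4})`, and squares are handled in the same way
(`exists_sum_trackSeq_le`). The regret is therefore at most `R T^{3/4}` with `R` free of `σ` and the
same for `p = 2` and `p = 4`. Both claimed bounds dominate this quantity. -/

/-- The first-order lower bound for a strongly convex function. -/
theorem StrongConvexOn.add_inner_add_le {f : X → ℝ} {g x : X} {m : ℝ}
    (hf : StrongConvexOn univ m f) (hg : HasGradientAt f g x) (y : X) :
    f x + ⟪g, y - x⟫ + m / 2 * ‖y - x‖ ^ 2 ≤ f y := by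
  have hd : HasDerivAt (fun a : ℝ => f (x + a • (y - x))) (⟪g, y - x⟫) 0 := by
    have h1 : HasFDerivAt f (InnerProductSpace.toDual ℝ X g) (x + (0 : ℝ) • (y - x)) := by
      simpa using hg.hasFDerivAt
    have h2 : HasDerivAt (fun a : ℝ => x + a • (y - x)) (y - x) 0 := by
      simpa using ((hasDerivAt_id (0 : ℝ)).smul_const (y - x)).const_add x
    have h3 := h1.comp_hasDerivAt (0 : ℝ) h2
    rw [InnerProductSpace.toDual_apply_apply] at h3
    exact h3
  have h3 := hd.tendsto_slope_zero_right
  have h4 : Filter.Tendsto (fun a : ℝ => f y - f x - (1 - a) * (m / 2 * ‖y - x‖ ^ 2))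
      (nhdsWithin 0 (Ioi 0)) (nhds (f y - f x - (1 - 0) * (m / 2 * ‖y - x‖ ^ 2))) := by
    apply Filter.Tendsto.mono_left _ nhdsWithin_le_nhds
    apply Continuous.tendsto
    fun_prop
  -- For `0 < a < 1`, strong convexity on the segment, divided by `a`, bounds the difference
  -- quotient; then `a → 0⁺`.
  have h5 := le_of_tendsto_of_tendsto h3 h4 (by
    filter_upwards [Ioo_mem_nhdsGT (zero_lt_one' ℝ)] with a ha
    have := hf.2 (mem_univ x) (mem_univ y) (sub_nonneg.2 ha.2.le) ha.1.le (by ring)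
    have e : (1 - a) • x + a • y = x + a • (y - x) := by module
    rw [e] at this
    simp only [smul_eq_mul, zero_add, zero_smul, add_zero] at this ⊢
    rw [norm_sub_rev x y] at this
    rw [inv_mul_le_iff₀ ha.1]
    nlinarith [this])
  linarith

/-- A function with Lipschitz gradient is close to its linearization. -/
theorem abs_sub_sub_inner_le {f : X → ℝ} {g : X → X} {L : ℝ}
    (hg : ∀ x, HasGradientAt f (g x) x) (hL : ∀ x y, ‖g x - g y‖ ≤ L * ‖x - y‖) (x y : X) :
    |f x - f y - ⟪g y, x - y⟫| ≤ L * ‖x - y‖ ^ 2 := by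
  have hL0 : 0 ≤ L * ‖x - y‖ := (norm_nonneg _).trans (hL x y)
  -- Mean value inequality on the segment for `f` minus its linearization at `y`. This yields the
  -- constant `L` rather than the sharp `L / 2`, which is enough here.
  have h := (convex_segment y x).norm_image_sub_le_of_norm_hasFDerivWithin_le' (𝕜 := ℝ)
    (f := f) (f' := fun z => InnerProductSpace.toDual ℝ X (g z))
    (φ := InnerProductSpace.toDual ℝ X (g y)) (C := L * ‖x - y‖)
    (fun z _ => (hg z).hasFDerivAt.hasFDerivWithinAt)
    (fun z hz => by
      rw [← map_sub, LinearIsometryEquiv.norm_map]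
      refine (hL z y).trans ?_
      obtain ⟨a, ha, rfl⟩ := (segment_eq_image' ℝ y x ▸ hz : z ∈ (fun θ : ℝ => y + θ • (x - y)) '' Icc 0 1)
      rw [add_sub_cancel_left, norm_smul, Real.norm_of_nonneg ha.1]
      nlinarith [ha.1, ha.2])
    (left_mem_segment ℝ y x) (right_mem_segment ℝ y x)
  simpa [Real.norm_eq_abs, pow_two, mul_assoc] using h

/-- The gradient of an `L`-Lipschitz function on an open set is bounded by `L`. -/
theorem norm_gradient_le_of_lipschitzOn {f : X → ℝ} {g x : X} {L : ℝ} {S : Set X}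
    (hS : IsOpen S) (hx : x ∈ S) (hg : HasGradientAt f g x) (hL0 : 0 ≤ L)
    (hL : ∀ x₁ ∈ S, ∀ x₂ ∈ S, |f x₁ - f x₂| ≤ L * ‖x₁ - x₂‖) : ‖g‖ ≤ L := by
  have h := hg.hasFDerivAt.le_of_lip' hL0 (by
    filter_upwards [hS.mem_nhds hx] with z hz
    simpa [Real.norm_eq_abs] using hL z hz x hx)
  simpa using h

/-- A function of two variables with partial gradients `gx`, `gy` that are `L`-Lipschitz, whose
saddle operator `(gx, -gy)` is `m`-strongly monotone, and whose partial gradients at `(x₀, y₀)` are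
bounded by `B`. -/
structure RegularSaddle (f : X → Y → ℝ) (gx : X → Y → X) (gy : X → Y → Y) (m L B : ℝ)
    (x₀ : X) (y₀ : Y) : Prop where
  gradX : ∀ x y, HasGradientAt (fun x' => f x' y) (gx x y) x
  gradY : ∀ x y, HasGradientAt (fun y' => f x y') (gy x y) y
  lipX : ∀ x x' y y', ‖gx x y - gx x' y'‖ ≤ L * (‖x - x'‖ + ‖y - y'‖)
  lipY : ∀ x x' y y', ‖gy x y - gy x' y'‖ ≤ L * (‖x - x'‖ + ‖y - y'‖)
  mono : ∀ x x' y y', m * (‖x - x'‖ ^ 2 + ‖y - y'‖ ^ 2) ≤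
    ⟪gx x y - gx x' y', x - x'⟫ - ⟪gy x y - gy x' y', y - y'⟫
  boundX : ‖gx x₀ y₀‖ ≤ B
  boundY : ‖gy x₀ y₀‖ ≤ B

/-- Strong convexity-concavity gives strong monotonicity of the saddle operator. -/
theorem strongMono_of_strongConvexConcave {f : X → Y → ℝ} {gx : X → Y → X} {gy : X → Y → Y}
    {mX mY : ℝ} (hx : ∀ y, StrongConvexOn univ mX (fun x => f x y))
    (hy : ∀ x, StrongConcaveOn univ mY (fun y => f x y))
    (hgx : ∀ x y, HasGradientAt (fun x' => f x' y) (gx x y) x)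
    (hgy : ∀ x y, HasGradientAt (fun y' => f x y') (gy x y) y) (x x' : X) (y y' : Y) :
    min mX mY * (‖x - x'‖ ^ 2 + ‖y - y'‖ ^ 2) ≤
      ⟪gx x y - gx x' y', x - x'⟫ - ⟪gy x y - gy x' y', y - y'⟫ := by
  have hng : ∀ x y, HasGradientAt (fun y' => - f x y') (- gy x y) y := fun x y => by
    have := (hgy x y).hasFDerivAt.neg
    rw [hasGradientAt_iff_hasFDerivAt, map_neg]
    exact this
  -- Lower bounds between the four corners `(x or x', y or y')`. In their sum every function value
  -- cancels and only the inner products remain.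
  have a1 := StrongConvexOn.add_inner_add_le (hx y) (hgx x y) x'
  have a2 := StrongConvexOn.add_inner_add_le (hx y') (hgx x' y') x
  have a3 := StrongConvexOn.add_inner_add_le (hy x).neg (hng x y) y'
  have a4 := StrongConvexOn.add_inner_add_le (hy x').neg (hng x' y') y
  simp only [Pi.neg_apply] at a3 a4
  rw [norm_sub_rev x' x, ← neg_sub x x', inner_neg_right] at a1
  rw [norm_sub_rev y' y, ← neg_sub y y', inner_neg_right, inner_neg_left] at a3
  rw [inner_neg_left] at a4
  rw [inner_sub_left, inner_sub_left]
  have b1 := mul_le_mul_of_nonneg_right (min_le_left mX mY) (sq_nonneg ‖x - x'‖)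
  have b2 := mul_le_mul_of_nonneg_right (min_le_right mX mY) (sq_nonneg ‖y - y'‖)
  linarith

/-- The norm of an average is at most a common bound for the norms of its terms. -/
theorem norm_average_le {V : Type*} [NormedAddCommGroup V] [NormedSpace ℝ V] {t : ℕ} (ht : 1 ≤ t)
    {v : ℕ → V} {b : ℝ} (hv : ∀ i ∈ Finset.Icc 1 t, ‖v i‖ ≤ b) :
    ‖(1 / (t : ℝ)) • ∑ i ∈ Finset.Icc 1 t, v i‖ ≤ b := by
  have ht0 : (0 : ℝ) < t := by exact_mod_cast ht
  rw [norm_smul, Real.norm_of_nonneg (by positivity), one_div, inv_mul_le_iff₀ ht0]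
  refine (norm_sum_le_of_le _ hv).trans ?_
  simp

/-- The gradient of an average is the average of the gradients. -/
theorem hasGradientAt_average {V : Type*} [NormedAddCommGroup V] [InnerProductSpace ℝ V]
    [CompleteSpace V] {t : ℕ} {φ : ℕ → V → ℝ} {g : ℕ → V} {v : V}
    (hφ : ∀ i ∈ Finset.Icc 1 t, HasGradientAt (φ i) (g i) v) :
    HasGradientAt (fun v => (1 / (t : ℝ)) * ∑ i ∈ Finset.Icc 1 t, φ i v)
      ((1 / (t : ℝ)) • ∑ i ∈ Finset.Icc 1 t, g i) v := by
  rw [hasGradientAt_iff_hasFDerivAt, map_smul, map_sum]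
  exact (HasFDerivAt.fun_sum fun i hi => (hφ i hi).hasFDerivAt).const_mul _

namespace RegularSaddle

variable {f : X → Y → ℝ} {gx : X → Y → X} {gy : X → Y → Y} {m L B : ℝ} {x₀ : X} {y₀ : Y}

/-- Growth of a regular function around a point `(x', y')`. -/
theorem abs_sub_le (h : RegularSaddle f gx gy m L B x₀ y₀) (hL : 0 ≤ L) (x x' : X) (y y' : Y) :
    |f x y - f x' y'| ≤ (‖gx x' y'‖ * ‖x - x'‖ + ‖gy x' y'‖ * ‖y - y'‖) +
      2 * L * (‖x - x'‖ ^ 2 + ‖y - y'‖ ^ 2) := by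
  -- The path goes from `(x', y')` to `(x', y)` and then to `(x, y)`. The `x`-gradient met at `(x',
  -- y)` is moved back to `(x', y')` at the cost of a mixed term `L ‖x - x'‖ ‖y - y'‖`.
  have h1 := abs_sub_sub_inner_le (fun z => h.gradX z y)
    (fun z w => by simpa using h.lipX z w y y) x x'
  have h2 := abs_sub_sub_inner_le (fun z => h.gradY x' z)
    (fun z w => by simpa using h.lipY x' x' z w) y y'
  have h3 := abs_real_inner_le_norm (gx x' y) (x - x')
  have h4 := abs_real_inner_le_norm (gy x' y') (y - y')
  have h5 : ‖gx x' y‖ ≤ ‖gx x' y'‖ + L * ‖y - y'‖ := by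
    have := h.lipX x' x' y y'
    simp only [sub_self, norm_zero, zero_add] at this
    linarith [norm_sub_norm_le (gx x' y) (gx x' y')]
  have h6 := mul_le_mul_of_nonneg_right h5 (norm_nonneg (x - x'))
  have h7 : f x y - f x' y' = (f x y - f x' y - ⟪gx x' y, x - x'⟫) +
      (f x' y - f x' y' - ⟪gy x' y', y - y'⟫) + ⟪gx x' y, x - x'⟫ + ⟪gy x' y', y - y'⟫ := by ring
  rw [h7]
  have h8 : L * (‖y - y'‖ * ‖x - x'‖) ≤ L * (‖x - x'‖ ^ 2 + ‖y - y'‖ ^ 2) :=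
    mul_le_mul_of_nonneg_left (by
      have := two_mul_le_add_sq ‖y - y'‖ ‖x - x'‖
      nlinarith [norm_nonneg (y - y'), norm_nonneg (x - x'),
        mul_nonneg (norm_nonneg (y - y')) (norm_nonneg (x - x'))]) hL
  refine (abs_add_le _ _).trans ?_
  refine (add_le_add_left (abs_add_three _ _ _) _).trans ?_
  linarith

/-- The average of regular functions is regular. -/
theorem average {f : ℕ → X → Y → ℝ} {gx : ℕ → X → Y → X} {gy : ℕ → X → Y → Y} {t : ℕ}
    (ht : 1 ≤ t) (h : ∀ i ∈ Finset.Icc 1 t, RegularSaddle (f i) (gx i) (gy i) m L B x₀ y₀) :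
    RegularSaddle (fun x y => (1 / (t : ℝ)) * ∑ i ∈ Finset.Icc 1 t, f i x y)
      (fun x y => (1 / (t : ℝ)) • ∑ i ∈ Finset.Icc 1 t, gx i x y)
      (fun x y => (1 / (t : ℝ)) • ∑ i ∈ Finset.Icc 1 t, gy i x y) m L B x₀ y₀ := by
  have ht0 : (0 : ℝ) < t := by exact_mod_cast ht
  refine ⟨fun x y => hasGradientAt_average fun i hi => (h i hi).gradX x y,
    fun x y => hasGradientAt_average fun i hi => (h i hi).gradY x y, fun x x' y y' => ?_,
    fun x x' y y' => ?_, fun x x' y y' => ?_, norm_average_le ht fun i hi => (h i hi).boundX,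
    norm_average_le ht fun i hi => (h i hi).boundY⟩
  · rw [← smul_sub, ← Finset.sum_sub_distrib]
    exact norm_average_le ht fun i hi => (h i hi).lipX x x' y y'
  · rw [← smul_sub, ← Finset.sum_sub_distrib]
    exact norm_average_le ht fun i hi => (h i hi).lipY x x' y y'
  · rw [← smul_sub, ← Finset.sum_sub_distrib, ← smul_sub, ← Finset.sum_sub_distrib,
      real_inner_smul_left, real_inner_smul_left, sum_inner, sum_inner, ← mul_sub,
      ← Finset.sum_sub_distrib, one_div, le_inv_mul_iff₀ ht0]
    have := Finset.card_nsmul_le_sum (Finset.Icc 1 t) _ _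
      fun i hi => (h i hi).mono x x' y y'
    simpa using this

/-- The partial gradients vanish at a saddle point. -/
theorem grad_eq_zero (h : RegularSaddle f gx gy m L B x₀ y₀) {u : X} {v : Y}
    (hs : IsSaddlePointOn univ univ f u v) : gx u v = 0 ∧ gy u v = 0 := by
  constructor
  · have h1 : IsLocalMin (fun x' => f x' v) u :=
      Filter.Eventually.of_forall fun x => hs x (mem_univ _) v (mem_univ _)
    have := h1.hasFDerivAt_eq_zero (h.gradX u v).hasFDerivAt
    simpa using this
  · have h1 : IsLocalMax (fun y' => f u y') v :=
      Filter.Eventually.of_forall fun y => hs u (mem_univ _) y (mem_univ _)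
    have := h1.hasFDerivAt_eq_zero (h.gradY u v).hasFDerivAt
    simpa using this

end RegularSaddle

/-! ### The saddle operator -/

/-- The saddle operator `(gx, -gy)` on the Euclidean product. -/
def saddleOp (gx : X → Y → X) (gy : X → Y → Y) (z : WithLp 2 (X × Y)) : WithLp 2 (X × Y) :=
  WithLp.toLp 2 (gx z.fst z.snd, - gy z.fst z.snd)

theorem norm_fst_le_withLp (z : WithLp 2 (X × Y)) : ‖z.fst‖ ≤ ‖z‖ := by
  refine abs_le_of_sq_le_sq' ?_ (norm_nonneg _) |>.2
  rw [WithLp.prod_norm_sq_eq_of_L2]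
  nlinarith [sq_nonneg (‖z.snd‖)]


theorem norm_snd_le_withLp (z : WithLp 2 (X × Y)) : ‖z.snd‖ ≤ ‖z‖ := by
  refine abs_le_of_sq_le_sq' ?_ (norm_nonneg _) |>.2
  rw [WithLp.prod_norm_sq_eq_of_L2]
  nlinarith [sq_nonneg (‖z.fst‖)]

theorem norm_withLp_le_add (z : WithLp 2 (X × Y)) : ‖z‖ ≤ ‖z.fst‖ + ‖z.snd‖ := by
  refine abs_le_of_sq_le_sq' ?_ (by positivity) |>.2
  rw [WithLp.prod_norm_sq_eq_of_L2]
  nlinarith [mul_nonneg (norm_nonneg z.fst) (norm_nonneg z.snd)]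

namespace RegularSaddle

variable {f : X → Y → ℝ} {gx : X → Y → X} {gy : X → Y → Y} {m L B : ℝ} {x₀ : X} {y₀ : Y}

/-- Each block contributes `L (‖Δx‖ + ‖Δy‖) ≤ 2L ‖z - w‖`, and the norm of the pair is at most the
sum of the norms of the two blocks. -/
theorem saddleOp_lipschitz (h : RegularSaddle f gx gy m L B x₀ y₀) (hL : 0 ≤ L)
    (z w : WithLp 2 (X × Y)) : ‖saddleOp gx gy z - saddleOp gx gy w‖ ≤ 4 * L * ‖z - w‖ := by
  refine (norm_withLp_le_add _).trans ?_
  have h1 := h.lipX z.fst w.fst z.snd w.snd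
  have h2 := h.lipY z.fst w.fst z.snd w.snd
  have h3 : ‖(saddleOp gx gy z - saddleOp gx gy w).fst‖ =
    ‖gx z.fst z.snd - gx w.fst w.snd‖ := rfl
  have h4 : ‖(saddleOp gx gy z - saddleOp gx gy w).snd‖ =
      ‖gy z.fst z.snd - gy w.fst w.snd‖ := by
    rw [← norm_neg]
    congr 1
    change -(- _ - - _) = _
    abel
  rw [h3, h4]
  have h5 : ‖z.fst - w.fst‖ ≤ ‖z - w‖ := norm_fst_le_withLp (z - w)
  have h6 : ‖z.snd - w.snd‖ ≤ ‖z - w‖ := norm_snd_le_withLp (z - w)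
  have h7 := mul_le_mul_of_nonneg_left (add_le_add h5 h6) hL
  linarith

theorem saddleOp_mono (h : RegularSaddle f gx gy m L B x₀ y₀) (z w : WithLp 2 (X × Y)) :
    m * ‖z - w‖ ^ 2 ≤ ⟪saddleOp gx gy z - saddleOp gx gy w, z - w⟫ := by
  have := h.mono z.fst w.fst z.snd w.snd
  rw [WithLp.prod_norm_sq_eq_of_L2, WithLp.prod_inner_apply]
  have e : ⟪(saddleOp gx gy z - saddleOp gx gy w).ofLp.2, (z - w).ofLp.2⟫ =
      - ⟪gy z.fst z.snd - gy w.fst w.snd, z.snd - w.snd⟫ := by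
    rw [← inner_neg_left]
    congr 1
    change - _ - - _ = _
    abel
  rw [e, ← sub_eq_add_neg]
  exact this

theorem saddleOp_eq_zero (h : RegularSaddle f gx gy m L B x₀ y₀) {u : X} {v : Y}
    (hs : IsSaddlePointOn univ univ f u v) : saddleOp gx gy (WithLp.toLp 2 (u, v)) = 0 := by
  obtain ⟨h1, h2⟩ := h.grad_eq_zero hs
  change WithLp.toLp 2 (gx u v, - gy u v) = 0
  rw [h1, h2, neg_zero]
  rfl

/-- The distance of a point to the saddle point is controlled by the gradient at that point. -/
theorem dist_saddle_le (h : RegularSaddle f gx gy m L B x₀ y₀)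
    {w : WithLp 2 (X × Y)} (hw : saddleOp gx gy w = 0) (z : WithLp 2 (X × Y)) :
    m * ‖z - w‖ ≤ ‖saddleOp gx gy z‖ := by
  have h1 := h.saddleOp_mono z w
  rw [hw, sub_zero] at h1
  have h2 := real_inner_le_norm (saddleOp gx gy z) (z - w)
  rcases (norm_nonneg (z - w)).eq_or_lt with h0 | h0
  · rw [← h0, mul_zero]
    exact norm_nonneg _
  · nlinarith

theorem norm_saddleOp_start_le (h : RegularSaddle f gx gy m L B x₀ y₀) :
    ‖saddleOp gx gy (WithLp.toLp 2 (x₀, y₀))‖ ≤ 2 * B := by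
  refine (norm_withLp_le_add _).trans ?_
  have h1 : ‖(saddleOp gx gy (WithLp.toLp 2 (x₀, y₀))).fst‖ = ‖gx x₀ y₀‖ := rfl
  have h2 : ‖(saddleOp gx gy (WithLp.toLp 2 (x₀, y₀))).snd‖ = ‖gy x₀ y₀‖ := norm_neg _
  rw [h1, h2]
  linarith [h.boundX, h.boundY]

/-- Growth of a regular function around `w`, in the Euclidean product norm. -/
theorem abs_sub_le_withLp (h : RegularSaddle f gx gy m L B x₀ y₀) (hL : 0 ≤ L)
    (z w : WithLp 2 (X × Y)) : |f z.fst z.snd - f w.fst w.snd| ≤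
      2 * ‖saddleOp gx gy w‖ * ‖z - w‖ + 2 * L * ‖z - w‖ ^ 2 := by
  refine (h.abs_sub_le hL z.fst w.fst z.snd w.snd).trans ?_
  rw [WithLp.prod_norm_sq_eq_of_L2 (z - w)]
  have h1 : ‖gx w.fst w.snd‖ ≤ ‖saddleOp gx gy w‖ := norm_fst_le_withLp (saddleOp gx gy w)
  have h2 : ‖gy w.fst w.snd‖ ≤ ‖saddleOp gx gy w‖ := by
    rw [← norm_neg]
    exact norm_snd_le_withLp (saddleOp gx gy w)
  have h5 : ‖z.fst - w.fst‖ ≤ ‖z - w‖ := norm_fst_le_withLp (z - w)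
  have h6 : ‖z.snd - w.snd‖ ≤ ‖z - w‖ := norm_snd_le_withLp (z - w)
  have h7 := mul_le_mul h1 h5 (norm_nonneg _) (norm_nonneg _)
  have h8 := mul_le_mul h2 h6 (norm_nonneg _) (norm_nonneg _)
  simp only [WithLp.sub_fst, WithLp.sub_snd]
  linarith

end RegularSaddle

end Smooth

/-! ### One step of the extragradient method -/

/-- One extragradient step with inexact directions `g₁`, `g₂` on a strongly monotone Lipschitz
operator with zero `w`. -/
theorem extragradient_step {E : Type*} [NormedAddCommGroup E] [InnerProductSpace ℝ E] {A : E → E}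
    {m L η : ℝ} (hη : 0 ≤ η) (hL : 0 ≤ L) (hlip : ∀ z w, ‖A z - A w‖ ≤ L * ‖z - w‖)
    (hmono : ∀ z w, m * ‖z - w‖ ^ 2 ≤ ⟪A z - A w, z - w⟫) {w : E} (hw : A w = 0) (hmL : m ≤ L)
    (hm : 0 ≤ m) (z g₁ g₂ : E) :
    ‖z - η • g₁ - w‖ ≤ (1 + η * L) * ‖z - w‖ + η * ‖g₁ - A z‖ ∧
    ‖z - η • g₂ - w‖ ≤ (1 - η * m + 2 * (η * L) ^ 2) * ‖z - w‖ + η ^ 2 * L * ‖g₁ - A z‖ +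
      η * ‖g₂ - A (z - η • g₁)‖ := by
  have hAz : ‖A z‖ ≤ L * ‖z - w‖ := by simpa [hw] using hlip z w
  -- The exact gradient step: expanding the square gives the factor `1 - 2ηm + (ηL)²`, which is at
  -- most `(1 - ηm + (ηL)²)²`. The bound `m ≤ L` makes the base nonnegative, so the root can be
  -- taken.
  have hgrad : ‖z - η • A z - w‖ ≤ (1 - η * m + (η * L) ^ 2) * ‖z - w‖ := by
    have hmn := hmono z w
    rw [hw, sub_zero, real_inner_comm] at hmn
    have e : ‖z - η • A z - w‖ ^ 2 = ‖z - w‖ ^ 2 - 2 * η * ⟪z - w, A z⟫ + η ^ 2 * ‖A z‖ ^ 2 := by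
      rw [sub_right_comm, norm_sub_sq_real, inner_smul_right, norm_smul, Real.norm_of_nonneg hη]
      ring
    have hηmL : η * m ≤ η * L := mul_le_mul_of_nonneg_left hmL hη
    have hηm : 0 ≤ η * m := mul_nonneg hη hm
    have hc : 0 ≤ 1 - η * m + (η * L) ^ 2 := by nlinarith [sq_nonneg (1 - η * L), sq_nonneg (η * L)]
    refine abs_le_of_sq_le_sq' ?_ (mul_nonneg hc (norm_nonneg _)) |>.2
    rw [e, mul_pow]
    have h1 : η ^ 2 * ‖A z‖ ^ 2 ≤ (η * L) ^ 2 * ‖z - w‖ ^ 2 := by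
      have := pow_le_pow_left₀ (norm_nonneg _) hAz 2
      nlinarith [mul_le_mul_of_nonneg_left this (sq_nonneg η)]
    have h2 : 1 - 2 * (η * m) + (η * L) ^ 2 ≤ (1 - η * m + (η * L) ^ 2) ^ 2 := by
      nlinarith [sq_nonneg (η * m - (η * L) ^ 2), sq_nonneg (η * L), sq_nonneg (1 - η * L),
        mul_nonneg hηm (sub_nonneg.2 hηmL), mul_nonneg hηm hηm]
    have h3 := mul_le_mul_of_nonneg_right h2 (sq_nonneg (‖z - w‖))
    nlinarith [mul_le_mul_of_nonneg_left hmn hη]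
  have n1 : ∀ v : E, ‖η • v‖ = η * ‖v‖ := fun v => by rw [norm_smul, Real.norm_of_nonneg hη]
  constructor
  · have e : z - η • g₁ - w = (z - w) - η • A z - η • (g₁ - A z) := by module
    rw [e]
    refine (norm_sub_le _ _).trans (add_le_add ((norm_sub_le _ _).trans ?_) (n1 _).le)
    rw [n1]
    nlinarith
  -- The step is an exact gradient step from `z`, plus the change of `A` between `z` and the half
  -- point, plus the error of `g₂`. By Lipschitz continuity the second term has size `η² L ‖g₁‖`,
  -- that is, second order in `η`.
  · have e : z - η • g₂ - w = (z - η • A z - w) + η • (A z - A (z - η • g₁)) -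
        η • (g₂ - A (z - η • g₁)) := by module
    have h1 := hlip z (z - η • g₁)
    rw [sub_sub_cancel, n1] at h1
    have h2 : ‖g₁‖ ≤ L * ‖z - w‖ + ‖g₁ - A z‖ := by
      linarith [norm_sub_norm_le g₁ (A z)]
    have h3 : η * ‖A z - A (z - η • g₁)‖ ≤ η * (L * (η * (L * ‖z - w‖ + ‖g₁ - A z‖))) := by
      gcongr
      exact h1.trans (by gcongr)
    rw [e]
    refine (norm_sub_le _ _).trans (add_le_add ((norm_add_le _ _).trans ?_) (n1 _).le)
    rw [n1]
    nlinarith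

/-- By `1 / (n + 1) ≤ 1 / √(n + 1) ≤ 2 (√(n + 1) - √n)` the sum telescopes. This replaces the
logarithm, at no cost for a final rate of `T^{3/4}`. -/
theorem sum_one_div_le_sqrt (n : ℕ) : ∑ t ∈ Finset.Icc 1 n, (1 : ℝ) / t ≤ 2 * √n := by
  induction n with
  | zero => simp
  | succ n ih =>
    rw [Finset.sum_Icc_succ_top (by omega)]
    have h0 : (0 : ℝ) < (n : ℝ) + 1 := by positivity
    have h1 := Real.sq_sqrt (Nat.cast_nonneg (α := ℝ) n)
    have h2 := Real.sq_sqrt h0.le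
    have h3 : 1 ≤ √((n : ℝ) + 1) := Real.one_le_sqrt.2 (by linarith [Nat.cast_nonneg (α := ℝ) n])
    have h4 : (1 : ℝ) / (n + 1) ≤ 2 * √(n + 1) - 2 * √n := by
      rw [div_le_iff₀ h0]
      have h5 : 1 ≤ (2 * √((n : ℝ) + 1) - 2 * √n) * √((n : ℝ) + 1) := by
        nlinarith [sq_nonneg (√((n : ℝ) + 1) - √n)]
      calc (1 : ℝ) ≤ (2 * √((n : ℝ) + 1) - 2 * √n) * √((n : ℝ) + 1) * √((n : ℝ) + 1) := by
            nlinarith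
        _ = (2 * √((n : ℝ) + 1) - 2 * √n) * √((n : ℝ) + 1) ^ 2 := by ring
        _ = _ := by rw [h2]
    push_cast
    linarith

/-! ### The path of the running saddle points -/

section SaddlePath

variable {X Y : Type*} [NormedAddCommGroup X] [InnerProductSpace ℝ X] [CompleteSpace X]
  [NormedAddCommGroup Y] [InnerProductSpace ℝ Y] [CompleteSpace Y]

theorem saddleOp_average (gx : ℕ → X → Y → X) (gy : ℕ → X → Y → Y) (t : ℕ)
    (z : WithLp 2 (X × Y)) :
    saddleOp (fun x y => (1 / (t : ℝ)) • ∑ i ∈ Finset.Icc 1 t, gx i x y)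
      (fun x y => (1 / (t : ℝ)) • ∑ i ∈ Finset.Icc 1 t, gy i x y) z =
      (1 / (t : ℝ)) • ∑ i ∈ Finset.Icc 1 t, saddleOp (gx i) (gy i) z := by
  apply (WithLp.equiv 2 (X × Y)).injective
  ext1
  · change _ = (1 / (t : ℝ)) • (WithLp.fstL 2 ℝ X Y) (∑ i ∈ Finset.Icc 1 t, saddleOp (gx i) (gy i) z)
    rw [map_sum]
    rfl
  · change _ = (1 / (t : ℝ)) • (WithLp.sndL 2 ℝ X Y) (∑ i ∈ Finset.Icc 1 t, saddleOp (gx i) (gy i) z)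
    rw [map_sum]
    change -((1 / (t : ℝ)) • _) = (1 / (t : ℝ)) • ∑ i ∈ Finset.Icc 1 t, - gy i z.fst z.snd
    rw [Finset.sum_neg_distrib, smul_neg]

/-- The data of an online saddle-point problem: regular functions `f 1, …, f T` and the saddle
points `(u (t + 1), v (t + 1))` of their running averages. -/
structure SaddlePath (T : ℕ) (f : ℕ → X → Y → ℝ) (gx : ℕ → X → Y → X) (gy : ℕ → X → Y → Y)
    (m L B : ℝ) (x₀ : X) (y₀ : Y) (u : ℕ → X) (v : ℕ → Y) : Prop where
  m_pos : 0 < m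
  L_nonneg : 0 ≤ L
  B_nonneg : 0 ≤ B
  regular : ∀ i, 1 ≤ i → i ≤ T → RegularSaddle (f i) (gx i) (gy i) m L B x₀ y₀
  saddle : ∀ t, 1 ≤ t → t ≤ T → IsSaddlePointOn univ univ
    (fun x y => (1 / (t : ℝ)) * ∑ i ∈ Finset.Icc 1 t, f i x y) (u (t + 1)) (v (t + 1))

/-- The saddle operator of the average of the first `t` functions. -/
noncomputable def avgOp (gx : ℕ → X → Y → X) (gy : ℕ → X → Y → Y) (t : ℕ) :
    WithLp 2 (X × Y) → WithLp 2 (X × Y) :=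
  saddleOp (fun x y => (1 / (t : ℝ)) • ∑ i ∈ Finset.Icc 1 t, gx i x y)
    (fun x y => (1 / (t : ℝ)) • ∑ i ∈ Finset.Icc 1 t, gy i x y)

namespace SaddlePath

variable {T : ℕ} {f : ℕ → X → Y → ℝ} {gx : ℕ → X → Y → X} {gy : ℕ → X → Y → Y}
  {m L B : ℝ} {x₀ : X} {y₀ : Y} {u : ℕ → X} {v : ℕ → Y}

theorem regular_average (h : SaddlePath T f gx gy m L B x₀ y₀ u v) {t : ℕ} (ht : 1 ≤ t)
    (htT : t ≤ T) : RegularSaddle (fun x y => (1 / (t : ℝ)) * ∑ i ∈ Finset.Icc 1 t, f i x y)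
      (fun x y => (1 / (t : ℝ)) • ∑ i ∈ Finset.Icc 1 t, gx i x y)
      (fun x y => (1 / (t : ℝ)) • ∑ i ∈ Finset.Icc 1 t, gy i x y) m L B x₀ y₀ :=
  RegularSaddle.average ht fun i hi => h.regular i (Finset.mem_Icc.1 hi).1
    ((Finset.mem_Icc.1 hi).2.trans htT)

theorem avgOp_saddle (h : SaddlePath T f gx gy m L B x₀ y₀ u v) {t : ℕ} (ht : 1 ≤ t)
    (htT : t ≤ T) : avgOp gx gy t (WithLp.toLp 2 (u (t + 1), v (t + 1))) = 0 :=
  (h.regular_average ht htT).saddleOp_eq_zero (h.saddle t ht htT)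

/-- The averaged operator has norm at most `2B` at the start and vanishes at the saddle point, so
strong monotonicity bounds the distance. All running saddle points lie in one ball. -/
theorem norm_start_sub_le (h : SaddlePath T f gx gy m L B x₀ y₀ u v) {t : ℕ} (ht : 1 ≤ t)
    (htT : t ≤ T) :
    ‖WithLp.toLp 2 (x₀, y₀) - WithLp.toLp 2 (u (t + 1), v (t + 1))‖ ≤ 2 * B / m := by
  rw [le_div_iff₀ h.m_pos, mul_comm]
  exact ((h.regular_average ht htT).dist_saddle_le (h.avgOp_saddle ht htT) _).trans
    (h.regular_average ht htT).norm_saddleOp_start_le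

/-- Each individual operator has norm at most `2B` at the start and is `4L`-Lipschitz, and every
running saddle point is within `2B / m` of the start. The resulting uniform constant governs both
the drift and the regret. -/
theorem norm_saddleOp_le (h : SaddlePath T f gx gy m L B x₀ y₀ u v) {i t : ℕ} (hi : 1 ≤ i)
    (hiT : i ≤ T) (ht : 1 ≤ t) (htT : t ≤ T) :
    ‖saddleOp (gx i) (gy i) (WithLp.toLp 2 (u (t + 1), v (t + 1)))‖ ≤
      2 * B + 4 * L * (2 * B / m) := by
  have h1 := (h.regular i hi hiT).saddleOp_lipschitz h.L_nonneg (WithLp.toLp 2 (x₀, y₀))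
    (WithLp.toLp 2 (u (t + 1), v (t + 1)))
  have h2 := (h.regular i hi hiT).norm_saddleOp_start_le
  have h3 := mul_le_mul_of_nonneg_left (h.norm_start_sub_le ht htT)
    (mul_nonneg (by norm_num : (0 : ℝ) ≤ 4) h.L_nonneg)
  have h4 := norm_sub_norm_le (saddleOp (gx i) (gy i) (WithLp.toLp 2 (u (t + 1), v (t + 1))))
    (saddleOp (gx i) (gy i) (WithLp.toLp 2 (x₀, y₀)))
  rw [norm_sub_rev] at h4
  linarith

/-- Consecutive saddle points are at distance `O(1/t)`. -/
theorem drift_le (h : SaddlePath T f gx gy m L B x₀ y₀ u v) {t : ℕ} (ht : 1 ≤ t)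
    (htT : t + 1 ≤ T) :
    ‖WithLp.toLp 2 (u (t + 1), v (t + 1)) - WithLp.toLp 2 (u (t + 2), v (t + 2))‖ ≤
      (2 * B + 4 * L * (2 * B / m)) / m * (1 / ((t : ℝ) + 1)) := by
  have hm := h.m_pos
  have ht0 : (0 : ℝ) < t := by exact_mod_cast ht
  have h1 := (h.regular_average (by omega : 1 ≤ t + 1) htT).dist_saddle_le
    (h.avgOp_saddle (by omega) htT) (WithLp.toLp 2 (u (t + 1), v (t + 1)))
  -- Only the new operator survives in the average of `t + 1` operators at the old saddle point,
  -- whence the factor `1 / (t + 1)`.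
  have h2 : ∑ i ∈ Finset.Icc 1 t, saddleOp (gx i) (gy i)
      (WithLp.toLp 2 (u (t + 1), v (t + 1))) = 0 := by
    have := h.avgOp_saddle ht (by omega)
    rw [avgOp, saddleOp_average, smul_eq_zero] at this
    refine this.resolve_left ?_
    positivity
  rw [saddleOp_average, Finset.sum_Icc_succ_top (by omega), h2, zero_add, norm_smul,
    Real.norm_of_nonneg (by positivity)] at h1
  have h3 := h.norm_saddleOp_le (by omega : 1 ≤ t + 1) htT ht (by omega)
  have h4 := mul_le_mul_of_nonneg_left h3 (by positivity : (0 : ℝ) ≤ 1 / ((t + 1 : ℕ) : ℝ))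
  have h5 := h1.trans h4
  push_cast at h5
  rw [div_mul_eq_mul_div, le_div_iff₀ hm]
  linarith

/-- The running saddle points compete with the final one. -/
theorem follow_the_leader (h : SaddlePath T f gx gy m L B x₀ y₀ u v) {n : ℕ} (hn : 1 ≤ n)
    (hnT : n ≤ T) :
    |∑ i ∈ Finset.Icc 1 n, f i (u (i + 1)) (v (i + 1)) -
      ∑ i ∈ Finset.Icc 1 n, f i (u (n + 1)) (v (n + 1))| ≤
      2 * L * ((2 * B + 4 * L * (2 * B / m)) / m) ^ 2 * ∑ t ∈ Finset.Icc 1 n, (1 : ℝ) / t := by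
  have hL := h.L_nonneg
  set D := (2 * B + 4 * L * (2 * B / m)) / m
  induction n, hn using Nat.le_induction with
  | base =>
    simp only [Finset.Icc_self, Finset.sum_singleton, sub_self, abs_zero]
    positivity
  | succ n hn ih =>
    have hn0 : (0 : ℝ) < n := by exact_mod_cast hn
    -- The linear term is absent because the operator of `J_n` vanishes at its own saddle point, so
    -- the change of `J_n` is quadratic in the drift.
    have h1 := (h.regular_average hn (by omega)).abs_sub_le_withLp hL
      (WithLp.toLp 2 (u (n + 2), v (n + 2))) (WithLp.toLp 2 (u (n + 1), v (n + 1)))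
    have h0 := h.avgOp_saddle hn (by omega)
    rw [avgOp] at h0
    rw [h0, norm_zero, mul_zero, zero_mul, zero_add] at h1
    have h2 := h.drift_le hn hnT
    rw [norm_sub_rev] at h2
    have h3 := pow_le_pow_left₀ (norm_nonneg _) h2 2
    have h4 := h1.trans (mul_le_mul_of_nonneg_left h3 (by positivity : 0 ≤ 2 * L))
    simp only [← mul_sub] at h4
    rw [abs_mul, abs_of_nonneg (by positivity : (0 : ℝ) ≤ 1 / (n : ℝ)), one_div,
      inv_mul_le_iff₀ hn0] at h4
    have h5 : (n : ℝ) * (2 * L * (D * (1 / ((n : ℝ) + 1))) ^ 2) ≤ 2 * L * D ^ 2 * (1 / ((n : ℝ) + 1)) := by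
      have e : (n : ℝ) * (2 * L * (D * (1 / ((n : ℝ) + 1))) ^ 2) =
          (2 * L * D ^ 2 * (1 / ((n : ℝ) + 1))) * ((n : ℝ) / (n + 1)) := by ring
      rw [e]
      refine mul_le_of_le_one_right (by positivity) ?_
      rw [div_le_one (by positivity)]
      linarith
    have h6 := h4.trans h5
    have ih' := ih (by omega)
    -- The term `i = n + 1` is evaluated at the same point `(u (n + 2), v (n + 2))` in both sums and
    -- cancels.
    rw [Finset.sum_Icc_succ_top (by omega), Finset.sum_Icc_succ_top (by omega),
      Finset.sum_Icc_succ_top (by omega), mul_add, add_sub_add_right_eq_sub]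
    have h7 := abs_sub_le (∑ i ∈ Finset.Icc 1 n, f i (u (i + 1)) (v (i + 1)))
      (∑ i ∈ Finset.Icc 1 n, f i (u (n + 1)) (v (n + 1)))
      (∑ i ∈ Finset.Icc 1 n, f i (u (n + 2)) (v (n + 2)))
    rw [abs_sub_comm (∑ i ∈ Finset.Icc 1 n, f i (u (n + 1)) (v (n + 1)))] at h7
    push_cast
    exact h7.trans (add_le_add ih' h6)

/-- The regret of a sequence in terms of its distances to the running saddle points. -/
theorem regret_le (h : SaddlePath T f gx gy m L B x₀ y₀ u v) (hT : 1 ≤ T) (z : ℕ → X × Y) :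
    |∑ t ∈ Finset.Icc 1 T, f t (z t).1 (z t).2 -
      ∑ t ∈ Finset.Icc 1 T, f t (u (T + 1)) (v (T + 1))| ≤
      ∑ t ∈ Finset.Icc 1 T, (2 * (2 * B + 4 * L * (2 * B / m)) *
        ‖WithLp.toLp 2 (z t) - WithLp.toLp 2 (u (t + 1), v (t + 1))‖ + 2 * L *
        ‖WithLp.toLp 2 (z t) - WithLp.toLp 2 (u (t + 1), v (t + 1))‖ ^ 2) +
      2 * L * ((2 * B + 4 * L * (2 * B / m)) / m) ^ 2 * (2 * √T) := by
  have hL := h.L_nonneg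
  have h1 := (h.follow_the_leader hT le_rfl).trans
    (mul_le_mul_of_nonneg_left (sum_one_div_le_sqrt T) (by positivity))
  have h2 := abs_sub_le (∑ t ∈ Finset.Icc 1 T, f t (z t).1 (z t).2)
    (∑ t ∈ Finset.Icc 1 T, f t (u (t + 1)) (v (t + 1)))
    (∑ t ∈ Finset.Icc 1 T, f t (u (T + 1)) (v (T + 1)))
  refine h2.trans (add_le_add ?_ h1)
  rw [← Finset.sum_sub_distrib]
  refine (Finset.abs_sum_le_sum_abs _ _).trans (Finset.sum_le_sum fun t ht => ?_)
  obtain ⟨ht1, htT⟩ := Finset.mem_Icc.1 ht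
  refine ((h.regular t ht1 htT).abs_sub_le_withLp hL (WithLp.toLp 2 (z t))
    (WithLp.toLp 2 (u (t + 1), v (t + 1)))).trans ?_
  have h3 := h.norm_saddleOp_le ht1 htT ht1 htT
  gcongr

end SaddlePath

end SaddlePath

/-! ### Gaussian moments -/

section Gaussian

variable {d : ℕ}

/-- Reduces every moment of `⟪a, u⟫` to a moment of the one-dimensional standard Gaussian, so the
constants below do not depend on `d`. -/
theorem stdGaussian_map_inner (a : Vec d) :
    (stdGaussian (Vec d)).map (fun u => ⟪a, u⟫) = (gaussianReal 0 1).map (fun x => ‖a‖ * x) := by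
  have h := IsGaussian.map_eq_gaussianReal (μ := stdGaussian (Vec d)) (innerSL ℝ a)
  rw [integral_strongDual_stdGaussian, variance_dual_stdGaussian, innerSL_apply_norm] at h
  rw [gaussianReal_map_const_mul, mul_zero, mul_one]
  refine Eq.trans h ?_
  congr 1
  exact Real.toNNReal_of_nonneg (sq_nonneg _)

theorem integrable_pow_gaussianReal (k : ℕ) : Integrable (fun x : ℝ => x ^ k) (gaussianReal 0 1) := by
  rcases Nat.eq_zero_or_pos k with rfl | hk
  · simp
  have h := (memLp_id_gaussianReal' (μ := 0) (v := 1) k (by simp)).integrable_norm_pow (by omega)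
  refine h.mono' (by fun_prop) (.of_forall fun x => ?_)
  simp

theorem integrable_inner_pow_stdGaussian (a : Vec d) (k : ℕ) :
    Integrable (fun u => ⟪a, u⟫ ^ k) (stdGaussian (Vec d)) := by
  have h : Integrable (fun x : ℝ => x ^ k) ((stdGaussian (Vec d)).map (fun u => ⟪a, u⟫)) := by
    rw [stdGaussian_map_inner, integrable_map_measure (by fun_prop) (by fun_prop)]
    simpa [Function.comp_def, mul_pow] using (integrable_pow_gaussianReal k).const_mul (‖a‖ ^ k)
  exact (integrable_map_measure (continuous_pow k).aestronglyMeasurable (by fun_prop)).1 h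

theorem integral_inner_pow_stdGaussian (a : Vec d) (k : ℕ) :
    ∫ u, ⟪a, u⟫ ^ k ∂(stdGaussian (Vec d)) = ‖a‖ ^ k * ∫ x : ℝ, x ^ k ∂(gaussianReal 0 1) := by
  have h : ∫ x : ℝ, x ^ k ∂((stdGaussian (Vec d)).map (fun u => ⟪a, u⟫)) =
      ‖a‖ ^ k * ∫ x : ℝ, x ^ k ∂(gaussianReal 0 1) := by
    rw [stdGaussian_map_inner, integral_map (by fun_prop) (by fun_prop)]
    simp [mul_pow, integral_const_mul]
  rw [integral_map (by fun_prop) (by fun_prop)] at h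
  exact h

theorem integrable_norm_pow_stdGaussian (k : ℕ) :
    Integrable (fun u => ‖u‖ ^ k) (stdGaussian (Vec d)) := by
  rcases Nat.eq_zero_or_pos k with rfl | hk
  · simp
  exact (IsGaussian.memLp_id (stdGaussian (Vec d)) k (by simp)).integrable_norm_pow (by omega)

/-- The covariance of the standard Gaussian is the identity. Hence the linear part of a Gaussian
finite difference is an unbiased gradient estimate. -/
theorem integral_inner_smul_stdGaussian (a : Vec d) :
    ∫ u, ⟪a, u⟫ • u ∂(stdGaussian (Vec d)) = a := by
  have hi : Integrable (fun u : Vec d => ⟪a, u⟫ • u) (stdGaussian (Vec d)) := by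
    refine ((integrable_norm_pow_stdGaussian (d := d) 2).const_mul ‖a‖).mono' (by fun_prop)
      (.of_forall fun u => ?_)
    rw [norm_smul]
    nlinarith [norm_inner_le_norm (𝕜 := ℝ) a u, norm_nonneg u]
  refine ext_inner_left ℝ fun b => ?_
  rw [← integral_inner hi]
  have h := covarianceBilin_apply (IsGaussian.memLp_id (stdGaussian (Vec d)) 2 (by simp)) a b
  rw [covarianceBilin_stdGaussian] at h
  simp only [id_eq, integral_id_stdGaussian, sub_zero] at h
  simp only [inner_smul_right]
  rw [← h, real_inner_comm]
  rfl

theorem norm_sq_eq_sum_inner_sq (u : Vec d) :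
    ‖u‖ ^ 2 = ∑ j, ⟪EuclideanSpace.single j (1 : ℝ), u⟫ ^ 2 := by
  simp [EuclideanSpace.norm_sq_eq, EuclideanSpace.inner_single_left]

/-- Expanding `‖u‖²` in coordinates and applying the weighted inequality `2pq ≤ p² + q²` to each
product of squares leaves only fourth moments of single projections. The weights `‖a‖^{-1}` and
`‖a‖` make both terms scale as `‖a‖²`. -/
theorem integral_inner_sq_mul_norm_sq_le (a : Vec d) :
    ∫ u, ⟪a, u⟫ ^ 2 * ‖u‖ ^ 2 ∂(stdGaussian (Vec d)) ≤
      d * (∫ x : ℝ, x ^ 4 ∂(gaussianReal 0 1)) * ‖a‖ ^ 2 := by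
  rcases eq_or_ne a 0 with rfl | ha
  · simp
  have ha0 : 0 < ‖a‖ := norm_pos_iff.2 ha
  set b : Fin d → Vec d := fun j => EuclideanSpace.single j (1 : ℝ) with hb
  have hint1 : ∀ j, Integrable (fun u : Vec d => ((‖a‖ ^ 2)⁻¹ * ⟪a, u⟫ ^ 4 +
      ‖a‖ ^ 2 * ⟪b j, u⟫ ^ 4) / 2) (stdGaussian (Vec d)) := fun j =>
    (((integrable_inner_pow_stdGaussian a 4).const_mul _).add
      ((integrable_inner_pow_stdGaussian (b j) 4).const_mul _)).div_const 2
  have hint : Integrable (fun u : Vec d => ∑ j, ((‖a‖ ^ 2)⁻¹ * ⟪a, u⟫ ^ 4 +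
      ‖a‖ ^ 2 * ⟪b j, u⟫ ^ 4) / 2) (stdGaussian (Vec d)) :=
    integrable_finsetSum _ fun j _ => hint1 j
  have hle : ∫ u, ⟪a, u⟫ ^ 2 * ‖u‖ ^ 2 ∂(stdGaussian (Vec d)) ≤
      ∫ u, ∑ j, ((‖a‖ ^ 2)⁻¹ * ⟪a, u⟫ ^ 4 + ‖a‖ ^ 2 * ⟪b j, u⟫ ^ 4) / 2 ∂(stdGaussian (Vec d)) := by
    refine integral_mono_of_nonneg (.of_forall fun u => by positivity) hint (.of_forall fun u => ?_)
    simp only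
    rw [norm_sq_eq_sum_inner_sq, Finset.mul_sum]
    refine Finset.sum_le_sum fun j _ => ?_
    have h := two_mul_le_add_sq (‖a‖⁻¹ * ⟪a, u⟫ ^ 2) (‖a‖ * ⟪b j, u⟫ ^ 2)
    have e : ‖a‖⁻¹ * ‖a‖ = 1 := inv_mul_cancel₀ ha0.ne'
    have e2 : 2 * (‖a‖⁻¹ * ⟪a, u⟫ ^ 2) * (‖a‖ * ⟪b j, u⟫ ^ 2) =
        2 * (‖a‖⁻¹ * ‖a‖) * (⟪a, u⟫ ^ 2 * ⟪b j, u⟫ ^ 2) := by ring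
    rw [e2, e] at h
    have e3 : (‖a‖⁻¹ * ⟪a, u⟫ ^ 2) ^ 2 = (‖a‖ ^ 2)⁻¹ * ⟪a, u⟫ ^ 4 := by
      rw [mul_pow, inv_pow]; ring
    have e4 : (‖a‖ * ⟪b j, u⟫ ^ 2) ^ 2 = ‖a‖ ^ 2 * ⟪b j, u⟫ ^ 4 := by ring
    rw [e3, e4] at h
    linarith
  refine hle.trans (le_of_eq ?_)
  have hone : ∀ j, ‖b j‖ = 1 := fun j => by simp [hb]
  rw [integral_finsetSum _ fun j _ => hint1 j]
  simp only [integral_div]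
  have h3 : ∀ j, ∫ u, ((‖a‖ ^ 2)⁻¹ * ⟪a, u⟫ ^ 4 + ‖a‖ ^ 2 * ⟪b j, u⟫ ^ 4) ∂(stdGaussian (Vec d)) =
      2 * ((∫ x : ℝ, x ^ 4 ∂(gaussianReal 0 1)) * ‖a‖ ^ 2) := fun j => by
    rw [integral_add ((integrable_inner_pow_stdGaussian a 4).const_mul _)
      ((integrable_inner_pow_stdGaussian (b j) 4).const_mul _), integral_const_mul,
      integral_const_mul, integral_inner_pow_stdGaussian, integral_inner_pow_stdGaussian, hone]
    field_simp
    ring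
  simp only [h3]
  simp
  ring

/-- The power mean inequality `(∑ u_j²)³ ≤ d² ∑ u_j⁶` reduces the claim to one-dimensional sixth
moments. -/
theorem integral_norm_pow_six_le :
    ∫ u, ‖u‖ ^ 6 ∂(stdGaussian (Vec d)) ≤ (d : ℝ) ^ 3 * ∫ x : ℝ, x ^ 6 ∂(gaussianReal 0 1) := by
  set b : Fin d → Vec d := fun j => EuclideanSpace.single j (1 : ℝ) with hb
  have hone : ∀ j, ‖b j‖ = 1 := fun j => by simp [hb]
  have hint : Integrable (fun u : Vec d => (d : ℝ) ^ 2 * ∑ j, ⟪b j, u⟫ ^ 6)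
      (stdGaussian (Vec d)) :=
    (integrable_finsetSum _ fun j _ => integrable_inner_pow_stdGaussian (b j) 6).const_mul _
  have hle : ∫ u, ‖u‖ ^ 6 ∂(stdGaussian (Vec d)) ≤
      ∫ u, (d : ℝ) ^ 2 * ∑ j, ⟪b j, u⟫ ^ 6 ∂(stdGaussian (Vec d)) := by
    refine integral_mono_of_nonneg (.of_forall fun u => by positivity) hint (.of_forall fun u => ?_)
    simp only
    have h := pow_sum_le_card_mul_sum_pow (s := Finset.univ) (f := fun j => ⟪b j, u⟫ ^ 2)
      (fun j _ => sq_nonneg _) 2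
    rw [← norm_sq_eq_sum_inner_sq, ← pow_mul] at h
    simpa [← pow_mul] using h
  refine hle.trans (le_of_eq ?_)
  rw [integral_const_mul, integral_finsetSum _ fun j _ => integrable_inner_pow_stdGaussian (b j) 6]
  simp only [integral_inner_pow_stdGaussian, hone]
  simp
  ring

end Gaussian

/-! ### Mini-batches -/

section Batch

variable {Ω : Type*} [MeasurableSpace Ω] {Pr : Measure Ω}

theorem eLpNorm_two_le_of_integral_sq_le {E : Type*} [NormedAddCommGroup E] {f : Ω → E} {c : ℝ}
    (hf : MemLp f 2 Pr) (hc : 0 ≤ c) (h : ∫ ω, ‖f ω‖ ^ 2 ∂Pr ≤ c ^ 2) :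
    eLpNorm f 2 Pr ≤ ENNReal.ofReal c := by
  rw [hf.eLpNorm_eq_integral_rpow_norm (by simp) (by simp)]
  refine ENNReal.ofReal_le_ofReal ?_
  simp only [ENNReal.toReal_ofNat, Real.rpow_ofNat]
  rw [← one_div, ← Real.sqrt_eq_rpow]
  exact Real.sqrt_le_iff.2 ⟨hc, h⟩

/-- The variance of a sum of pairwise independent random vectors. -/
theorem integral_norm_sq_sum_sub_mean_le [IsProbabilityMeasure Pr] {d : ℕ} {ι : Type*}
    {I : Finset ι} {X : ι → Ω → Vec d} {V : ℝ} (hX : ∀ a ∈ I, MemLp (X a) 2 Pr)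
    (hind : (I : Set ι).Pairwise fun a b => IndepFun (X a) (X b) Pr)
    (hV : ∀ a ∈ I, ∫ ω, ‖X a ω‖ ^ 2 ∂Pr ≤ V) :
    ∫ ω, ‖∑ a ∈ I, (X a ω - ∫ ω', X a ω' ∂Pr)‖ ^ 2 ∂Pr ≤ I.card * V := by
  have hXj : ∀ a ∈ I, ∀ j, MemLp (fun ω => X a ω j) 2 Pr := fun a ha j => by
    refine (hX a ha).of_le ?_ (.of_forall fun ω => PiLp.norm_apply_le (X a ω) j)
    exact (EuclideanSpace.proj (𝕜 := ℝ) j).continuous.comp_aestronglyMeasurable (hX a ha).1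
  have hmean : ∀ a ∈ I, ∀ j, (∫ ω', X a ω' ∂Pr) j = ∫ ω', X a ω' j ∂Pr := fun a ha j =>
    ((EuclideanSpace.proj (𝕜 := ℝ) j).integral_comp_comm ((hX a ha).integrable (by simp))).symm
  have hcoord : ∀ j ω, (∑ a ∈ I, (X a ω - ∫ ω', X a ω' ∂Pr)) j =
      ∑ a ∈ I, (X a ω j - ∫ ω', X a ω' j ∂Pr) := fun j ω => by
    have h1 := map_sum (EuclideanSpace.proj (𝕜 := ℝ) j)
      (fun a => X a ω - ∫ ω', X a ω' ∂Pr) I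
    refine Eq.trans h1 (Finset.sum_congr rfl fun a ha => ?_)
    rw [← hmean a ha j]
    rfl
  have hL : ∀ j, MemLp (fun ω => ∑ a ∈ I, (X a ω j - ∫ ω', X a ω' j ∂Pr)) 2 Pr := fun j =>
    memLp_finsetSum _ fun a ha => (hXj a ha j).sub (memLp_const _)
  have hvar : ∀ j, ∫ ω, (∑ a ∈ I, (X a ω j - ∫ ω', X a ω' j ∂Pr)) ^ 2 ∂Pr ≤
      ∑ a ∈ I, ∫ ω, (X a ω j) ^ 2 ∂Pr := fun j => by
    -- Coordinatewise, pairwise independence removes the cross terms; each variance is then at most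
    -- a second moment, and the coordinates are summed again.
    have h1 := IndepFun.variance_sum (μ := Pr) (X := fun a ω => X a ω j) (s := I)
      (fun a ha => hXj a ha j) (fun a ha b hb hab => (hind ha hb hab).comp
        (φ := fun v : Vec d => v j) (ψ := fun v : Vec d => v j) (by fun_prop) (by fun_prop))
    have h2 : ∫ ω, (∑ a ∈ I, (X a ω j - ∫ ω', X a ω' j ∂Pr)) ^ 2 ∂Pr =
        Var[∑ a ∈ I, fun ω => X a ω j; Pr] := by
      rw [variance_eq_integral (memLp_finsetSum' _ fun a ha => hXj a ha j).1.aemeasurable]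
      congr 1
      ext ω
      simp only [Finset.sum_apply]
      rw [integral_finsetSum _ fun a ha => (hXj a ha j).integrable (by simp),
        Finset.sum_sub_distrib]
    rw [h2, h1]
    refine Finset.sum_le_sum fun a ha => ?_
    have h3 := variance_le_expectation_sq (hXj a ha j).1
    simpa using h3
  simp only [EuclideanSpace.real_norm_sq_eq, hcoord]
  rw [integral_finsetSum _ fun j _ => (hL j).integrable_sq]
  refine (Finset.sum_le_sum fun j _ => hvar j).trans ?_
  rw [Finset.sum_comm, ← nsmul_eq_mul]
  refine Finset.sum_le_card_nsmul _ _ _ fun a ha => ?_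
  refine le_of_eq_of_le ?_ (hV a ha)
  simp only [EuclideanSpace.real_norm_sq_eq]
  rw [integral_finsetSum _ fun j _ => (hXj a ha j).integrable_sq]

/-- The error of a mini-batch estimate built from independent samples: `φ i` is the estimator of
the `i`-th term and `Y i` an approximation of it whose mean is the target. -/
theorem eLpNorm_batch_sub_mean_le [IsProbabilityMeasure Pr] {d t m : ℕ} {S : Type*}
    [MeasurableSpace S] {Q : Measure S} {s : ℕ → ℕ → Ω → S} (ht : 1 ≤ t) (hm : 1 ≤ m)
    (hs : ∀ i j, Measurable (s i j)) (hlaw : ∀ i j, Pr.map (s i j) = Q)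
    (hind : iIndepFun (fun a : ℕ × ℕ => s a.1 a.2) Pr) {φ Y : ℕ → S → Vec d} {V ρ : ℝ}
    (hρ : 0 ≤ ρ) (hφ : ∀ i ∈ Finset.Icc 1 t, AEStronglyMeasurable (φ i) Q)
    (hYm : ∀ i ∈ Finset.Icc 1 t, StronglyMeasurable (Y i))
    (hY : ∀ i ∈ Finset.Icc 1 t, MemLp (Y i) 2 Q)
    (hV : ∀ i ∈ Finset.Icc 1 t, ∫ x, ‖Y i x‖ ^ 2 ∂Q ≤ V)
    (hr : ∀ i ∈ Finset.Icc 1 t, eLpNorm (φ i - Y i) 2 Q ≤ ENNReal.ofReal ρ) :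
    eLpNorm (fun ω => (1 / ((t : ℝ) * m)) • ∑ i ∈ Finset.Icc 1 t, ∑ j ∈ Finset.range m,
        φ i (s i j ω) - (1 / (t : ℝ)) • ∑ i ∈ Finset.Icc 1 t, ∫ x, Y i x ∂Q) 2 Pr ≤
      ENNReal.ofReal (√(V / m) + ρ) := by
  have ht0 : (0 : ℝ) < t := by exact_mod_cast ht
  have hm0 : (0 : ℝ) < m := by exact_mod_cast hm
  have hV0 : 0 ≤ V := by
    refine le_trans ?_ (hV 1 (Finset.mem_Icc.2 ⟨le_rfl, ht⟩))
    positivity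
  set I : Finset (ℕ × ℕ) := Finset.Icc 1 t ×ˢ Finset.range m with hI
  have hcard : (I.card : ℝ) = t * m := by simp [hI]
  have hI1 : ∀ a ∈ I, a.1 ∈ Finset.Icc 1 t := fun a ha => (Finset.mem_product.1 ha).1
  set X : ℕ × ℕ → Ω → Vec d := fun a ω => Y a.1 (s a.1 a.2 ω) with hXdef
  set R : ℕ × ℕ → Ω → Vec d := fun a ω => (φ a.1 - Y a.1) (s a.1 a.2 ω) with hRdef
  have hXL : ∀ a ∈ I, MemLp (X a) 2 Pr := fun a ha => by
    have := hY a.1 (hI1 a ha)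
    rw [← hlaw a.1 a.2] at this
    exact this.comp_of_map (hs _ _).aemeasurable
  have hmean : ∀ a ∈ I, ∫ ω, X a ω ∂Pr = ∫ x, Y a.1 x ∂Q := fun a ha => by
    rw [← hlaw a.1 a.2, integral_map (hs _ _).aemeasurable
      (hYm a.1 (hI1 a ha)).aestronglyMeasurable]
  have hXV : ∀ a ∈ I, ∫ ω, ‖X a ω‖ ^ 2 ∂Pr ≤ V := fun a ha => by
    refine le_of_eq_of_le ?_ (hV a.1 (hI1 a ha))
    rw [← hlaw a.1 a.2]
    exact (integral_map (hs _ _).aemeasurable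
      ((hYm a.1 (hI1 a ha)).norm.pow 2).aestronglyMeasurable).symm
  have hXind : (I : Set (ℕ × ℕ)).Pairwise fun a b => IndepFun (X a) (X b) Pr :=
    fun a ha b hb hab => (hind.indepFun hab).comp (hYm a.1 (hI1 a ha)).measurable
      (hYm b.1 (hI1 b hb)).measurable
  have hRm : ∀ a ∈ I, AEStronglyMeasurable (R a) Pr := fun a ha => by
    have h1 := (hφ a.1 (hI1 a ha)).sub (hY a.1 (hI1 a ha)).1
    rw [← hlaw a.1 a.2] at h1
    exact h1.comp_measurable (hs _ _)
  have hR : ∀ a ∈ I, eLpNorm (R a) 2 Pr ≤ ENNReal.ofReal ρ := fun a ha => by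
    have h1 := (hφ a.1 (hI1 a ha)).sub (hY a.1 (hI1 a ha)).1
    refine le_of_eq_of_le ?_ (hr a.1 (hI1 a ha))
    rw [← hlaw a.1 a.2] at h1 ⊢
    rw [eLpNorm_map_measure h1 (hs _ _).aemeasurable]
    rfl
  -- A centred part, controlled through independence, plus the residuals `φ - Y`, which carry no
  -- cancellation and are added by Minkowski.
  have hsplit : (fun ω => (1 / ((t : ℝ) * m)) • ∑ i ∈ Finset.Icc 1 t, ∑ j ∈ Finset.range m,
        φ i (s i j ω) - (1 / (t : ℝ)) • ∑ i ∈ Finset.Icc 1 t, ∫ x, Y i x ∂Q) =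
      (1 / ((t : ℝ) * m)) • (fun ω => ∑ a ∈ I, (X a ω - ∫ ω', X a ω' ∂Pr)) +
        (1 / ((t : ℝ) * m)) • ∑ a ∈ I, R a := by
    ext1 ω
    have e1 : (1 / (t : ℝ)) • ∑ i ∈ Finset.Icc 1 t, ∫ x, Y i x ∂Q =
        (1 / ((t : ℝ) * m)) • ∑ a ∈ I, ∫ ω', X a ω' ∂Pr := by
      rw [Finset.sum_congr rfl hmean, hI, Finset.sum_product]
      simp only [Finset.sum_const, Finset.card_range]
      rw [← Finset.smul_sum, ← Nat.cast_smul_eq_nsmul ℝ, smul_smul]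
      congr 1
      field_simp
    rw [e1]
    simp only [Pi.add_apply, Pi.smul_apply, Finset.sum_apply]
    rw [← smul_add, ← smul_sub, ← Finset.sum_add_distrib, hI, Finset.sum_product,
      Finset.sum_product, ← Finset.sum_sub_distrib]
    congr 1
    refine Finset.sum_congr rfl fun i _ => ?_
    rw [← Finset.sum_sub_distrib]
    refine Finset.sum_congr rfl fun j _ => ?_
    simp only [hXdef, hRdef, Pi.sub_apply]
    abel
  have hAL : MemLp (fun ω => ∑ a ∈ I, (X a ω - ∫ ω', X a ω' ∂Pr)) 2 Pr :=
    memLp_finsetSum _ fun a ha => (hXL a ha).sub (memLp_const _)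
  have hA : eLpNorm (fun ω => ∑ a ∈ I, (X a ω - ∫ ω', X a ω' ∂Pr)) 2 Pr ≤
      ENNReal.ofReal (√(t * m * V)) := by
    refine eLpNorm_two_le_of_integral_sq_le hAL (Real.sqrt_nonneg _) ?_
    rw [Real.sq_sqrt (by positivity), ← hcard]
    exact integral_norm_sq_sum_sub_mean_le hXL hXind hXV
  have hB : eLpNorm (∑ a ∈ I, R a) 2 Pr ≤ ENNReal.ofReal (t * m * ρ) := by
    refine (eLpNorm_sum_le hRm (by norm_num)).trans ((Finset.sum_le_card_nsmul _ _ _ hR).trans ?_)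
    rw [← hcard, nsmul_eq_mul, ENNReal.ofReal_mul (by positivity), ENNReal.ofReal_natCast]
  have hN : (0 : ℝ) ≤ 1 / ((t : ℝ) * m) := by positivity
  rw [hsplit]
  refine (eLpNorm_add_le (hAL.1.const_smul _)
    ((Finset.aestronglyMeasurable_sum _ hRm).const_smul _) (by norm_num)).trans ?_
  rw [eLpNorm_const_smul, eLpNorm_const_smul, Real.enorm_of_nonneg hN,
    ENNReal.ofReal_add (Real.sqrt_nonneg _) hρ]
  refine add_le_add ?_ ?_
  · refine (mul_le_mul_right hA _).trans ?_
    rw [← ENNReal.ofReal_mul hN]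
    refine ENNReal.ofReal_le_ofReal ?_
    rw [div_mul_eq_mul_div, one_mul, div_le_iff₀ (by positivity)]
    refine Real.sqrt_le_iff.2 ⟨by positivity, ?_⟩
    rw [mul_pow, Real.sq_sqrt (by positivity)]
    -- The centred part is in fact of order `√(V / (t m))`; the gain from averaging over `t`
    -- functions is given up.
    have e : V / m * (t * m) ^ 2 = t * m * V * t := by field_simp
    rw [e]
    have h1t : (1 : ℝ) ≤ t := by exact_mod_cast ht
    exact le_mul_of_one_le_right (by positivity) h1t
  · refine (mul_le_mul_right hB _).trans ?_
    rw [← ENNReal.ofReal_mul hN]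
    refine ENNReal.ofReal_le_ofReal (le_of_eq ?_)
    field_simp

end Batch

/-! ### Errors of the gradient estimators in one block of variables -/

section Block

variable {Ω : Type*} [MeasurableSpace Ω] {Pr : Measure Ω} [IsProbabilityMeasure Pr]
  {Ξ : Type*} [MeasurableSpace Ξ] {P : Measure Ξ} [IsProbabilityMeasure P] {d : ℕ}

/-- Each coordinate of the gradient is the limit of difference quotients along the sequence `1 / (n
+ 1)`, so joint measurability passes from the functions to their gradients. -/
theorem measurable_of_hasGradientAt {α : Type*} [MeasurableSpace α] {f : α → Vec d → ℝ}
    {x g : α → Vec d} (hf : Measurable (fun p : α × Vec d => f p.1 p.2)) (hx : Measurable x)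
    (hg : ∀ a, HasGradientAt (f a) (g a) (x a)) : Measurable g := by
  have hj : ∀ j, Measurable (fun a => g a j) := fun j => by
    set b : Vec d := EuclideanSpace.single j (1 : ℝ) with hb
    refine measurable_of_tendsto_metrizable
      (f := fun (n : ℕ) a => ((1 : ℝ) / ((n : ℝ) + 1))⁻¹ • (f a (x a + ((1 : ℝ) / ((n : ℝ) + 1)) • b) - f a (x a)))
      (fun n => ?_) ?_
    · have h1 : Measurable (fun a => f a (x a + ((1 : ℝ) / ((n : ℝ) + 1)) • b)) :=
        hf.comp (measurable_id.prodMk (hx.add_const _))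
      have h2 : Measurable (fun a => f a (x a)) := hf.comp (measurable_id.prodMk hx)
      exact (h1.sub h2).const_mul ((1 : ℝ) / ((n : ℝ) + 1))⁻¹
    · rw [tendsto_pi_nhds]
      intro a
      have hd : HasDerivAt (fun r : ℝ => f a (x a + r • b)) (g a j) 0 := by
        have h1 : HasFDerivAt (f a) (InnerProductSpace.toDual ℝ (Vec d) (g a))
            (x a + (0 : ℝ) • b) := by simpa using (hg a).hasFDerivAt
        have h2 : HasDerivAt (fun r : ℝ => x a + r • b) b 0 := by
          simpa using ((hasDerivAt_id (0 : ℝ)).smul_const b).const_add (x a)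
        have h3 := h1.comp_hasDerivAt (0 : ℝ) h2
        have h4 : InnerProductSpace.toDual ℝ (Vec d) (g a) b = g a j := by
          rw [InnerProductSpace.toDual_apply_apply, hb, EuclideanSpace.inner_single_right]
          simp
        rw [h4] at h3
        exact h3
      have h4 := hd.tendsto_slope_zero
      simp only [zero_add, zero_smul, add_zero] at h4
      refine h4.comp ?_
      refine tendsto_nhdsWithin_iff.2 ⟨tendsto_one_div_add_atTop_nhds_zero_nat, ?_⟩
      exact .of_forall fun n => by
        simp only [mem_compl_iff, mem_singleton_iff]
        positivity
  have h := (WithLp.measurable_toLp 2 (Fin d → ℝ)).comp (measurable_pi_iff.2 hj)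
  exact h

/-- The mini-batch average of bounded stochastic gradients. -/
theorem eLpNorm_first_block_le {t m : ℕ} {s : ℕ → ℕ → Ω → Ξ} (ht : 1 ≤ t) (hm : 1 ≤ m)
    (hs : ∀ i j, Measurable (s i j)) (hlaw : ∀ i j, Pr.map (s i j) = P)
    (hind : iIndepFun (fun a : ℕ × ℕ => s a.1 a.2) Pr) {h : ℕ → Ξ → Vec d} {B : ℝ}
    (hh : ∀ i ∈ Finset.Icc 1 t, Measurable (h i))
    (hB : ∀ i ∈ Finset.Icc 1 t, ∀ᵐ ξ ∂P, ‖h i ξ‖ ≤ B) :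
    eLpNorm (fun ω => (1 / ((t : ℝ) * m)) • ∑ i ∈ Finset.Icc 1 t, ∑ j ∈ Finset.range m,
        h i (s i j ω) - (1 / (t : ℝ)) • ∑ i ∈ Finset.Icc 1 t, ∫ ξ, h i ξ ∂P) 2 Pr ≤
      ENNReal.ofReal √(B ^ 2 / m) := by
  -- The stochastic gradient has exactly the target mean, so it serves as its own approximation,
  -- with residual bound `ρ = 0`.
  rw [← add_zero √(B ^ 2 / m)]
  refine eLpNorm_batch_sub_mean_le ht hm hs hlaw hind le_rfl
    (fun i hi => (hh i hi).aestronglyMeasurable) (fun i hi => (hh i hi).stronglyMeasurable)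
    (fun i hi => .of_bound (hh i hi).aestronglyMeasurable B (hB i hi)) (fun i hi => ?_) ?_
  · refine (integral_mono_of_nonneg (.of_forall fun ξ => by positivity) (integrable_const (B ^ 2))
      ?_).trans (by simp)
    filter_upwards [hB i hi] with ξ hξ
    exact pow_le_pow_left₀ (norm_nonneg _) hξ 2
  · intro i _
    simp

/-- The mini-batch average of Gaussian finite differences. -/
theorem eLpNorm_zeroth_block_le {t m : ℕ} {s : ℕ → ℕ → Ω → Ξ × Vec d} (ht : 1 ≤ t) (hm : 1 ≤ m)
    (hs : ∀ i j, Measurable (s i j)) (hlaw : ∀ i j, Pr.map (s i j) = P.prod (stdGaussian (Vec d)))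
    (hind : iIndepFun (fun a : ℕ × ℕ => s a.1 a.2) Pr) {H : ℕ → Vec d → Ξ → ℝ} {v : Vec d}
    {h : ℕ → Ξ → Vec d} {B L ν : ℝ} (hν : 0 < ν) (hL : 0 ≤ L)
    (hH : ∀ i ∈ Finset.Icc 1 t, Measurable (fun p : Vec d × Ξ => H i p.1 p.2))
    (hh : ∀ i ∈ Finset.Icc 1 t, Measurable (h i))
    (hB : ∀ i ∈ Finset.Icc 1 t, ∀ᵐ ξ ∂P, ‖h i ξ‖ ≤ B)
    (hT : ∀ i ∈ Finset.Icc 1 t, ∀ᵐ ξ ∂P, ∀ v', |H i v' ξ - H i v ξ - ⟪h i ξ, v' - v⟫| ≤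
      L * ‖v' - v‖ ^ 2) :
    eLpNorm (fun ω => (1 / ((t : ℝ) * m)) • ∑ i ∈ Finset.Icc 1 t, ∑ j ∈ Finset.range m,
        ((H i (v + ν • (s i j ω).2) (s i j ω).1 - H i v (s i j ω).1) / ν) • (s i j ω).2 -
        (1 / (t : ℝ)) • ∑ i ∈ Finset.Icc 1 t, ∫ ξ, h i ξ ∂P) 2 Pr ≤
      ENNReal.ofReal (√(d * (∫ x : ℝ, x ^ 4 ∂(gaussianReal 0 1)) * B ^ 2 / m) +
        L * ν * √((d : ℝ) ^ 3 * ∫ x : ℝ, x ^ 6 ∂(gaussianReal 0 1))) := by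
  set G := stdGaussian (Vec d) with hG
  -- The finite difference with `H` replaced by its linearization at `v`: its mean is the expected
  -- gradient, and the quadratic remainder goes into the residual.
  set Y : ℕ → Ξ × Vec d → Vec d := fun i q => ⟪h i q.1, q.2⟫ • q.2 with hY
  have hYm : ∀ i ∈ Finset.Icc 1 t, Measurable (Y i) := fun i hi => by
    have := (hh i hi)
    simp only [hY]
    fun_prop
  have haeB : ∀ i ∈ Finset.Icc 1 t, ∀ᵐ q ∂(P.prod G), ‖h i q.1‖ ≤ B := fun i hi =>
    Measure.quasiMeasurePreserving_fst.ae (hB i hi)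
  have hYL : ∀ i ∈ Finset.Icc 1 t, MemLp (Y i) 2 (P.prod G) := fun i hi => by
    have h4 : Integrable (fun u : Vec d => B ^ 2 * ‖u‖ ^ 4) G :=
      (integrable_norm_pow_stdGaussian 4).const_mul _
    rw [memLp_two_iff_integrable_sq_norm (hYm i hi).aestronglyMeasurable]
    refine (h4.comp_snd P).mono' ((hYm i hi).norm.pow_const 2).aestronglyMeasurable ?_
    filter_upwards [haeB i hi] with q hq
    have h5 : ‖Y i q‖ ≤ B * ‖q.2‖ ^ 2 := by
      simp only [hY, norm_smul]
      have := norm_inner_le_norm (𝕜 := ℝ) (h i q.1) q.2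
      nlinarith [norm_nonneg q.2, mul_le_mul_of_nonneg_right hq (norm_nonneg q.2)]
    rw [Real.norm_of_nonneg (by positivity)]
    refine (pow_le_pow_left₀ (norm_nonneg _) h5 2).trans (le_of_eq (by ring))
  have hYmean : ∀ i ∈ Finset.Icc 1 t, ∫ q, Y i q ∂(P.prod G) = ∫ ξ, h i ξ ∂P := fun i hi => by
    rw [integral_prod _ ((hYL i hi).integrable (by simp))]
    simp only [hY, hG, integral_inner_smul_stdGaussian]
  rw [← Finset.sum_congr rfl hYmean]
  refine eLpNorm_batch_sub_mean_le (Q := P.prod G)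
    (φ := fun i q => ((H i (v + ν • q.2) q.1 - H i v q.1) / ν) • q.2) ht hm hs hlaw hind
    (by positivity) ?_ (fun i hi => (hYm i hi).stronglyMeasurable) hYL ?_ ?_
  · intro i hi
    have h1 : Measurable (fun q : Ξ × Vec d => H i (v + ν • q.2) q.1) :=
      (hH i hi).comp (f := fun q : Ξ × Vec d => (v + ν • q.2, q.1)) (by fun_prop)
    have h2 : Measurable (fun q : Ξ × Vec d => H i v q.1) :=
      (hH i hi).comp (f := fun q : Ξ × Vec d => (v, q.1)) (by fun_prop)
    exact (((h1.sub h2).div_const ν).smul measurable_snd).aestronglyMeasurable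
  · intro i hi
    rw [integral_prod _ ((memLp_two_iff_integrable_sq_norm (hYL i hi).1).1 (hYL i hi))]
    refine (integral_mono_of_nonneg (.of_forall fun ξ => integral_nonneg fun u => by positivity)
      (integrable_const (d * (∫ x : ℝ, x ^ 4 ∂(gaussianReal 0 1)) * B ^ 2)) ?_).trans (by simp)
    filter_upwards [hB i hi] with ξ hξ
    have h1 := integral_inner_sq_mul_norm_sq_le (h i ξ)
    have h2 : (0 : ℝ) ≤ d * (∫ x : ℝ, x ^ 4 ∂(gaussianReal 0 1)) :=
      mul_nonneg (Nat.cast_nonneg _) (integral_nonneg fun x => by positivity)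
    have h3 := mul_le_mul_of_nonneg_left (pow_le_pow_left₀ (norm_nonneg _) hξ 2) h2
    simp only [hY, norm_smul, mul_pow, Real.norm_eq_abs, sq_abs]
    exact h1.trans h3
  · intro i hi
    have hR : MemLp (fun q : Ξ × Vec d => L * ν * ‖q.2‖ ^ 3) 2 (P.prod G) := by
      rw [memLp_two_iff_integrable_sq (by fun_prop)]
      have h6 : Integrable (fun u : Vec d => (L * ν) ^ 2 * ‖u‖ ^ 6) G :=
        (integrable_norm_pow_stdGaussian 6).const_mul _
      refine (h6.comp_snd P).congr (.of_forall fun q => ?_)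
      ring
    -- The Taylor remainder `L ‖ν u‖²`, divided by `ν` and multiplied by `‖u‖`, is `L ν ‖u‖³`; its
    -- square brings in the sixth moment.
    have hle : eLpNorm ((fun q => ((H i (v + ν • q.2) q.1 - H i v q.1) / ν) • q.2) - Y i) 2
        (P.prod G) ≤ eLpNorm (fun q : Ξ × Vec d => L * ν * ‖q.2‖ ^ 3) 2 (P.prod G) := by
      refine eLpNorm_mono_ae_real ?_
      filter_upwards [Measure.quasiMeasurePreserving_fst.ae (hT i hi)] with q hq
      have h1 := hq (v + ν • q.2)
      rw [add_sub_cancel_left, norm_smul, Real.norm_of_nonneg hν.le, inner_smul_right] at h1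
      have e : ((fun q : Ξ × Vec d => ((H i (v + ν • q.2) q.1 - H i v q.1) / ν) • q.2) - Y i) q =
          ((H i (v + ν • q.2) q.1 - H i v q.1 - ν * ⟪h i q.1, q.2⟫) / ν) • q.2 := by
        simp only [Pi.sub_apply, hY]
        rw [← sub_smul]
        congr 1
        field_simp
      rw [e, norm_smul, norm_div, Real.norm_eq_abs, Real.norm_of_nonneg hν.le]
      have h2 : |H i (v + ν • q.2) q.1 - H i v q.1 - ν * ⟪h i q.1, q.2⟫| / ν ≤
          L * ν * ‖q.2‖ ^ 2 := by
        rw [div_le_iff₀ hν]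
        refine h1.trans (le_of_eq (by ring))
      refine (mul_le_mul_of_nonneg_right h2 (norm_nonneg _)).trans (le_of_eq (by ring))
    refine hle.trans (eLpNorm_two_le_of_integral_sq_le hR (by positivity) ?_)
    have h0 : (0 : ℝ) ≤ (d : ℝ) ^ 3 * ∫ x : ℝ, x ^ 6 ∂(gaussianReal 0 1) :=
      mul_nonneg (by positivity) (integral_nonneg fun x => by positivity)
    rw [mul_pow, Real.sq_sqrt h0]
    have h1 := mul_le_mul_of_nonneg_left (integral_norm_pow_six_le (d := d))
      (sq_nonneg (L * ν))
    refine le_of_eq_of_le ?_ h1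
    rw [← integral_const_mul]
    have h2 := integral_fun_snd (μ := P) (ν := G) (fun u : Vec d => (L * ν) ^ 2 * ‖u‖ ^ 6)
    rw [probReal_univ, one_smul] at h2
    rw [← h2]
    congr 1
    ext q
    rw [Real.norm_eq_abs, sq_abs]
    ring

end Block

/-! ### Regularity of the functions `F_i(·, ·, ξ)` and of their means -/

section Functions

variable {dX dY : ℕ} {Ξ : Type*} [MeasurableSpace Ξ] {P : Measure Ξ} {T : ℕ}
  {F : ℕ → Vec dX → Vec dY → Ξ → ℝ}

theorem StronglyConvexConcave.hasGradientAt_gradX {μX μY : ℝ}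
    (h : StronglyConvexConcave T F μX μY) {i : ℕ} (hi : 1 ≤ i) (hiT : i ≤ T) (x : Vec dX)
    (y : Vec dY) (ξ : Ξ) : HasGradientAt (fun x' => F i x' y ξ) (gradX F i x y ξ) x := by
  have h1 : Differentiable ℝ (fun z : Vec dX × Vec dY => F i z.1 z.2 ξ) :=
    (h.contDiff i hi hiT ξ).differentiable (by simp)
  have h2 : DifferentiableAt ℝ (fun x' => F i x' y ξ) x :=
    (h1 (x, y)).comp (f := fun x' => (x', y)) x (by fun_prop)
  exact h2.hasGradientAt

theorem StronglyConvexConcave.hasGradientAt_gradY {μX μY : ℝ}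
    (h : StronglyConvexConcave T F μX μY) {i : ℕ} (hi : 1 ≤ i) (hiT : i ≤ T) (x : Vec dX)
    (y : Vec dY) (ξ : Ξ) : HasGradientAt (fun y' => F i x y' ξ) (gradY F i x y ξ) y := by
  have h1 : Differentiable ℝ (fun z : Vec dX × Vec dY => F i z.1 z.2 ξ) :=
    (h.contDiff i hi hiT ξ).differentiable (by simp)
  have h2 : DifferentiableAt ℝ (fun y' => F i x y' ξ) y :=
    (h1 (x, y)).comp (f := fun y' => (x, y')) y (by fun_prop)
  exact h2.hasGradientAt

theorem measurable_gradX {μX μY : ℝ} (h : StronglyConvexConcave T F μX μY) {i : ℕ} (hi : 1 ≤ i)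
    (hiT : i ≤ T) (hm : Measurable (fun p : (Vec dX × Vec dY) × Ξ => F i p.1.1 p.1.2 p.2)) :
    Measurable (fun p : (Vec dX × Vec dY) × Ξ => gradX F i p.1.1 p.1.2 p.2) :=
  measurable_of_hasGradientAt (f := fun (p : (Vec dX × Vec dY) × Ξ) x' => F i x' p.1.2 p.2)
    (x := fun p => p.1.1)
    (hm.comp (f := fun q : ((Vec dX × Vec dY) × Ξ) × Vec dX => ((q.2, q.1.1.2), q.1.2))
      (by fun_prop)) (by fun_prop) fun p => h.hasGradientAt_gradX hi hiT p.1.1 p.1.2 p.2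

theorem measurable_gradY {μX μY : ℝ} (h : StronglyConvexConcave T F μX μY) {i : ℕ} (hi : 1 ≤ i)
    (hiT : i ≤ T) (hm : Measurable (fun p : (Vec dX × Vec dY) × Ξ => F i p.1.1 p.1.2 p.2)) :
    Measurable (fun p : (Vec dX × Vec dY) × Ξ => gradY F i p.1.1 p.1.2 p.2) :=
  measurable_of_hasGradientAt (f := fun (p : (Vec dX × Vec dY) × Ξ) y' => F i p.1.1 y' p.2)
    (x := fun p => p.1.2)
    (hm.comp (f := fun q : ((Vec dX × Vec dY) × Ξ) × Vec dY => ((q.1.1.1, q.2), q.1.2))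
      (by fun_prop)) (by fun_prop) fun p => h.hasGradientAt_gradY hi hiT p.1.1 p.1.2 p.2

/-- Almost every `F_i(·, ·, ξ)` is regular. -/
theorem ae_regularSaddle {SX : Set (Vec dX)} {SY : Set (Vec dY)}
    {μX μY LX LY LGX LGY LXY LYX : ℝ} (hSX : IsOpen SX) (hSY : IsOpen SY)
    (hF : StronglyConvexConcave T F μX μY) (hLip : LipschitzOnRegion T P F SX SY LX LY)
    (hG : LipschitzGradient T P F LGX LGY) (hGG : LipschitzPartialGradient T P F LXY LYX)
    {x₀ : Vec dX} {y₀ : Vec dY} (hx₀ : x₀ ∈ SX) (hy₀ : y₀ ∈ SY) {i : ℕ} (hi : 1 ≤ i)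
    (hiT : i ≤ T) :
    ∀ᵐ ξ ∂P, RegularSaddle (fun x y => F i x y ξ) (fun x y => gradX F i x y ξ)
      (fun x y => gradY F i x y ξ) (min μX μY) (|LGX| + |LGY| + |LXY| + |LYX|) (|LX| + |LY|)
      x₀ y₀ := by
  filter_upwards [hLip.lipX i hi hiT, hLip.lipY i hi hiT, hG.lipX i hi hiT, hG.lipY i hi hiT,
    hGG.lipXY i hi hiT, hGG.lipYX i hi hiT] with ξ h1 h2 h3 h4 h5 h6
  have a1 := abs_nonneg LGX
  have a2 := abs_nonneg LGY
  have a3 := abs_nonneg LXY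
  have a4 := abs_nonneg LYX
  have gX := fun x y => hF.hasGradientAt_gradX hi hiT x y ξ
  have gY := fun x y => hF.hasGradientAt_gradY hi hiT x y ξ
  -- The given Lipschitz constants have no prescribed sign; absolute values yield one common
  -- nonnegative constant.
  have weaken : ∀ {l L r : ℝ}, |l| ≤ L → 0 ≤ r → l * r ≤ L * r := fun hl hr =>
    mul_le_mul_of_nonneg_right ((le_abs_self _).trans hl) hr
  refine ⟨gX, gY, fun x x' y y' => ?_, fun x x' y y' => ?_,
    strongMono_of_strongConvexConcave (fun y => hF.convex i hi hiT y ξ)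
      (fun x => hF.concave i hi hiT x ξ) gX gY, ?_, ?_⟩
  · have b1 := (h3 x x' y).trans (weaken (L := |LGX| + |LGY| + |LXY| + |LYX|) (by linarith)
      (norm_nonneg _))
    have b2 := (h5 x' y y').trans (weaken (L := |LGX| + |LGY| + |LXY| + |LYX|) (by linarith)
      (norm_nonneg _))
    have b3 := norm_sub_le_norm_sub_add_norm_sub (gradX F i x y ξ) (gradX F i x' y ξ)
      (gradX F i x' y' ξ)
    linarith
  · have b1 := (h6 x x' y).trans (weaken (L := |LGX| + |LGY| + |LXY| + |LYX|) (by linarith)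
      (norm_nonneg _))
    have b2 := (h4 x' y y').trans (weaken (L := |LGX| + |LGY| + |LXY| + |LYX|) (by linarith)
      (norm_nonneg _))
    have b3 := norm_sub_le_norm_sub_add_norm_sub (gradY F i x y ξ) (gradY F i x' y ξ)
      (gradY F i x' y' ξ)
    linarith
  -- Local Lipschitz continuity is applied at the starting point alone; openness of the region turns
  -- it into a gradient bound there.
  · have := norm_gradient_le_of_lipschitzOn hSX hx₀ (gX x₀ y₀) (abs_nonneg LX)
      fun x₁ hx₁ x₂ hx₂ => (h1 x₁ hx₁ x₂ hx₂ y₀ hy₀).trans (weaken le_rfl (norm_nonneg _))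
    linarith [abs_nonneg LY]
  · have := norm_gradient_le_of_lipschitzOn hSY hy₀ (gY x₀ y₀) (abs_nonneg LY)
      fun y₁ hy₁ y₂ hy₂ => (h2 x₀ hx₀ y₁ hy₁ y₂ hy₂).trans (weaken le_rfl (norm_nonneg _))
    linarith [abs_nonneg LX]

/-- The mean `f_i` is regular if almost every `F_i(·, ·, ξ)` is. -/
theorem regularSaddle_meanF [IsProbabilityMeasure P] {σ : ℝ} (hO : StochasticOracle T P F σ)
    {m L B : ℝ} {x₀ : Vec dX} {y₀ : Vec dY} {i : ℕ} (hi : 1 ≤ i) (hiT : i ≤ T)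
    (h : ∀ᵐ ξ ∂P, RegularSaddle (fun x y => F i x y ξ) (fun x y => gradX F i x y ξ)
      (fun x y => gradY F i x y ξ) m L B x₀ y₀) :
    RegularSaddle (meanF P F i) (fun x y => ∫ ξ, gradX F i x y ξ ∂P)
      (fun x y => ∫ ξ, gradY F i x y ξ ∂P) m L B x₀ y₀ := by
  have iX := hO.integrable_gradX i hi hiT
  have iY := hO.integrable_gradY i hi hiT
  refine ⟨hO.mean_gradX i hi hiT, hO.mean_gradY i hi hiT, fun x x' y y' => ?_,
    fun x x' y y' => ?_, fun x x' y y' => ?_, ?_, ?_⟩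
  · rw [← integral_sub (iX x y) (iX x' y')]
    refine (norm_integral_le_of_norm_le_const (h.mono fun ξ hξ => hξ.lipX x x' y y')).trans ?_
    simp
  · rw [← integral_sub (iY x y) (iY x' y')]
    refine (norm_integral_le_of_norm_le_const (h.mono fun ξ hξ => hξ.lipY x x' y y')).trans ?_
    simp
  · have jX : Integrable (fun ξ => gradX F i x y ξ - gradX F i x' y' ξ) P :=
      (iX x y).sub (iX x' y')
    have jY : Integrable (fun ξ => gradY F i x y ξ - gradY F i x' y' ξ) P :=
      (iY x y).sub (iY x' y')
    rw [← integral_sub (iX x y) (iX x' y'), ← integral_sub (iY x y) (iY x' y'),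
      real_inner_comm, real_inner_comm (y - y'),
      ← integral_inner jX, ← integral_inner jY,
      ← integral_sub (jX.const_inner _) (jY.const_inner _)]
    -- The monotonicity inequality is linear in the gradients, so it can be integrated over `ξ`.
    have hc := integral_mono_ae (integrable_const (μ := P) (m * (‖x - x'‖ ^ 2 + ‖y - y'‖ ^ 2)))
      ((jX.const_inner (𝕜 := ℝ) (x - x')).sub (jY.const_inner (𝕜 := ℝ) (y - y')))
      (h.mono fun ξ hξ => by
        have := hξ.mono x x' y y'
        rw [real_inner_comm, real_inner_comm (y - y')] at this
        exact this)
    rw [integral_const, probReal_univ, one_smul] at hc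
    exact hc
  · refine (norm_integral_le_of_norm_le_const (h.mono fun ξ hξ => hξ.boundX)).trans ?_
    simp
  · refine (norm_integral_le_of_norm_le_const (h.mono fun ξ hξ => hξ.boundY)).trans ?_
    simp

end Functions

/-! ### Errors of the gradient estimators -/

section Noise

variable {dX dY : ℕ}

/-- The descent direction of the saddle-point problem: the `y`-block changes its sign. -/
def signed (g : Vec dX × Vec dY) : WithLp 2 (Vec dX × Vec dY) := WithLp.toLp 2 (g.1, - g.2)

theorem toLp_gdaStep (η : ℝ) (z g : Vec dX × Vec dY) :
    WithLp.toLp 2 (gdaStep η z g) = WithLp.toLp 2 z - η • signed g := by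
  apply (WithLp.equiv 2 (Vec dX × Vec dY)).injective
  ext1
  · rfl
  · change z.2 + η • g.2 = z.2 - η • (- g.2)
    rw [smul_neg, sub_neg_eq_add]

theorem norm_signed_sub_le (g : Vec dX × Vec dY) (a : Vec dX) (b : Vec dY) :
    ‖signed g - WithLp.toLp 2 (a, - b)‖ ≤ ‖g.1 - a‖ + ‖g.2 - b‖ := by
  refine (norm_withLp_le_add _).trans (le_of_eq ?_)
  congr 1
  rw [← norm_neg]
  congr 1
  change -(- g.2 - - b) = _
  abel

theorem measurable_signed : Measurable (signed : Vec dX × Vec dY → WithLp 2 (Vec dX × Vec dY)) :=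
  (WithLp.measurable_toLp 2 (Vec dX × Vec dY)).comp (measurable_fst.prodMk measurable_snd.neg)

variable {Ξ : Type*} [MeasurableSpace Ξ] {P : Measure Ξ} {T : ℕ}
  {F : ℕ → Vec dX → Vec dY → Ξ → ℝ}

theorem measurable_smul_sum_sum {α : Type*} [MeasurableSpace α] {d : ℕ} {I J : Finset ℕ} (c : ℝ)
    {g : ℕ → ℕ → α → Vec d} (hg : ∀ i ∈ I, ∀ j, Measurable (g i j)) :
    Measurable (fun a => c • ∑ i ∈ I, ∑ j ∈ J, g i j a) := by
  have h : Measurable (fun a => ∑ i ∈ I, ∑ j ∈ J, g i j a) :=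
    Finset.measurable_fun_sum _ fun i hi => Finset.measurable_fun_sum _ fun j _ => hg i hi j
  exact h.const_smul c

theorem measurable_gradestFirst {μX μY σ : ℝ} (hF : StronglyConvexConcave T F μX μY)
    (hO : StochasticOracle T P F σ) {t : ℕ} (htT : t ≤ T) (m : ℕ) :
    Measurable (fun p : (ℕ → ℕ → Ξ) × (Vec dX × Vec dY) => gradestFirst F t m p.1 p.2) := by
  refine Measurable.prodMk (measurable_smul_sum_sum _ fun i hi j => ?_)
    (measurable_smul_sum_sum _ fun i hi j => ?_)
  · have := measurable_gradX hF (Finset.mem_Icc.1 hi).1 ((Finset.mem_Icc.1 hi).2.trans htT)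
      (hO.measurable i (Finset.mem_Icc.1 hi).1 ((Finset.mem_Icc.1 hi).2.trans htT))
    exact this.comp (f := fun p : (ℕ → ℕ → Ξ) × (Vec dX × Vec dY) => (p.2, p.1 i j)) (by fun_prop)
  · have := measurable_gradY hF (Finset.mem_Icc.1 hi).1 ((Finset.mem_Icc.1 hi).2.trans htT)
      (hO.measurable i (Finset.mem_Icc.1 hi).1 ((Finset.mem_Icc.1 hi).2.trans htT))
    exact this.comp (f := fun p : (ℕ → ℕ → Ξ) × (Vec dX × Vec dY) => (p.2, p.1 i j)) (by fun_prop)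

theorem measurable_gradestZeroth {σ : ℝ} (hO : StochasticOracle T P F σ) {t : ℕ} (htT : t ≤ T)
    (mX mY : ℕ) (νX νY : ℝ) :
    Measurable (fun p : (ℕ → ℕ → (Ξ × Vec dX) × (Ξ × Vec dY)) × (Vec dX × Vec dY) =>
      gradestZeroth F t mX mY νX νY p.1 p.2) := by
  refine Measurable.prodMk (measurable_smul_sum_sum _ fun i hi j => ?_)
    (measurable_smul_sum_sum _ fun i hi j => ?_)
  · have h := hO.measurable i (Finset.mem_Icc.1 hi).1 ((Finset.mem_Icc.1 hi).2.trans htT)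
    have h1 := h.comp (f := fun p : (ℕ → ℕ → (Ξ × Vec dX) × (Ξ × Vec dY)) × (Vec dX × Vec dY) =>
      ((p.2.1 + νX • (p.1 i j).1.2, p.2.2), (p.1 i j).1.1)) (by fun_prop)
    have h2 := h.comp (f := fun p : (ℕ → ℕ → (Ξ × Vec dX) × (Ξ × Vec dY)) × (Vec dX × Vec dY) =>
      ((p.2.1, p.2.2), (p.1 i j).1.1)) (by fun_prop)
    exact ((h1.sub h2).div_const νX).smul (by fun_prop)
  · have h := hO.measurable i (Finset.mem_Icc.1 hi).1 ((Finset.mem_Icc.1 hi).2.trans htT)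
    have h1 := h.comp (f := fun p : (ℕ → ℕ → (Ξ × Vec dX) × (Ξ × Vec dY)) × (Vec dX × Vec dY) =>
      ((p.2.1, p.2.2 + νY • (p.1 i j).2.2), (p.1 i j).2.1)) (by fun_prop)
    have h2 := h.comp (f := fun p : (ℕ → ℕ → (Ξ × Vec dX) × (Ξ × Vec dY)) × (Vec dX × Vec dY) =>
      ((p.2.1, p.2.2), (p.1 i j).2.1)) (by fun_prop)
    exact ((h1.sub h2).div_const νY).smul (by fun_prop)

end Noise

/-! ### Mean square noise of the estimators at a fixed point -/

section NoiseBound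

variable {dX dY : ℕ} {Ξ : Type*} [MeasurableSpace Ξ] {P : Measure Ξ} [IsProbabilityMeasure P]
  {T : ℕ} {F : ℕ → Vec dX → Vec dY → Ξ → ℝ} {Ω : Type*} [MeasurableSpace Ω] {Pr : Measure Ω}
  [IsProbabilityMeasure Pr]

theorem eLpNorm_norm_signed_sub_le {g : Ω → Vec dX × Vec dY} (hg : Measurable g) {a : Vec dX}
    {b : Vec dY} {α β : ℝ} (hα : 0 ≤ α) (hβ : 0 ≤ β)
    (ha : eLpNorm (fun ω => (g ω).1 - a) 2 Pr ≤ ENNReal.ofReal α)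
    (hb : eLpNorm (fun ω => (g ω).2 - b) 2 Pr ≤ ENNReal.ofReal β) :
    eLpNorm (fun ω => ‖signed (g ω) - WithLp.toLp 2 (a, - b)‖) 2 Pr ≤ ENNReal.ofReal (α + β) := by
  have m1 : Measurable (fun ω => (g ω).1 - a) := (measurable_fst.comp hg).sub_const a
  have m2 : Measurable (fun ω => (g ω).2 - b) := (measurable_snd.comp hg).sub_const b
  have h1 : eLpNorm (fun ω => ‖signed (g ω) - WithLp.toLp 2 (a, - b)‖) 2 Pr ≤
      eLpNorm ((fun ω => ‖(g ω).1 - a‖) + (fun ω => ‖(g ω).2 - b‖)) 2 Pr :=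
    eLpNorm_mono_real fun ω => by
      rw [norm_norm]
      exact norm_signed_sub_le (g ω) a b
  refine h1.trans ((eLpNorm_add_le m1.norm.aestronglyMeasurable m2.norm.aestronglyMeasurable
    (by norm_num)).trans ?_)
  rw [eLpNorm_norm, eLpNorm_norm, ENNReal.ofReal_add hα hβ]
  exact add_le_add ha hb

/-- Almost sure bound for the partial gradients in terms of the distance to the starting point. -/
theorem ae_norm_grad_le {m L B : ℝ} (hL : 0 ≤ L) {x₀ : Vec dX} {y₀ : Vec dY} {i : ℕ}
    (h : ∀ᵐ ξ ∂P, RegularSaddle (fun x y => F i x y ξ) (fun x y => gradX F i x y ξ)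
      (fun x y => gradY F i x y ξ) m L B x₀ y₀) (z : Vec dX × Vec dY) :
    (∀ᵐ ξ ∂P, ‖gradX F i z.1 z.2 ξ‖ ≤
      (B + 2 * L) * (1 + ‖WithLp.toLp 2 z - WithLp.toLp 2 (x₀, y₀)‖)) ∧
    (∀ᵐ ξ ∂P, ‖gradY F i z.1 z.2 ξ‖ ≤
      (B + 2 * L) * (1 + ‖WithLp.toLp 2 z - WithLp.toLp 2 (x₀, y₀)‖)) := by
  have h5 : ‖z.1 - x₀‖ ≤ ‖WithLp.toLp 2 z - WithLp.toLp 2 (x₀, y₀)‖ :=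
    norm_fst_le_withLp (WithLp.toLp 2 z - WithLp.toLp 2 (x₀, y₀))
  have h6 : ‖z.2 - y₀‖ ≤ ‖WithLp.toLp 2 z - WithLp.toLp 2 (x₀, y₀)‖ :=
    norm_snd_le_withLp (WithLp.toLp 2 z - WithLp.toLp 2 (x₀, y₀))
  have h7 := mul_le_mul_of_nonneg_left (add_le_add h5 h6) hL
  set r := ‖WithLp.toLp 2 z - WithLp.toLp 2 (x₀, y₀)‖
  have hr : 0 ≤ r := norm_nonneg _
  constructor
  · filter_upwards [h] with ξ hξ
    have h1 := hξ.lipX z.1 x₀ z.2 y₀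
    have h2 := norm_sub_norm_le (gradX F i z.1 z.2 ξ) (gradX F i x₀ y₀ ξ)
    have h3 := hξ.boundX
    nlinarith [(norm_nonneg _).trans h3]
  · filter_upwards [h] with ξ hξ
    have h1 := hξ.lipY z.1 x₀ z.2 y₀
    have h2 := norm_sub_norm_le (gradY F i z.1 z.2 ξ) (gradY F i x₀ y₀ ξ)
    have h3 := hξ.boundY
    nlinarith [(norm_nonneg _).trans h3]

/-- The constant in the bounds for the noise of the gradient estimators. -/
noncomputable def noiseConst (L B c : ℝ) : ℝ :=
  2 * c * ((√(∫ x : ℝ, x ^ 4 ∂(gaussianReal 0 1)) + 1) * (B + 2 * L) +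
    L * √(∫ x : ℝ, x ^ 6 ∂(gaussianReal 0 1)))

theorem one_le_batchFirst {p : ℕ} {η : ℝ} (hη : 0 < η) : 1 ≤ batchFirst p η :=
  Nat.one_le_ceil_iff.2 (by positivity)

theorem one_le_batchZeroth {p d : ℕ} {η : ℝ} (hη : 0 < η) : 1 ≤ batchZeroth p η d :=
  Nat.one_le_ceil_iff.2 (by positivity)

/-- The batch size is at least `η^{-p}`, so the standard deviation is at most `b η^{p/2}`, that is,
first order in `η`. The constant `c` lets `p = 2` and `p = 4` share one bound. -/
theorem sqrt_div_batchFirst_le {p : ℕ} {η c b : ℝ} (hη : 0 < η) (hc : 0 ≤ c) (hb : 0 ≤ b)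
    (hp : η ^ p ≤ (c * η) ^ 2) : √(b ^ 2 / batchFirst p η) ≤ b * (c * η) := by
  have hm : (1 : ℝ) ≤ batchFirst p η := by exact_mod_cast one_le_batchFirst hη
  have h1 : 1 / η ^ p ≤ batchFirst p η := Nat.le_ceil _
  refine Real.sqrt_le_iff.2 ⟨by positivity, ?_⟩
  rw [div_le_iff₀ (by positivity), mul_pow, mul_assoc]
  refine le_mul_of_one_le_right (by positivity) ?_
  rw [div_le_iff₀ (by positivity)] at h1
  nlinarith

theorem sqrt_div_batchZeroth_le {p d : ℕ} {η c b M : ℝ} (hη : 0 < η) (hc : 0 ≤ c) (hb : 0 ≤ b)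
    (hM : 0 ≤ M) (hp : η ^ p ≤ (c * η) ^ 2) :
    √(d * M * b ^ 2 / batchZeroth p η d) ≤ √M * b * (c * η) := by
  have hm : (1 : ℝ) ≤ batchZeroth p η d := by exact_mod_cast one_le_batchZeroth hη
  have h1 : ((d : ℝ) + 5) / η ^ p ≤ batchZeroth p η d := Nat.le_ceil _
  refine Real.sqrt_le_iff.2 ⟨by positivity, ?_⟩
  rw [div_le_iff₀ (by positivity), mul_pow, mul_pow, Real.sq_sqrt hM]
  rw [div_le_iff₀ (by positivity)] at h1
  have h2 : (d : ℝ) ≤ (c * η) ^ 2 * batchZeroth p η d := by nlinarith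
  have h3 := mul_le_mul_of_nonneg_left h2 (by positivity : 0 ≤ M * b ^ 2)
  linarith

/-- The exponent `-3/2` in the smoothing radius compensates the root of the sixth Gaussian moment,
which grows like `d^{3/2}`. -/
theorem smoothing_mul_sqrt_le {p d : ℕ} {η c L M : ℝ} (hη : 0 < η) (hL : 0 ≤ L)
    (hp : η ^ p ≤ c * η) : L * smoothing p η d * √((d : ℝ) ^ 3 * M) ≤ L * √M * (c * η) := by
  have hd : (0 : ℝ) < (d : ℝ) + 3 := by positivity
  have h1 : √((d : ℝ) ^ 3) ≤ ((d : ℝ) + 3) ^ (3 / 2 : ℝ) := by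
    refine Real.sqrt_le_iff.2 ⟨by positivity, ?_⟩
    rw [← Real.rpow_natCast (((d : ℝ) + 3) ^ (3 / 2 : ℝ)), ← Real.rpow_mul hd.le]
    norm_num
    exact pow_le_pow_left₀ (Nat.cast_nonneg _) (by linarith) 3
  have h2 : ((d : ℝ) + 3) ^ (-(3 / 2) : ℝ) * ((d : ℝ) + 3) ^ (3 / 2 : ℝ) = 1 := by
    rw [← Real.rpow_add hd]
    simp
  rw [Real.sqrt_mul (by positivity), smoothing]
  calc L * (η ^ p * ((d : ℝ) + 3) ^ (-(3 / 2) : ℝ)) * (√((d : ℝ) ^ 3) * √M)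
      = (L * √M * η ^ p) * (((d : ℝ) + 3) ^ (-(3 / 2) : ℝ) * √((d : ℝ) ^ 3)) := by ring
    _ ≤ (L * √M * η ^ p) * (((d : ℝ) + 3) ^ (-(3 / 2) : ℝ) * ((d : ℝ) + 3) ^ (3 / 2 : ℝ)) := by
        gcongr
    _ = L * √M * η ^ p := by rw [h2, mul_one]
    _ ≤ L * √M * (c * η) := by gcongr

variable {μX μY σ m L B : ℝ} {x₀ : Vec dX} {y₀ : Vec dY}

/-- The noise of the first-order estimator at a fixed point. -/
theorem noise_gradestFirst_le (hF : StronglyConvexConcave T F μX μY)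
    (hO : StochasticOracle T P F σ) (hL : 0 ≤ L) (hB : 0 ≤ B)
    (hreg : ∀ i, 1 ≤ i → i ≤ T → ∀ᵐ ξ ∂P, RegularSaddle (fun x y => F i x y ξ)
      (fun x y => gradX F i x y ξ) (fun x y => gradY F i x y ξ) m L B x₀ y₀)
    {p : ℕ} {η c : ℝ} (hη : 0 < η) (hc : 0 ≤ c) (hp : η ^ p ≤ (c * η) ^ 2)
    {t : ℕ} (ht : 1 ≤ t) (htT : t ≤ T) {s : ℕ → ℕ → Ω → Ξ}
    (hs : ∀ i j, Measurable (s i j)) (hlaw : ∀ i j, Pr.map (s i j) = P)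
    (hind : iIndepFun (fun a : ℕ × ℕ => s a.1 a.2) Pr) (z : Vec dX × Vec dY) :
    eLpNorm (fun ω => ‖signed (gradestFirst F t (batchFirst p η) (fun i j => s i j ω) z) -
      avgOp (fun i x y => ∫ ξ, gradX F i x y ξ ∂P) (fun i x y => ∫ ξ, gradY F i x y ξ ∂P) t
        (WithLp.toLp 2 z)‖) 2 Pr ≤
      ENNReal.ofReal (noiseConst L B c * η *
        (1 + ‖WithLp.toLp 2 z - WithLp.toLp 2 (x₀, y₀)‖)) := by
  set r := ‖WithLp.toLp 2 z - WithLp.toLp 2 (x₀, y₀)‖ with hr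
  have hr0 : 0 ≤ r := norm_nonneg _
  have hb : 0 ≤ (B + 2 * L) * (1 + r) := by positivity
  have hI : ∀ i ∈ Finset.Icc 1 t, 1 ≤ i ∧ i ≤ T := fun i hi =>
    ⟨(Finset.mem_Icc.1 hi).1, (Finset.mem_Icc.1 hi).2.trans htT⟩
  have hx := eLpNorm_first_block_le ht (one_le_batchFirst (p := p) hη) hs hlaw hind
    (h := fun i => gradX F i z.1 z.2) (B := (B + 2 * L) * (1 + r))
    (fun i hi => (measurable_gradX hF (hI i hi).1 (hI i hi).2
      (hO.measurable i (hI i hi).1 (hI i hi).2)).comp (f := fun ξ : Ξ => (z, ξ)) (by fun_prop))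
    (fun i hi => (ae_norm_grad_le hL (hreg i (hI i hi).1 (hI i hi).2) z).1)
  have hy := eLpNorm_first_block_le ht (one_le_batchFirst (p := p) hη) hs hlaw hind
    (h := fun i => gradY F i z.1 z.2) (B := (B + 2 * L) * (1 + r))
    (fun i hi => (measurable_gradY hF (hI i hi).1 (hI i hi).2
      (hO.measurable i (hI i hi).1 (hI i hi).2)).comp (f := fun ξ : Ξ => (z, ξ)) (by fun_prop))
    (fun i hi => (ae_norm_grad_le hL (hreg i (hI i hi).1 (hI i hi).2) z).2)
  have hg : Measurable (fun ω => gradestFirst F t (batchFirst p η) (fun i j => s i j ω) z) :=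
    (measurable_gradestFirst hF hO htT _).comp (f := fun ω => ((fun i j => s i j ω), z)) (by
      have : Measurable (fun ω => fun i j => s i j ω) :=
        measurable_pi_iff.2 fun i => measurable_pi_iff.2 fun j => hs i j
      exact this.prodMk measurable_const)
  refine (eLpNorm_norm_signed_sub_le hg (Real.sqrt_nonneg _) (Real.sqrt_nonneg _) hx hy).trans
    (ENNReal.ofReal_le_ofReal ?_)
  have h1 := sqrt_div_batchFirst_le hη hc hb hp
  -- `noiseConst` serves both estimators: the first-order one needs only its `1 · (B + 2L)` part,
  -- and these terms are the slack. The factor `2` counts the two blocks.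
  have h2 : (0 : ℝ) ≤ 2 * c * (√(∫ x : ℝ, x ^ 4 ∂(gaussianReal 0 1)) * (B + 2 * L) +
      L * √(∫ x : ℝ, x ^ 6 ∂(gaussianReal 0 1))) * (η * (1 + r)) := by positivity
  rw [noiseConst]
  linarith

/-- The noise of the zeroth-order estimator at a fixed point. -/
theorem noise_gradestZeroth_le (hF : StronglyConvexConcave T F μX μY)
    (hO : StochasticOracle T P F σ) (hL : 0 ≤ L) (hB : 0 ≤ B)
    (hreg : ∀ i, 1 ≤ i → i ≤ T → ∀ᵐ ξ ∂P, RegularSaddle (fun x y => F i x y ξ)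
      (fun x y => gradX F i x y ξ) (fun x y => gradY F i x y ξ) m L B x₀ y₀)
    {p : ℕ} {η c : ℝ} (hη : 0 < η) (hc : 0 ≤ c) (hp : η ^ p ≤ (c * η) ^ 2)
    (hp' : η ^ p ≤ c * η) {t : ℕ} (ht : 1 ≤ t) (htT : t ≤ T)
    {s : ℕ → ℕ → Ω → (Ξ × Vec dX) × (Ξ × Vec dY)} (hs : ∀ i j, Measurable (s i j))
    (hlaw : ∀ i j, Pr.map (s i j) =
      (P.prod (stdGaussian (Vec dX))).prod (P.prod (stdGaussian (Vec dY))))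
    (hind : iIndepFun (fun a : ℕ × ℕ => s a.1 a.2) Pr) (z : Vec dX × Vec dY) :
    eLpNorm (fun ω => ‖signed (gradestZeroth F t (batchZeroth p η dX) (batchZeroth p η dY)
        (smoothing p η dX) (smoothing p η dY) (fun i j => s i j ω) z) -
      avgOp (fun i x y => ∫ ξ, gradX F i x y ξ ∂P) (fun i x y => ∫ ξ, gradY F i x y ξ ∂P) t
        (WithLp.toLp 2 z)‖) 2 Pr ≤
      ENNReal.ofReal (noiseConst L B c * η *
        (1 + ‖WithLp.toLp 2 z - WithLp.toLp 2 (x₀, y₀)‖)) := by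
  set r := ‖WithLp.toLp 2 z - WithLp.toLp 2 (x₀, y₀)‖ with hr
  have hr0 : 0 ≤ r := norm_nonneg _
  have hb : 0 ≤ (B + 2 * L) * (1 + r) := by positivity
  have hν : ∀ d, 0 < smoothing p η d := fun d => by
    rw [smoothing]
    positivity
  have hI : ∀ i ∈ Finset.Icc 1 t, 1 ≤ i ∧ i ≤ T := fun i hi =>
    ⟨(Finset.mem_Icc.1 hi).1, (Finset.mem_Icc.1 hi).2.trans htT⟩
  have hx := eLpNorm_zeroth_block_le (P := P) (Pr := Pr) (s := fun i j ω => (s i j ω).1) ht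
    (one_le_batchZeroth (p := p) (d := dX) hη) (fun i j => (hs i j).fst)
    (fun i j => by
      change Pr.map (Prod.fst ∘ s i j) = _
      rw [← Measure.map_map measurable_fst (hs i j), hlaw, Measure.map_fst_prod, measure_univ,
        one_smul])
    (hind.comp (fun _ => Prod.fst) fun _ => measurable_fst)
    (H := fun i v ξ => F i v z.2 ξ) (v := z.1) (h := fun i => gradX F i z.1 z.2)
    (B := (B + 2 * L) * (1 + r)) (hν dX) hL
    (fun i hi => (hO.measurable i (hI i hi).1 (hI i hi).2).comp
      (f := fun q : Vec dX × Ξ => ((q.1, z.2), q.2)) (by fun_prop))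
    (fun i hi => (measurable_gradX hF (hI i hi).1 (hI i hi).2
      (hO.measurable i (hI i hi).1 (hI i hi).2)).comp (f := fun ξ : Ξ => (z, ξ)) (by fun_prop))
    (fun i hi => (ae_norm_grad_le hL (hreg i (hI i hi).1 (hI i hi).2) z).1)
    (fun i hi => (hreg i (hI i hi).1 (hI i hi).2).mono fun ξ hξ v' =>
      abs_sub_sub_inner_le (fun w => hξ.gradX w z.2)
        (fun w w' => by simpa using hξ.lipX w w' z.2 z.2) v' z.1)
  have hy := eLpNorm_zeroth_block_le (P := P) (Pr := Pr) (s := fun i j ω => (s i j ω).2) ht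
    (one_le_batchZeroth (p := p) (d := dY) hη) (fun i j => (hs i j).snd)
    (fun i j => by
      change Pr.map (Prod.snd ∘ s i j) = _
      rw [← Measure.map_map measurable_snd (hs i j), hlaw, Measure.map_snd_prod, measure_univ,
        one_smul])
    (hind.comp (fun _ => Prod.snd) fun _ => measurable_snd)
    (H := fun i v ξ => F i z.1 v ξ) (v := z.2) (h := fun i => gradY F i z.1 z.2)
    (B := (B + 2 * L) * (1 + r)) (hν dY) hL
    (fun i hi => (hO.measurable i (hI i hi).1 (hI i hi).2).comp
      (f := fun q : Vec dY × Ξ => ((z.1, q.1), q.2)) (by fun_prop))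
    (fun i hi => (measurable_gradY hF (hI i hi).1 (hI i hi).2
      (hO.measurable i (hI i hi).1 (hI i hi).2)).comp (f := fun ξ : Ξ => (z, ξ)) (by fun_prop))
    (fun i hi => (ae_norm_grad_le hL (hreg i (hI i hi).1 (hI i hi).2) z).2)
    (fun i hi => (hreg i (hI i hi).1 (hI i hi).2).mono fun ξ hξ v' =>
      abs_sub_sub_inner_le (fun w => hξ.gradY z.1 w)
        (fun w w' => by simpa using hξ.lipY z.1 z.1 w w') v' z.2)
  have hg : Measurable (fun ω => gradestZeroth F t (batchZeroth p η dX) (batchZeroth p η dY)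
        (smoothing p η dX) (smoothing p η dY) (fun i j => s i j ω) z) :=
    (measurable_gradestZeroth hO htT _ _ _ _).comp (f := fun ω => ((fun i j => s i j ω), z)) (by
      have : Measurable (fun ω => fun i j => s i j ω) :=
        measurable_pi_iff.2 fun i => measurable_pi_iff.2 fun j => hs i j
      exact this.prodMk measurable_const)
  have hM4 : (0 : ℝ) ≤ ∫ x : ℝ, x ^ 4 ∂(gaussianReal 0 1) := integral_nonneg fun x => by positivity
  refine (eLpNorm_norm_signed_sub_le hg
    (add_nonneg (Real.sqrt_nonneg _) (mul_nonneg (mul_nonneg hL (hν dX).le) (Real.sqrt_nonneg _)))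
    (add_nonneg (Real.sqrt_nonneg _) (mul_nonneg (mul_nonneg hL (hν dY).le) (Real.sqrt_nonneg _)))
    hx hy).trans (ENNReal.ofReal_le_ofReal ?_)
  have h1 := sqrt_div_batchZeroth_le (d := dX) hη hc hb hM4 hp
  have h2 := sqrt_div_batchZeroth_le (d := dY) hη hc hb hM4 hp
  have h3 := smoothing_mul_sqrt_le (d := dX) (M := ∫ x : ℝ, x ^ 6 ∂(gaussianReal 0 1)) hη hL hp'
  have h4 := smoothing_mul_sqrt_le (d := dY) (M := ∫ x : ℝ, x ^ 6 ∂(gaussianReal 0 1)) hη hL hp'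
  have h5 : (0 : ℝ) ≤ 2 * c * (B + 2 * L) * (η * (1 + r)) := by positivity
  have h6 : (0 : ℝ) ≤ L * √(∫ x : ℝ, x ^ 6 ∂(gaussianReal 0 1)) * (c * η) * r := by positivity
  rw [noiseConst]
  linarith

end NoiseBound

/-! ### Independence of the iterates and the fresh samples -/

section Independence

variable {Ω S : Type*} [MeasurableSpace Ω] [MeasurableSpace S] {Pr : Measure Ω}

/-- The σ-algebra generated by the samples with index in `A`. -/
abbrev sampleAlg (s : SampleIdx → Ω → S) (A : Set SampleIdx) : MeasurableSpace Ω :=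
  ⨆ a ∈ A, MeasurableSpace.comap (s a) inferInstance

theorem sampleAlg_mono (s : SampleIdx → Ω → S) {A B : Set SampleIdx} (h : A ⊆ B) :
    sampleAlg s A ≤ sampleAlg s B :=
  biSup_mono h

theorem sampleAlg_le {s : SampleIdx → Ω → S} (hs : ∀ a, Measurable (s a)) (A : Set SampleIdx) :
    sampleAlg s A ≤ (inferInstance : MeasurableSpace Ω) :=
  iSup₂_le fun a _ => (hs a).comap_le

theorem measurable_sampleAlg (s : SampleIdx → Ω → S) {A : Set SampleIdx} {a : SampleIdx}
    (ha : a ∈ A) : Measurable[sampleAlg s A] (s a) :=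
  measurable_iff_comap_le.2 (le_iSup₂_of_le a ha le_rfl)

theorem measurable_batch_sampleAlg (s : SampleIdx → Ω → S) {A : Set SampleIdx} {t : ℕ} {k : Fin 2}
    (hA : ∀ i j, (t, k, i, j) ∈ A) :
    Measurable[sampleAlg s A] (fun ω i j => s (t, k, i, j) ω) :=
  @measurable_pi_lambda _ _ _ (sampleAlg s A) _ _ fun i =>
    @measurable_pi_lambda _ _ _ (sampleAlg s A) _ _ fun j => measurable_sampleAlg s (hA i j)

theorem indepFun_of_disjoint {s : SampleIdx → Ω → S} (hs : ∀ a, Measurable (s a))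
    (hind : iIndepFun s Pr) {A B : Set SampleIdx} (hAB : Disjoint A B) {α β : Type*}
    [MeasurableSpace α] [MeasurableSpace β] {f : Ω → α} {g : Ω → β}
    (hf : Measurable[sampleAlg s A] f) (hg : Measurable[sampleAlg s B] g) : IndepFun f g Pr :=
  indep_of_indep_of_le_right (indep_of_indep_of_le_left
    (indep_iSup_of_disjoint (fun a => (hs a).comap_le) hind hAB) hf.comap_le) hg.comap_le

/-- If `W` is independent of `Z`, an `L²` bound at each fixed point `z` can be applied at the
random point `Z`. -/
theorem eLpNorm_indep_le [IsProbabilityMeasure Pr] {α β : Type*} [MeasurableSpace α]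
    [MeasurableSpace β] {Z : Ω → α} {W : Ω → β} (hZ : Measurable Z) (hW : Measurable W)
    (hind : IndepFun Z W Pr) {n : α → β → ℝ} (hn : Measurable (fun q : α × β => n q.1 q.2))
    {b : α → ℝ} (hb0 : ∀ z, 0 ≤ b z)
    (hb : ∀ z, eLpNorm (fun ω => n z (W ω)) 2 Pr ≤ ENNReal.ofReal (b z)) :
    eLpNorm (fun ω => n (Z ω) (W ω)) 2 Pr ≤ eLpNorm (fun ω => b (Z ω)) 2 Pr := by
  have key : ∀ f : Ω → ℝ, eLpNorm f 2 Pr ^ (2 : ℝ) = ∫⁻ ω, ‖f ω‖ₑ ^ (2 : ℝ) ∂Pr := fun f => by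
    have := eLpNorm_nnreal_pow_eq_lintegral (μ := Pr) (f := f) (p := 2) (by simp)
    simpa using this
  rw [← ENNReal.rpow_le_rpow_iff (z := 2) (by norm_num), key, key]
  have hm : Measurable (fun q : α × β => ‖n q.1 q.2‖ₑ ^ (2 : ℝ)) := hn.enorm.pow_const _
  -- Independence makes the joint law a product, so Tonelli freezes `Z` and leaves the bound at a
  -- fixed point.
  have h1 : ∫⁻ ω, ‖n (Z ω) (W ω)‖ₑ ^ (2 : ℝ) ∂Pr =
      ∫⁻ q, ‖n q.1 q.2‖ₑ ^ (2 : ℝ) ∂((Pr.map Z).prod (Pr.map W)) := by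
    rw [← hind.map_prod_eq_prod_map_map hZ.aemeasurable hW.aemeasurable,
      lintegral_map hm (hZ.prodMk hW)]
  have := Measure.isProbabilityMeasure_map (μ := Pr) hW.aemeasurable
  rw [h1, lintegral_prod _ hm.aemeasurable, lintegral_map hm.lintegral_prod_right' hZ]
  refine lintegral_mono fun ω => ?_
  simp only
  rw [lintegral_map (f := fun w => ‖n (Z ω) w‖ₑ ^ (2 : ℝ)) (hm.comp measurable_prodMk_left) hW,
    ← key]
  refine ENNReal.rpow_le_rpow ((hb (Z ω)).trans_eq ?_) (by norm_num)
  rw [Real.enorm_of_nonneg (hb0 _)]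

end Independence

/-! ### The iterates -/

section Iterates

variable {dX dY : ℕ} {Ω S : Type*} [MeasurableSpace Ω] [MeasurableSpace S] {Pr : Measure Ω}

/-- The extragradient iterates driven by the estimators `est` and the samples `s`. -/
def sampleIter (η : ℝ) (est : ℕ → (ℕ → ℕ → S) → Vec dX × Vec dY → Vec dX × Vec dY)
    (z₀ : Vec dX × Vec dY) (s : SampleIdx → Ω → S) (ω : Ω) : ℕ → Vec dX × Vec dY :=
  egIter η (fun t k => est t (fun i j => s (t, k, i, j) ω)) z₀

/-- The intermediate point of round `t`. -/
def sampleHalf (η : ℝ) (est : ℕ → (ℕ → ℕ → S) → Vec dX × Vec dY → Vec dX × Vec dY)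
    (z₀ : Vec dX × Vec dY) (s : SampleIdx → Ω → S) (ω : Ω) (t : ℕ) : Vec dX × Vec dY :=
  gdaStep η (sampleIter η est z₀ s ω t)
    (est t (fun i j => s (t, 0, i, j) ω) (sampleIter η est z₀ s ω t))

variable {η : ℝ} {est : ℕ → (ℕ → ℕ → S) → Vec dX × Vec dY → Vec dX × Vec dY}
  {z₀ : Vec dX × Vec dY} {s : SampleIdx → Ω → S} {T : ℕ}

theorem sampleIter_succ (ω : Ω) (t : ℕ) : sampleIter η est z₀ s ω (t + 1) =
    gdaStep η (sampleIter η est z₀ s ω t)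
      (est t (fun i j => s (t, 1, i, j) ω) (sampleHalf η est z₀ s ω t)) := rfl

theorem measurable_gdaStep (η : ℝ) :
    Measurable (fun q : (Vec dX × Vec dY) × (Vec dX × Vec dY) => gdaStep η q.1 q.2) := by
  unfold gdaStep
  fun_prop

theorem measurable_sampleHalf_of (hest : ∀ t ≤ T, Measurable
      (fun q : (ℕ → ℕ → S) × (Vec dX × Vec dY) => est t q.1 q.2)) {t : ℕ} (ht : t ≤ T)
    {A : Set SampleIdx} (hA : ∀ i j, (t, 0, i, j) ∈ A)
    (h : Measurable[sampleAlg s A] (fun ω => sampleIter η est z₀ s ω t)) :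
    Measurable[sampleAlg s A] (fun ω => sampleHalf η est z₀ s ω t) :=
  (measurable_gdaStep η).comp (h.prodMk ((hest t ht).comp
    ((measurable_batch_sampleAlg s hA).prodMk h)))

theorem measurable_sampleIter (hest : ∀ t ≤ T, Measurable
      (fun q : (ℕ → ℕ → S) × (Vec dX × Vec dY) => est t q.1 q.2)) {t : ℕ} (ht : t ≤ T + 1) :
    Measurable[sampleAlg s {a | a.1 < t}] (fun ω => sampleIter η est z₀ s ω t) := by
  induction t with
  | zero => exact @measurable_const _ _ _ (sampleAlg s _) z₀
  | succ t ih =>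
    have h1 : Measurable[sampleAlg s {a | a.1 < t + 1}] (fun ω => sampleIter η est z₀ s ω t) :=
      (ih (by omega)).mono (sampleAlg_mono s fun a (ha : a.1 < t) => Nat.lt_succ_of_lt ha) le_rfl
    have h2 := measurable_sampleHalf_of hest (by omega : t ≤ T)
      (fun i j => (Nat.lt_succ_self t : t < t + 1)) h1
    exact (measurable_gdaStep η).comp (h1.prodMk ((hest t (by omega)).comp
      ((measurable_batch_sampleAlg s fun i j => (Nat.lt_succ_self t : t < t + 1)).prodMk h2)))

theorem measurable_sampleHalf (hest : ∀ t ≤ T, Measurable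
      (fun q : (ℕ → ℕ → S) × (Vec dX × Vec dY) => est t q.1 q.2)) {t : ℕ} (ht : t ≤ T) :
    Measurable[sampleAlg s {a | a.1 < t ∨ a.1 = t ∧ a.2.1 = 0}]
      (fun ω => sampleHalf η est z₀ s ω t) :=
  measurable_sampleHalf_of hest ht (fun _ _ => Or.inr ⟨rfl, rfl⟩)
    ((measurable_sampleIter hest (by omega)).mono
      (sampleAlg_mono s fun _ (ha : _ < t) => Or.inl ha) le_rfl)

/-- The iterate `z_t` depends on samples of earlier rounds only. -/
theorem indepFun_sampleIter (hs : ∀ a, Measurable (s a)) (hind : iIndepFun s Pr)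
    (hest : ∀ t ≤ T, Measurable
      (fun q : (ℕ → ℕ → S) × (Vec dX × Vec dY) => est t q.1 q.2)) {t : ℕ} (ht : t ≤ T) :
    IndepFun (fun ω => sampleIter η est z₀ s ω t) (fun ω i j => s (t, 0, i, j) ω) Pr :=
  indepFun_of_disjoint hs hind (A := {a | a.1 < t}) (B := {a | a.1 = t})
    (disjoint_left.2 fun _ h1 h2 => (ne_of_lt h1) h2)
    (measurable_sampleIter hest (by omega)) (measurable_batch_sampleAlg s fun _ _ => rfl)

/-- The half point also uses the samples of call `0` in round `t`; those of call `1` remain fresh.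
-/
theorem indepFun_sampleHalf (hs : ∀ a, Measurable (s a)) (hind : iIndepFun s Pr)
    (hest : ∀ t ≤ T, Measurable
      (fun q : (ℕ → ℕ → S) × (Vec dX × Vec dY) => est t q.1 q.2)) {t : ℕ} (ht : t ≤ T) :
    IndepFun (fun ω => sampleHalf η est z₀ s ω t) (fun ω i j => s (t, 1, i, j) ω) Pr :=
  indepFun_of_disjoint hs hind (A := {a | a.1 < t ∨ a.1 = t ∧ a.2.1 = 0})
    (B := {a | a.1 = t ∧ a.2.1 = 1})
    (disjoint_left.2 fun a h1 h2 => by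
      rcases h1 with h1 | h1
      · exact (ne_of_lt h1) h2.1
      · exact absurd (h1.2.symm.trans h2.2) (by decide))
    (measurable_sampleHalf hest ht) (measurable_batch_sampleAlg s fun _ _ => ⟨rfl, rfl⟩)

end Iterates

/-! ### Tracking of the saddle points in mean square -/

section Tracking

variable {dX dY : ℕ} {Ω S : Type*} [MeasurableSpace Ω] [MeasurableSpace S] {Pr : Measure Ω}
  [IsProbabilityMeasure Pr]

/-- Minkowski in `L²`. Pathwise linear inequalities between distances become the same inequalities
between root mean squares, so no cross terms have to be expanded. -/
theorem eLpNorm_le_of_le_linear {f g h : Ω → ℝ} {a b α β : ℝ} (ha : 0 ≤ a) (hb : 0 ≤ b)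
    (hg : AEStronglyMeasurable g Pr) (hh : AEStronglyMeasurable h Pr)
    (hf0 : ∀ ω, 0 ≤ f ω) (hf : ∀ ω, f ω ≤ a * g ω + b * h ω) (hα : 0 ≤ α) (hβ : 0 ≤ β)
    (hgα : eLpNorm g 2 Pr ≤ ENNReal.ofReal α) (hhβ : eLpNorm h 2 Pr ≤ ENNReal.ofReal β) :
    eLpNorm f 2 Pr ≤ ENNReal.ofReal (a * α + b * β) := by
  have h1 : eLpNorm f 2 Pr ≤ eLpNorm (a • g + b • h) 2 Pr :=
    eLpNorm_mono_real fun ω => by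
      rw [Real.norm_of_nonneg (hf0 ω)]
      exact hf ω
  refine h1.trans ((eLpNorm_add_le (hg.const_smul a) (hh.const_smul b) (by norm_num)).trans ?_)
  rw [eLpNorm_const_smul, eLpNorm_const_smul, Real.enorm_of_nonneg ha, Real.enorm_of_nonneg hb,
    ENNReal.ofReal_add (by positivity) (by positivity), ENNReal.ofReal_mul ha,
    ENNReal.ofReal_mul hb]
  gcongr

theorem eLpNorm_const_le {c : ℝ} (hc : 0 ≤ c) :
    eLpNorm (fun _ : Ω => c) 2 Pr ≤ ENNReal.ofReal c := by
  rw [eLpNorm_const c (by norm_num) (NeZero.ne Pr), measure_univ]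
  simp [Real.enorm_of_nonneg hc]

variable {η : ℝ} {est : ℕ → (ℕ → ℕ → S) → Vec dX × Vec dY → Vec dX × Vec dY}
  {x₀ : Vec dX} {y₀ : Vec dY} {s : SampleIdx → Ω → S} {T : ℕ}
  {f : ℕ → Vec dX → Vec dY → ℝ} {gx : ℕ → Vec dX → Vec dY → Vec dX}
  {gy : ℕ → Vec dX → Vec dY → Vec dY} {m L B κ : ℝ} {u : ℕ → Vec dX} {v : ℕ → Vec dY}

/-- The distance of the iterate `z_t` to the saddle point of the average of the first `t - 1`
or, for `r = t + 1`, of the first `t` functions. -/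
noncomputable def saddleDist (u : ℕ → Vec dX) (v : ℕ → Vec dY) (z : ℕ → Vec dX × Vec dY) (t r : ℕ) : ℝ :=
  ‖WithLp.toLp 2 (z t) - WithLp.toLp 2 (u r, v r)‖

/-- Bounds on the noise of the estimators: they are measurable, vanish in round `0`, and in the
later rounds their mean square error at a fixed point is at most
`κ η (1 + the distance to the starting point)`. -/
structure NoiseBound (Pr : Measure Ω) (est : ℕ → (ℕ → ℕ → S) → Vec dX × Vec dY → Vec dX × Vec dY)
    (s : SampleIdx → Ω → S) (T : ℕ) (gx : ℕ → Vec dX → Vec dY → Vec dX)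
    (gy : ℕ → Vec dX → Vec dY → Vec dY) (x₀ : Vec dX) (y₀ : Vec dY) (κ η : ℝ) : Prop where
  measurable_sample : ∀ a, Measurable (s a)
  indep : iIndepFun s Pr
  measurable_est : ∀ t ≤ T, Measurable
    (fun q : (ℕ → ℕ → S) × (Vec dX × Vec dY) => est t q.1 q.2)
  est_zero : ∀ w z, est 0 w z = 0
  noise : ∀ t, 1 ≤ t → t ≤ T → ∀ k z, eLpNorm (fun ω =>
    ‖signed (est t (fun i j => s (t, k, i, j) ω) z) - avgOp gx gy t (WithLp.toLp 2 z)‖) 2 Pr ≤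
      ENNReal.ofReal (κ * η * (1 + ‖WithLp.toLp 2 z - WithLp.toLp 2 (x₀, y₀)‖))

theorem NoiseBound.measurable_iter (hN : NoiseBound Pr est s T gx gy x₀ y₀ κ η) {t : ℕ}
    (ht : t ≤ T + 1) : Measurable (fun ω => sampleIter η est (x₀, y₀) s ω t) :=
  (measurable_sampleIter hN.measurable_est ht).mono (sampleAlg_le hN.measurable_sample _) le_rfl

theorem NoiseBound.measurable_half (hN : NoiseBound Pr est s T gx gy x₀ y₀ κ η) {t : ℕ}
    (ht : t ≤ T) : Measurable (fun ω => sampleHalf η est (x₀, y₀) s ω t) :=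
  (measurable_sampleHalf hN.measurable_est ht).mono (sampleAlg_le hN.measurable_sample _) le_rfl

theorem measurable_dist_toLp {z : Ω → Vec dX × Vec dY} (hz : Measurable z)
    (w : WithLp 2 (Vec dX × Vec dY)) : Measurable (fun ω => ‖WithLp.toLp 2 (z ω) - w‖) :=
  (((WithLp.measurable_toLp 2 (Vec dX × Vec dY)).comp hz).sub_const w).norm

theorem SaddlePath.measurable_avgOp (hpath : SaddlePath T f gx gy m L B x₀ y₀ u v) {t : ℕ}
    (ht : 1 ≤ t) (htT : t ≤ T) : Measurable (avgOp gx gy t) := by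
  refine (LipschitzWith.of_dist_le' (K := 4 * L) fun z w => ?_).continuous.measurable
  rw [dist_eq_norm, dist_eq_norm]
  exact (hpath.regular_average ht htT).saddleOp_lipschitz hpath.L_nonneg z w

/-- The noise bound is applied at a point independent of the samples. The distance to the start is
then replaced by the distance to the current saddle point, which differs from it by at most `2B /
m`. -/
theorem NoiseBound.noise_random (hN : NoiseBound Pr est s T gx gy x₀ y₀ κ η) (hη : 0 ≤ η)
    (hκ : 0 ≤ κ) (hpath : SaddlePath T f gx gy m L B x₀ y₀ u v) {t : ℕ} (ht : 1 ≤ t)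
    (htT : t ≤ T) {k : Fin 2} {Z : Ω → Vec dX × Vec dY} (hZ : Measurable Z)
    (hind : IndepFun Z (fun ω i j => s (t, k, i, j) ω) Pr) {a : ℝ} (ha : 0 ≤ a)
    (hZa : eLpNorm (fun ω => ‖WithLp.toLp 2 (Z ω) - WithLp.toLp 2 (u (t + 1), v (t + 1))‖) 2 Pr ≤
      ENNReal.ofReal a) :
    eLpNorm (fun ω => ‖signed (est t (fun i j => s (t, k, i, j) ω) (Z ω)) -
      avgOp gx gy t (WithLp.toLp 2 (Z ω))‖) 2 Pr ≤
      ENNReal.ofReal (κ * η * (1 + 2 * B / m) + κ * η * a) := by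
  have hm := hpath.m_pos
  have hB := hpath.B_nonneg
  have hW : Measurable (fun ω i j => s (t, k, i, j) ω) :=
    measurable_pi_iff.2 fun i => measurable_pi_iff.2 fun j => hN.measurable_sample _
  have hA := hpath.measurable_avgOp ht htT
  have hn : Measurable (fun q : (Vec dX × Vec dY) × (ℕ → ℕ → S) =>
      ‖signed (est t q.2 q.1) - avgOp gx gy t (WithLp.toLp 2 q.1)‖) := by
    have h1 : Measurable (fun q : (Vec dX × Vec dY) × (ℕ → ℕ → S) => signed (est t q.2 q.1)) :=
      measurable_signed.comp ((hN.measurable_est t htT).comp measurable_swap)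
    exact (h1.sub (hA.comp ((WithLp.measurable_toLp 2 (Vec dX × Vec dY)).comp
      measurable_fst))).norm
  refine (eLpNorm_indep_le (n := fun z w => ‖signed (est t w z) - avgOp gx gy t (WithLp.toLp 2 z)‖)
    (b := fun z => κ * η * (1 + ‖WithLp.toLp 2 z - WithLp.toLp 2 (x₀, y₀)‖))
    hZ hW hind hn (fun z => by positivity) (hN.noise t ht htT k)).trans ?_
  rw [← mul_one (κ * η * (1 + 2 * B / m))]
  refine eLpNorm_le_of_le_linear (h := fun ω =>
    ‖WithLp.toLp 2 (Z ω) - WithLp.toLp 2 (u (t + 1), v (t + 1))‖) (g := fun _ => 1)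
    (by positivity) (by positivity) aestronglyMeasurable_const
    (measurable_dist_toLp hZ _).aestronglyMeasurable (fun ω => by positivity) (fun ω => ?_)
    zero_le_one ha (eLpNorm_const_le zero_le_one) hZa
  have h1 := hpath.norm_start_sub_le ht htT
  have h2 := norm_sub_le_norm_sub_add_norm_sub (WithLp.toLp 2 (Z ω))
    (WithLp.toLp 2 (u (t + 1), v (t + 1))) (WithLp.toLp 2 (x₀, y₀))
  rw [norm_sub_rev (WithLp.toLp 2 (u (t + 1), v (t + 1)))] at h2
  have h3 : 0 ≤ κ * η := by positivity
  nlinarith [mul_le_mul_of_nonneg_left (h2.trans (add_le_add_right h1 _)) h3]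

/-- The constant of the quadratic terms in the mean square recursion. -/
noncomputable def recConst (m L B κ η₀ : ℝ) : ℝ :=
  (2 * (4 * L + m) ^ 2 + (4 * L + m) * κ * η₀ + κ * (1 + η₀ * (4 * L + m)) + κ ^ 2 * η₀ ^ 2) *
    (1 + 2 * B / m)

/-- One round of the method contracts the mean square distance to the saddle point. -/
theorem NoiseBound.step (hN : NoiseBound Pr est s T gx gy x₀ y₀ κ η) {η₀ : ℝ} (hη : 0 < η)
    (hηη₀ : η ≤ η₀) (hκ : 0 ≤ κ) (hpath : SaddlePath T f gx gy m L B x₀ y₀ u v) {t : ℕ}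
    (ht : 1 ≤ t) (htT : t ≤ T) {a : ℝ} (ha : 0 ≤ a)
    (hZa : eLpNorm (fun ω => saddleDist u v (sampleIter η est (x₀, y₀) s ω) t (t + 1)) 2 Pr ≤
      ENNReal.ofReal a) :
    eLpNorm (fun ω => saddleDist u v (sampleIter η est (x₀, y₀) s ω) (t + 1) (t + 1)) 2 Pr ≤
      ENNReal.ofReal ((1 - η * m + recConst m L B κ η₀ * η ^ 2) * a +
        recConst m L B κ η₀ * η ^ 2) := by
  have hm := hpath.m_pos
  have hB := hpath.B_nonneg
  have hL := hpath.L_nonneg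
  have hη₀ : 0 < η₀ := hη.trans_le hηη₀
  -- Adding `m` to the Lipschitz constant `4L` secures `m ≤ Λ`, as `extragradient_step` requires.
  set Λ := 4 * L + m with hΛ
  have hΛ0 : 0 < Λ := by positivity
  set D := 1 + 2 * B / m with hD
  have hD1 : 1 ≤ D := by
    have : 0 ≤ 2 * B / m := by positivity
    linarith
  set w := WithLp.toLp 2 (u (t + 1), v (t + 1)) with hw
  have hreg := hpath.regular_average ht htT
  have hstep := fun (z g₁ g₂ : WithLp 2 (Vec dX × Vec dY)) =>
    extragradient_step (A := avgOp gx gy t) (m := m) (L := Λ) hη.le hΛ0.le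
      (fun z w => (hreg.saddleOp_lipschitz hL z w).trans
        (mul_le_mul_of_nonneg_right (by linarith) (norm_nonneg _)))
      hreg.saddleOp_mono (hpath.avgOp_saddle ht htT) (by linarith) hm.le z g₁ g₂
  set e₁ : Ω → ℝ := fun ω => ‖signed (est t (fun i j => s (t, 0, i, j) ω)
    (sampleIter η est (x₀, y₀) s ω t)) -
    avgOp gx gy t (WithLp.toLp 2 (sampleIter η est (x₀, y₀) s ω t))‖ with he₁
  set e₂ : Ω → ℝ := fun ω => ‖signed (est t (fun i j => s (t, 1, i, j) ω)
    (sampleHalf η est (x₀, y₀) s ω t)) -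
    avgOp gx gy t (WithLp.toLp 2 (sampleHalf η est (x₀, y₀) s ω t))‖ with he₂
  have hZm := hN.measurable_iter (t := t) (by omega)
  have hHm := hN.measurable_half htT
  have hdm : Measurable (fun ω => saddleDist u v (sampleIter η est (x₀, y₀) s ω) t (t + 1)) :=
    measurable_dist_toLp hZm _
  have hAm := hpath.measurable_avgOp ht htT
  have hem : ∀ (k : Fin 2) {Z : Ω → Vec dX × Vec dY}, Measurable Z → Measurable (fun ω =>
      ‖signed (est t (fun i j => s (t, k, i, j) ω) (Z ω)) -
        avgOp gx gy t (WithLp.toLp 2 (Z ω))‖) := fun k Z hZ => by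
    have hW : Measurable (fun ω i j => s (t, k, i, j) ω) :=
      measurable_pi_iff.2 fun i => measurable_pi_iff.2 fun j => hN.measurable_sample _
    have h1 : Measurable (fun ω => signed (est t (fun i j => s (t, k, i, j) ω) (Z ω))) :=
      measurable_signed.comp ((hN.measurable_est t htT).comp (hW.prodMk hZ))
    exact (h1.sub (hAm.comp ((WithLp.measurable_toLp 2 (Vec dX × Vec dY)).comp hZ))).norm
  have he₁a := hN.noise_random hη.le hκ hpath ht htT hZm
    (indepFun_sampleIter hN.measurable_sample hN.indep hN.measurable_est htT) ha hZa
  have hhalf : ∀ ω, ‖WithLp.toLp 2 (sampleHalf η est (x₀, y₀) s ω t) - w‖ ≤ (1 + η * Λ) *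
      saddleDist u v (sampleIter η est (x₀, y₀) s ω) t (t + 1) + η * e₁ ω := fun ω => by
    rw [sampleHalf, toLp_gdaStep]
    exact (hstep _ _ 0).1
  have hHa := eLpNorm_le_of_le_linear (by positivity) hη.le hdm.aestronglyMeasurable
    (hem 0 hZm).aestronglyMeasurable (fun ω => norm_nonneg _) hhalf ha (by positivity) hZa he₁a
  have he₂a := hN.noise_random hη.le hκ hpath ht htT hHm
    (indepFun_sampleHalf hN.measurable_sample hN.indep hN.measurable_est htT)
    (by positivity) hHa
  have hc0 : 0 ≤ 1 - η * m + 2 * (η * Λ) ^ 2 := by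
    have h1 : η * m ≤ η * Λ := mul_le_mul_of_nonneg_left (by linarith) hη.le
    nlinarith [sq_nonneg (1 - η * Λ), sq_nonneg (η * Λ)]
  have hfull : ∀ ω, saddleDist u v (sampleIter η est (x₀, y₀) s ω) (t + 1) (t + 1) ≤
      1 * ((1 - η * m + 2 * (η * Λ) ^ 2) *
        saddleDist u v (sampleIter η est (x₀, y₀) s ω) t (t + 1) + η ^ 2 * Λ * e₁ ω) +
      η * e₂ ω := fun ω => by
    rw [one_mul, saddleDist, sampleIter_succ]
    have h2 := (hstep (WithLp.toLp 2 (sampleIter η est (x₀, y₀) s ω t))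
      (signed (est t (fun i j => s (t, 0, i, j) ω) (sampleIter η est (x₀, y₀) s ω t)))
      (signed (est t (fun i j => s (t, 1, i, j) ω) (sampleHalf η est (x₀, y₀) s ω t)))).2
    rw [← toLp_gdaStep, ← toLp_gdaStep] at h2
    exact h2
  have hmid := eLpNorm_le_of_le_linear (f := fun ω => (1 - η * m + 2 * (η * Λ) ^ 2) *
        saddleDist u v (sampleIter η est (x₀, y₀) s ω) t (t + 1) + η ^ 2 * Λ * e₁ ω)
    hc0 (by positivity : 0 ≤ η ^ 2 * Λ) hdm.aestronglyMeasurable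
    (hem 0 hZm).aestronglyMeasurable
    (fun ω => add_nonneg (mul_nonneg hc0 (norm_nonneg _))
      (mul_nonneg (by positivity) (norm_nonneg _)))
    (fun ω => le_rfl) ha (by positivity) hZa he₁a
  have hfin := eLpNorm_le_of_le_linear zero_le_one hη.le
    ((hdm.const_mul _).add ((hem 0 hZm).const_mul _)).aestronglyMeasurable
    (hem 1 hHm).aestronglyMeasurable (fun ω => norm_nonneg _) hfull
    (add_nonneg (mul_nonneg hc0 ha) (by positivity)) (by positivity) hmid he₂a
  refine hfin.trans (ENNReal.ofReal_le_ofReal ?_)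
  have hC : recConst m L B κ η₀ = (2 * Λ ^ 2 + Λ * κ * η₀ + κ * (1 + η₀ * Λ) + κ ^ 2 * η₀ ^ 2) * D :=
    rfl
  rw [hC]
  have k1 : η * (Λ * κ) ≤ η₀ * (Λ * κ) := mul_le_mul_of_nonneg_right hηη₀ (by positivity)
  have k2 : η ^ 2 * κ ^ 2 ≤ η₀ ^ 2 * κ ^ 2 :=
    mul_le_mul_of_nonneg_right (pow_le_pow_left₀ hη.le hηη₀ 2) (by positivity)
  have hb : 2 * Λ ^ 2 + η * (Λ * κ) + κ + η * (Λ * κ) + η ^ 2 * κ ^ 2 ≤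
      2 * Λ ^ 2 + Λ * κ * η₀ + κ * (1 + η₀ * Λ) + κ ^ 2 * η₀ ^ 2 := by linarith
  have hb0 : 0 ≤ 2 * Λ ^ 2 + Λ * κ * η₀ + κ * (1 + η₀ * Λ) + κ ^ 2 * η₀ ^ 2 := by positivity
  -- Substituting the bounds for both errors, every contribution beyond `(1 - ηm) a` carries a
  -- factor `η²`. `q1` bounds the remaining coefficient of `a`, and `q2` that of the constant term;
  -- surplus powers of `η` are replaced by `η₀`.
  have q1 : 2 * Λ ^ 2 + η * (Λ * κ) + κ + η * (Λ * κ) + η ^ 2 * κ ^ 2 ≤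
      (2 * Λ ^ 2 + Λ * κ * η₀ + κ * (1 + η₀ * Λ) + κ ^ 2 * η₀ ^ 2) * D :=
    hb.trans (le_mul_of_one_le_right hb0 hD1)
  have q2 : η * (Λ * κ) * D + κ * D + η ^ 2 * κ ^ 2 * D ≤
      (2 * Λ ^ 2 + Λ * κ * η₀ + κ * (1 + η₀ * Λ) + κ ^ 2 * η₀ ^ 2) * D := by
    rw [← add_mul, ← add_mul]
    refine mul_le_mul_of_nonneg_right ?_ (by linarith)
    have : 0 ≤ 2 * Λ ^ 2 + κ * (η₀ * Λ) := by positivity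
    linarith
  have r1 := mul_le_mul_of_nonneg_left q1 (by positivity : 0 ≤ η ^ 2 * a)
  have r2 := mul_le_mul_of_nonneg_left q2 (by positivity : 0 ≤ η ^ 2)
  linarith

end Tracking

/-! ### The scalar recursion -/

section Recursion

/-- The sequence `α_{n+1} = q α_n + r + c / (n + 2)`. -/
noncomputable def trackSeq (A q r c : ℝ) : ℕ → ℝ
  | 0 => A
  | n + 1 => q * trackSeq A q r c n + r + c / ((n : ℝ) + 2)

variable {A q r c : ℝ}

theorem trackSeq_nonneg (hA : 0 ≤ A) (hq : 0 ≤ q) (hr : 0 ≤ r) (hc : 0 ≤ c) (n : ℕ) :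
    0 ≤ trackSeq A q r c n := by
  induction n with
  | zero => exact hA
  | succ n ih =>
    rw [trackSeq]
    positivity

/-- Summing `ρ a_n ≤ a_n - a_{n+1} + δ_n` telescopes. -/
theorem mul_sum_le_of_contraction {a δ : ℕ → ℝ} {ρ : ℝ} (h : ∀ n, a (n + 1) ≤ (1 - ρ) * a n + δ n)
    (ha : ∀ n, 0 ≤ a n) (N : ℕ) :
    ρ * ∑ n ∈ Finset.range N, a n ≤ a 0 + ∑ n ∈ Finset.range N, δ n := by
  have h1 : ρ * ∑ n ∈ Finset.range N, a n + a N ≤ a 0 + ∑ n ∈ Finset.range N, δ n := by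
    induction N with
    | zero => simp
    | succ N ih =>
      rw [Finset.sum_range_succ, Finset.sum_range_succ]
      linarith [h N]
  linarith [ha N]

/-- Convexity of the square, applied to `(1 - ρ) a + ρ (δ / ρ)`: squaring keeps the contraction
rate. -/
theorem sq_le_of_contraction {a b δ ρ : ℝ} (hb : 0 ≤ b) (hρ : 0 < ρ) (hρ1 : ρ ≤ 1)
    (h : b ≤ (1 - ρ) * a + δ) : b ^ 2 ≤ (1 - ρ) * a ^ 2 + δ ^ 2 / ρ := by
  have h1 := pow_le_pow_left₀ hb h 2
  have h2 : (1 - ρ) * a ^ 2 + δ ^ 2 / ρ - ((1 - ρ) * a + δ) ^ 2 =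
      (1 - ρ) * (ρ * a - δ) ^ 2 / ρ := by
    field_simp
    ring
  have h3 : 0 ≤ (1 - ρ) * (ρ * a - δ) ^ 2 / ρ := by
    have := sub_nonneg.2 hρ1
    positivity
  linarith

/-- Each term is at most `1 / (n + 1) - 1 / (n + 2)`. -/
theorem sum_one_div_add_two_sq_le (N : ℕ) :
    ∑ n ∈ Finset.range N, (1 : ℝ) / ((n : ℝ) + 2) ^ 2 ≤ 1 - 1 / ((N : ℝ) + 1) := by
  induction N with
  | zero => simp
  | succ N ih =>
    rw [Finset.sum_range_succ]
    have h : (1 : ℝ) / ((N : ℝ) + 2) ^ 2 ≤ 1 / ((N : ℝ) + 1) - 1 / ((N : ℝ) + 2) := by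
      rw [div_sub_div _ _ (by positivity) (by positivity), div_le_div_iff₀ (by positivity)
        (by positivity)]
      have := Nat.cast_nonneg (α := ℝ) N
      nlinarith
    push_cast
    have e : (N : ℝ) + 1 + 1 = N + 2 := by ring
    rw [e]
    linarith

theorem sum_one_div_add_two_le (N : ℕ) :
    ∑ n ∈ Finset.range N, (1 : ℝ) / ((n : ℝ) + 2) ≤ 2 * √N := by
  refine le_trans ?_ (sum_one_div_le_sqrt N)
  have e : ∑ t ∈ Finset.Icc 1 N, (1 : ℝ) / t = ∑ n ∈ Finset.range N, (1 : ℝ) / ((n : ℝ) + 1) := by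
    rw [Finset.sum_bij (fun n (_ : n ∈ Finset.range N) => n + 1) (t := Finset.Icc 1 N)
      (g := fun t : ℕ => (1 : ℝ) / t)]
    · intro n hn
      simp only [Finset.mem_range, Finset.mem_Icc] at hn ⊢
      omega
    · intro a _ b _ h
      omega
    · intro b hb
      simp only [Finset.mem_Icc] at hb
      exact ⟨b - 1, by simp only [Finset.mem_range]; omega, by omega⟩
    · intro n _
      push_cast
      rfl
  rw [e]
  refine Finset.sum_le_sum fun n _ => one_div_le_one_div_of_le (by positivity) (by linarith)

theorem le_half_mul_of_two_div_mul_le {τ x y : ℝ} (hτ : 0 < τ) (h : 2 / τ * x ≤ y) :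
    x ≤ τ / 2 * y := by
  have h1 := mul_le_mul_of_nonneg_left h (by positivity : 0 ≤ τ / 2)
  have h2 : τ / 2 * (2 / τ * x) = x := by field_simp
  linarith

/-- Summation of a contracting recursion with rate `2 / τ`, where `τ ^ 4` is the horizon. -/
theorem sum_le_of_contraction {α : ℕ → ℝ} {T : ℕ} {τ A G c : ℝ} (hτ : 1 ≤ τ) (hT : τ ^ 4 = T)
    (hα : ∀ n, 0 ≤ α n) (hα0 : α 0 = A) (hA : 0 ≤ A) (hc : 0 ≤ c)
    (hrec : ∀ n, α (n + 1) ≤ (1 - 2 / τ) * α n + (G / τ ^ 2 + c / ((n : ℝ) + 2))) :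
    ∑ n ∈ Finset.range T, α n ≤ (A + G + 2 * c) / 2 * τ ^ 3 := by
  have hτ0 : 0 < τ := by linarith
  have hsqrt : √(T : ℝ) = τ ^ 2 := by
    rw [← hT, show τ ^ 4 = (τ ^ 2) ^ 2 by ring]
    exact Real.sqrt_sq (by positivity)
  refine (le_half_mul_of_two_div_mul_le hτ0 (mul_sum_le_of_contraction hrec hα T)).trans ?_
  have h1 : ∑ n ∈ Finset.range T, (G / τ ^ 2 + c / ((n : ℝ) + 2)) ≤
      G * τ ^ 2 + c * (2 * τ ^ 2) := by
    rw [Finset.sum_add_distrib]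
    refine add_le_add (le_of_eq ?_) ?_
    · rw [Finset.sum_const, Finset.card_range, nsmul_eq_mul, ← hT]
      field_simp
    · have h3 := sum_one_div_add_two_le T
      rw [hsqrt] at h3
      have h4 := mul_le_mul_of_nonneg_left h3 hc
      rw [Finset.mul_sum] at h4
      simpa only [mul_one_div] using h4
  have h2 : α 0 ≤ A * τ ^ 2 := by
    rw [hα0]
    exact le_mul_of_one_le_right hA (one_le_pow₀ hτ)
  refine (mul_le_mul_of_nonneg_left (add_le_add h2 h1) (by positivity : 0 ≤ τ / 2)).trans
    (le_of_eq ?_)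
  ring

/-- Summation of the squares of a contracting recursion with rate `2 / τ`. -/
theorem sum_sq_le_of_contraction {α : ℕ → ℝ} {T : ℕ} {τ A G c : ℝ} (hτ : 2 ≤ τ) (hT : τ ^ 4 = T)
    (hα : ∀ n, 0 ≤ α n) (hα0 : α 0 = A)
    (hrec : ∀ n, α (n + 1) ≤ (1 - 2 / τ) * α n + (G / τ ^ 2 + c / ((n : ℝ) + 2))) :
    ∑ n ∈ Finset.range T, α n ^ 2 ≤ (A ^ 2 + (G ^ 2 + c ^ 2)) / 2 * τ ^ 3 := by
  have hτ0 : 0 < τ := by linarith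
  have hτ1 : 1 ≤ τ := by linarith
  have hρ0 : 0 < 2 / τ := by positivity
  have hρ1 : 2 / τ ≤ 1 := by rwa [div_le_one hτ0]
  have hrec2 : ∀ n, α (n + 1) ^ 2 ≤ (1 - 2 / τ) * α n ^ 2 +
      (G / τ ^ 2 + c / ((n : ℝ) + 2)) ^ 2 / (2 / τ) := fun n =>
    sq_le_of_contraction (hα _) hρ0 hρ1 (hrec n)
  refine (le_half_mul_of_two_div_mul_le hτ0 (mul_sum_le_of_contraction (a := fun n => α n ^ 2)
    hrec2 (fun n => sq_nonneg _) T)).trans ?_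
  have h3 : ∀ n : ℕ, (G / τ ^ 2 + c / ((n : ℝ) + 2)) ^ 2 / (2 / τ) ≤
      τ * ((G / τ ^ 2) ^ 2 + c ^ 2 * (1 / ((n : ℝ) + 2) ^ 2)) := fun n => by
    have e : ∀ x : ℝ, x / (2 / τ) = τ / 2 * x := fun x => by field_simp
    have e2 : c ^ 2 * (1 / ((n : ℝ) + 2) ^ 2) = (c / ((n : ℝ) + 2)) ^ 2 := by
      rw [div_pow]
      ring
    rw [e, e2]
    nlinarith [mul_nonneg hτ0.le (sq_nonneg (G / τ ^ 2 - c / ((n : ℝ) + 2)))]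
  have h2 : ∑ n ∈ Finset.range T, (G / τ ^ 2 + c / ((n : ℝ) + 2)) ^ 2 / (2 / τ) ≤
      τ * (G ^ 2 + c ^ 2) := by
    refine (Finset.sum_le_sum fun n _ => h3 n).trans ?_
    rw [← Finset.mul_sum, Finset.sum_add_distrib, ← Finset.mul_sum]
    refine mul_le_mul_of_nonneg_left (add_le_add (le_of_eq ?_) ?_) (by positivity)
    · rw [Finset.sum_const, Finset.card_range, nsmul_eq_mul, ← hT]
      field_simp
    · refine mul_le_of_le_one_right (by positivity) ((sum_one_div_add_two_sq_le T).trans ?_)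
      have : 0 ≤ 1 / ((T : ℝ) + 1) := by positivity
      linarith
  have h4 : τ * (G ^ 2 + c ^ 2) ≤ τ ^ 2 * (G ^ 2 + c ^ 2) :=
    mul_le_mul_of_nonneg_right (by nlinarith) (by positivity)
  have h5 : α 0 ^ 2 ≤ τ ^ 2 * A ^ 2 := by
    rw [hα0]
    exact le_mul_of_one_le_left (by positivity) (one_le_pow₀ hτ1)
  refine (mul_le_mul_of_nonneg_left (add_le_add h5 (h2.trans h4))
    (by positivity : 0 ≤ τ / 2)).trans (le_of_eq ?_)
  ring

/-- Geometric growth of `trackSeq`. -/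
theorem trackSeq_add_one_le {Q : ℝ} (hA : 0 ≤ A) (hq : 0 ≤ q) (hr : 0 ≤ r) (hc : 0 ≤ c)
    (hqQ : q ≤ Q) (hrQ : r ≤ Q) (n : ℕ) :
    trackSeq A q r c n + 1 ≤ (A + 1) * (2 * Q + c + 1) ^ n := by
  have hQ : 0 ≤ Q := hq.trans hqQ
  induction n with
  | zero => simp [trackSeq]
  | succ n ih =>
    have h0 := trackSeq_nonneg hA hq hr hc n
    have h1 : c / ((n : ℝ) + 2) ≤ c :=
      div_le_self hc (by linarith [Nat.cast_nonneg (α := ℝ) n])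
    have h2 := mul_le_mul_of_nonneg_right hqQ h0
    -- Adding `1` absorbs the inhomogeneous terms, so the affine recursion becomes a multiplicative
    -- one.
    rw [trackSeq, pow_succ]
    set a := trackSeq A q r c n
    have h3 : 0 ≤ (Q + c + 1) * a := by positivity
    have h4 := mul_le_mul_of_nonneg_right ih (by positivity : 0 ≤ 2 * Q + c + 1)
    linarith

/-- The tracking errors sum up to `O(T^{3/4})` for the step size `4 T^{-1/4} / m`. -/
theorem exists_sum_trackSeq_le {m C₁ : ℝ} (hm : 0 < m) (hC : m ^ 2 ≤ C₁) (hA : 0 ≤ A)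
    (hc : 0 ≤ c) : ∃ K : ℝ, 0 ≤ K ∧ ∀ T : ℕ, 1 ≤ T →
      (∑ n ∈ Finset.range T, trackSeq A
        (1 - stepSize m T * m + C₁ * stepSize m T ^ 2) (C₁ * stepSize m T ^ 2) c n ≤
          K * (T : ℝ) ^ (3 / 4 : ℝ)) ∧
      (∑ n ∈ Finset.range T, trackSeq A
        (1 - stepSize m T * m + C₁ * stepSize m T ^ 2) (C₁ * stepSize m T ^ 2) c n ^ 2 ≤
          K * (T : ℝ) ^ (3 / 4 : ℝ)) := by
  have hC0 : 0 ≤ C₁ := (sq_nonneg m).trans hC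
  obtain ⟨G, hG⟩ : ∃ G, G = 16 * C₁ / m ^ 2 := ⟨_, rfl⟩
  have hG0 : 0 ≤ G := by
    rw [hG]
    positivity
  -- The threshold horizon: above it `τ = T^{1/4}` is at least `G / 2` and `2`, so the recursion
  -- contracts. The finitely many smaller horizons are absorbed into the constant.
  obtain ⟨N₀, hN₀⟩ : ∃ N, N = ⌈(max (G / 2) 2) ^ 4⌉₊ := ⟨_, rfl⟩
  obtain ⟨M, hM⟩ : ∃ M, M = (A + 1) * (2 * (1 + G) + c + 1) ^ N₀ := ⟨_, rfl⟩
  have hM0 : 0 ≤ M := by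
    rw [hM]
    positivity
  obtain ⟨K₁, hK₁⟩ : ∃ K, K = (A + G + 2 * c) / 2 := ⟨_, rfl⟩
  obtain ⟨K₂, hK₂⟩ : ∃ K, K = (A ^ 2 + (G ^ 2 + c ^ 2)) / 2 := ⟨_, rfl⟩
  have hK₁0 : 0 ≤ K₁ := by
    rw [hK₁]
    positivity
  have hK₂0 : 0 ≤ K₂ := by
    rw [hK₂]
    positivity
  have hNM : 0 ≤ N₀ * M := by positivity
  have hNM2 : 0 ≤ N₀ * M ^ 2 := by positivity
  refine ⟨K₁ + K₂ + N₀ * M + N₀ * M ^ 2, by positivity, fun T hT => ?_⟩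
  have hT0 : (0 : ℝ) < T := by exact_mod_cast hT
  have hT1 : (1 : ℝ) ≤ T := by exact_mod_cast hT
  obtain ⟨τ, hτ⟩ : ∃ τ, τ = (T : ℝ) ^ (1 / 4 : ℝ) := ⟨_, rfl⟩
  have hτ1 : 1 ≤ τ := hτ ▸ Real.one_le_rpow hT1 (by norm_num)
  have hτ0 : 0 < τ := by linarith
  have hτ4 : τ ^ 4 = T := by
    rw [hτ, ← Real.rpow_natCast, ← Real.rpow_mul hT0.le]
    norm_num
  have hτ3 : (T : ℝ) ^ (3 / 4 : ℝ) = τ ^ 3 := by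
    rw [hτ, ← Real.rpow_natCast, ← Real.rpow_mul hT0.le]
    norm_num
  have hη : stepSize m T = 4 / (m * τ) := by
    rw [stepSize, Real.rpow_neg hT0.le, ← hτ]
    field_simp
  rw [hτ3, hη]
  obtain ⟨η, hηdef⟩ : ∃ η, η = 4 / (m * τ) := ⟨_, rfl⟩
  rw [← hηdef]
  have hη0 : 0 < η := by
    rw [hηdef]
    positivity
  have hηm : η * m = 4 / τ := by
    rw [hηdef]
    field_simp
  have hη2 : C₁ * η ^ 2 = G / τ ^ 2 := by
    rw [hηdef, hG]
    field_simp
    ring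
  -- This is where `m² ≤ C₁` enters: the factor is at least `1 - ηm + (ηm)²`, which is positive.
  have hq0 : 0 ≤ 1 - η * m + C₁ * η ^ 2 := by
    have := mul_le_mul_of_nonneg_right hC (sq_nonneg η)
    nlinarith [sq_nonneg (η * m - 1), sq_nonneg (η * m)]
  have hr0 : 0 ≤ C₁ * η ^ 2 := by positivity
  obtain ⟨α, hα⟩ : ∃ α, α = trackSeq A (1 - η * m + C₁ * η ^ 2) (C₁ * η ^ 2) c := ⟨_, rfl⟩
  rw [← hα]
  have hα0 : ∀ n, 0 ≤ α n := hα ▸ trackSeq_nonneg hA hq0 hr0 hc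
  have hαA : α 0 = A := hα ▸ rfl
  have hτ13 : 1 ≤ τ ^ 3 := one_le_pow₀ hτ1
  rcases le_or_gt (max (G / 2) 2) τ with hbig | hsmall
  · have hτ2 : 2 ≤ τ := (le_max_right _ _).trans hbig
    -- Here `ηm = 4/τ`, and half of it pays for the second-order term `G / τ² ≤ 2 / τ`.
    have hqρ : 1 - η * m + C₁ * η ^ 2 ≤ 1 - 2 / τ := by
      have h1 : G / 2 ≤ τ := (le_max_left _ _).trans hbig
      have h2 : G / τ ^ 2 ≤ 2 / τ := by
        rw [div_le_div_iff₀ (by positivity) hτ0]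
        nlinarith
      rw [hη2, hηm]
      have : 4 / τ = 2 / τ + 2 / τ := by ring
      linarith
    have hrec : ∀ n, α (n + 1) ≤ (1 - 2 / τ) * α n + (G / τ ^ 2 + c / ((n : ℝ) + 2)) := fun n => by
      have h1 := mul_le_mul_of_nonneg_right hqρ (hα0 n)
      have h2 : α (n + 1) = (1 - η * m + C₁ * η ^ 2) * α n + C₁ * η ^ 2 + c / ((n : ℝ) + 2) := by
        rw [hα, trackSeq]
      rw [h2, ← hη2]
      linarith
    constructor
    · refine (sum_le_of_contraction hτ1 hτ4 hα0 hαA hA hc hrec).trans ?_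
      rw [← hK₁]
      exact mul_le_mul_of_nonneg_right (by linarith) (by positivity)
    · refine (sum_sq_le_of_contraction hτ2 hτ4 hα0 hαA hrec).trans ?_
      rw [← hK₂]
      exact mul_le_mul_of_nonneg_right (by linarith) (by positivity)
  -- Small horizons: no contraction is available, but geometric growth over at most `N₀` steps is
  -- bounded by a constant.
  · have hTN : T ≤ N₀ := by
      have h1 : (T : ℝ) ≤ N₀ := by
        rw [← hτ4, hN₀]
        exact (pow_le_pow_left₀ hτ0.le hsmall.le 4).trans (Nat.le_ceil _)
      exact_mod_cast h1
    have hrG : C₁ * η ^ 2 ≤ G := by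
      rw [hη2]
      exact div_le_self hG0 (one_le_pow₀ hτ1)
    have hαM : ∀ n ∈ Finset.range T, α n ≤ M := fun n hn => by
      have h0 := trackSeq_add_one_le (Q := 1 + G) hA hq0 hr0 hc (by linarith [mul_pos hη0 hm])
        (by linarith) n
      have h1 : (2 * (1 + G) + c + 1) ^ n ≤ (2 * (1 + G) + c + 1) ^ N₀ :=
        pow_le_pow_right₀ (by linarith) ((Finset.mem_range.1 hn).le.trans hTN)
      have h2 := mul_le_mul_of_nonneg_left h1 (by linarith : 0 ≤ A + 1)
      rw [← hM] at h2
      rw [← hα] at h0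
      linarith
    have hTN' : (T : ℝ) ≤ N₀ := by exact_mod_cast hTN
    have h3 : K₁ + K₂ + N₀ * M + N₀ * M ^ 2 ≤ (K₁ + K₂ + N₀ * M + N₀ * M ^ 2) * τ ^ 3 :=
      le_mul_of_one_le_right (by positivity) hτ13
    constructor
    · refine (Finset.sum_le_card_nsmul _ _ _ hαM).trans ?_
      rw [Finset.card_range, nsmul_eq_mul]
      have h1 : (T : ℝ) * M ≤ N₀ * M := mul_le_mul_of_nonneg_right hTN' hM0
      linarith
    · refine (Finset.sum_le_card_nsmul _ _ _
        fun n hn => pow_le_pow_left₀ (hα0 n) (hαM n hn) 2).trans ?_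
      rw [Finset.card_range, nsmul_eq_mul]
      have h1 : (T : ℝ) * M ^ 2 ≤ N₀ * M ^ 2 := mul_le_mul_of_nonneg_right hTN' (by positivity)
      linarith

end Recursion

/-! ### The regret of the method -/

section Regret

variable {dX dY : ℕ} {Ω S : Type*} [MeasurableSpace Ω] [MeasurableSpace S] {Pr : Measure Ω}
  [IsProbabilityMeasure Pr] {η : ℝ}
  {est : ℕ → (ℕ → ℕ → S) → Vec dX × Vec dY → Vec dX × Vec dY}
  {x₀ : Vec dX} {y₀ : Vec dY} {s : SampleIdx → Ω → S} {T : ℕ}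
  {f : ℕ → Vec dX → Vec dY → ℝ} {gx : ℕ → Vec dX → Vec dY → Vec dX}
  {gy : ℕ → Vec dX → Vec dY → Vec dY} {m L B κ : ℝ} {u : ℕ → Vec dX} {v : ℕ → Vec dY}

/-- Converts an `L²` bound into bounds for the first and second moments, the two quantities
occurring in the regret. -/
theorem integral_le_of_eLpNorm_two_le {g : Ω → ℝ} {a : ℝ} (hg : Measurable g)
    (hg0 : ∀ ω, 0 ≤ g ω) (ha : 0 ≤ a) (h : eLpNorm g 2 Pr ≤ ENNReal.ofReal a) :
    (Integrable g Pr ∧ ∫ ω, g ω ∂Pr ≤ a) ∧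
      Integrable (fun ω => g ω ^ 2) Pr ∧ ∫ ω, g ω ^ 2 ∂Pr ≤ a ^ 2 := by
  have hL : MemLp g 2 Pr := ⟨hg.aestronglyMeasurable, h.trans_lt ENNReal.ofReal_lt_top⟩
  refine ⟨⟨hL.integrable (by norm_num), ?_⟩, hL.integrable_sq, ?_⟩
  · have h1 : eLpNorm g 1 Pr ≤ ENNReal.ofReal a :=
      (eLpNorm_le_eLpNorm_of_exponent_le (by norm_num) hg.aestronglyMeasurable).trans h
    rw [eLpNorm_one_eq_lintegral_enorm,
      ← ofReal_integral_norm_eq_lintegral_enorm (hL.integrable (by norm_num)),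
      ENNReal.ofReal_le_ofReal_iff ha] at h1
    simpa only [Real.norm_of_nonneg (hg0 _)] using h1
  · rw [hL.eLpNorm_eq_integral_rpow_norm (by simp) (by simp), ENNReal.ofReal_le_ofReal_iff ha] at h
    simp only [ENNReal.toReal_ofNat, Real.rpow_ofNat, Real.norm_eq_abs, sq_abs] at h
    rw [← one_div, ← Real.sqrt_eq_rpow] at h
    exact (Real.sqrt_le_left ha).1 h

/-- The mean square distances to the running saddle points follow the scalar recursion. -/
theorem NoiseBound.tracking (hN : NoiseBound Pr est s T gx gy x₀ y₀ κ η) {η₀ : ℝ} (hη : 0 < η)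
    (hηη₀ : η ≤ η₀) (hκ : 0 ≤ κ) (hpath : SaddlePath T f gx gy m L B x₀ y₀ u v)
    (hC : m ^ 2 ≤ recConst m L B κ η₀) {n : ℕ} (hn : n + 1 ≤ T) :
    eLpNorm (fun ω => saddleDist u v (sampleIter η est (x₀, y₀) s ω) (n + 1) (n + 2)) 2 Pr ≤
      ENNReal.ofReal (trackSeq (2 * B / m) (1 - η * m + recConst m L B κ η₀ * η ^ 2)
        (recConst m L B κ η₀ * η ^ 2) ((2 * B + 4 * L * (2 * B / m)) / m) n) := by
  have hm := hpath.m_pos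
  have hB := hpath.B_nonneg
  have hL := hpath.L_nonneg
  have hC0 : 0 ≤ recConst m L B κ η₀ := (sq_nonneg m).trans hC
  have hq0 : 0 ≤ 1 - η * m + recConst m L B κ η₀ * η ^ 2 := by
    have := mul_le_mul_of_nonneg_right hC (sq_nonneg η)
    nlinarith [sq_nonneg (η * m - 1), sq_nonneg (η * m)]
  induction n with
  | zero =>
    -- In round `0` the estimate is zero, so `z_1` is still the start, at distance at most `2B / m`
    -- from the saddle point of `J_1`. The recursion begins here, with index `n` standing for round
    -- `n + 1`.
    have h1 : ∀ ω, sampleIter η est (x₀, y₀) s ω 1 = (x₀, y₀) := fun ω => by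
      change sampleIter η est (x₀, y₀) s ω (0 + 1) = _
      rw [sampleIter_succ, hN.est_zero]
      change (x₀ - η • (0 : Vec dX), y₀ + η • (0 : Vec dY)) = _
      simp
    simp only [saddleDist, zero_add, h1]
    refine (eLpNorm_const_le (norm_nonneg _)).trans (ENNReal.ofReal_le_ofReal ?_)
    exact hpath.norm_start_sub_le le_rfl hn
  | succ n ih =>
    have hα0 : 0 ≤ trackSeq (2 * B / m) (1 - η * m + recConst m L B κ η₀ * η ^ 2)
        (recConst m L B κ η₀ * η ^ 2) ((2 * B + 4 * L * (2 * B / m)) / m) n :=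
      trackSeq_nonneg (by positivity) hq0 (by positivity) (by positivity) n
    have h1 := hN.step hη hηη₀ hκ hpath (t := n + 1) (by omega) (by omega) hα0 (ih (by omega))
    have hd : Measurable (fun ω =>
        saddleDist u v (sampleIter η est (x₀, y₀) s ω) (n + 2) (n + 2)) :=
      measurable_dist_toLp (hN.measurable_iter (by omega)) _
    -- After the contraction towards the saddle point of `J_{n+1}`, the target moves to that of
    -- `J_{n+2}`; this produces the term `c / (n + 2)`.
    have h2 := hpath.drift_le (t := n + 1) (by omega) hn
    have h3 := eLpNorm_le_of_le_linear (Pr := Pr)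
      (f := fun ω => saddleDist u v (sampleIter η est (x₀, y₀) s ω) (n + 2) (n + 3))
      (h := fun _ => 1) zero_le_one ((norm_nonneg _).trans h2) hd.aestronglyMeasurable
      aestronglyMeasurable_const (fun ω => norm_nonneg _) (fun ω => by
        rw [one_mul, mul_one]
        exact (norm_sub_le_norm_sub_add_norm_sub _
          (WithLp.toLp 2 (u (n + 2), v (n + 2))) _).trans (add_le_add_right h2 _))
      (by positivity) zero_le_one h1 (eLpNorm_const_le zero_le_one)
    refine h3.trans (ENNReal.ofReal_le_ofReal (le_of_eq ?_))
    rw [trackSeq, one_mul, mul_one, mul_one_div]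
    push_cast
    congr 2
    ring

/-- The regret is controlled by the sums of the tracking errors. -/
theorem NoiseBound.regretLE {Ξ : Type*} [MeasurableSpace Ξ] {P : Measure Ξ}
    {F : ℕ → Vec dX → Vec dY → Ξ → ℝ} (hN : NoiseBound Pr est s T gx gy x₀ y₀ κ η) {η₀ : ℝ}
    (hη : 0 < η) (hηη₀ : η ≤ η₀) (hκ : 0 ≤ κ)
    (hpath : SaddlePath T (meanF P F) gx gy m L B x₀ y₀ u v)
    (hF : ∀ i, 1 ≤ i → i ≤ T → Measurable (fun z : Vec dX × Vec dY => meanF P F i z.1 z.2))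
    (hC : m ^ 2 ≤ recConst m L B κ η₀) (hT : 1 ≤ T) {K : ℝ}
    (hK₁ : ∑ n ∈ Finset.range T, trackSeq (2 * B / m) (1 - η * m + recConst m L B κ η₀ * η ^ 2)
      (recConst m L B κ η₀ * η ^ 2) ((2 * B + 4 * L * (2 * B / m)) / m) n ≤
      K * (T : ℝ) ^ (3 / 4 : ℝ))
    (hK₂ : ∑ n ∈ Finset.range T, trackSeq (2 * B / m) (1 - η * m + recConst m L B κ η₀ * η ^ 2)
      (recConst m L B κ η₀ * η ^ 2) ((2 * B + 4 * L * (2 * B / m)) / m) n ^ 2 ≤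
      K * (T : ℝ) ^ (3 / 4 : ℝ)) :
    RegretLE Pr P F T (sampleIter η est (x₀, y₀) s) (u (T + 1)) (v (T + 1))
      (((2 * (2 * B + 4 * L * (2 * B / m)) + 2 * L) * K +
        4 * L * ((2 * B + 4 * L * (2 * B / m)) / m) ^ 2) * (T : ℝ) ^ (3 / 4 : ℝ)) := by
  have hm := hpath.m_pos
  have hB := hpath.B_nonneg
  have hL := hpath.L_nonneg
  have hT1 : (1 : ℝ) ≤ T := by exact_mod_cast hT
  have hC0 : 0 ≤ recConst m L B κ η₀ := (sq_nonneg m).trans hC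
  have hq0 : 0 ≤ 1 - η * m + recConst m L B κ η₀ * η ^ 2 := by
    have := mul_le_mul_of_nonneg_right hC (sq_nonneg η)
    nlinarith [sq_nonneg (η * m - 1), sq_nonneg (η * m)]
  set G := 2 * B + 4 * L * (2 * B / m) with hG
  have hG0 : 0 ≤ G := by positivity
  set α := trackSeq (2 * B / m) (1 - η * m + recConst m L B κ η₀ * η ^ 2)
    (recConst m L B κ η₀ * η ^ 2) (G / m) with hα
  have hα0 : ∀ n, 0 ≤ α n :=
    trackSeq_nonneg (by positivity) hq0 (by positivity) (by positivity)
  set D : ℕ → Ω → ℝ := fun n ω =>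
    saddleDist u v (sampleIter η est (x₀, y₀) s ω) (n + 1) (n + 2) with hD
  have hDm : ∀ n ∈ Finset.range T, Measurable (D n) := fun n hn =>
    measurable_dist_toLp (hN.measurable_iter (by have := Finset.mem_range.1 hn; omega)) _
  have hDi : ∀ n ∈ Finset.range T, _ := fun n hn =>
    integral_le_of_eLpNorm_two_le (Pr := Pr) (hDm n hn) (fun ω => norm_nonneg _) (hα0 n)
      (hN.tracking hη hηη₀ hκ hpath hC (by have := Finset.mem_range.1 hn; omega))
  have hpt : ∀ ω, regretVar P F T (sampleIter η est (x₀, y₀) s ω) (u (T + 1)) (v (T + 1)) ≤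
      ∑ n ∈ Finset.range T, (2 * G * D n ω + 2 * L * D n ω ^ 2) +
        2 * L * (G / m) ^ 2 * (2 * √T) := fun ω => by
    refine (hpath.regret_le hT (sampleIter η est (x₀, y₀) s ω)).trans (le_of_eq ?_)
    congr 1
    -- Index shift from rounds `1, …, T` to `n = 0, …, T - 1`.
    rw [Finset.range_eq_Ico, Finset.sum_Ico_add' (fun t : ℕ => 2 * G *
      saddleDist u v (sampleIter η est (x₀, y₀) s ω) t (t + 1) + 2 * L *
      saddleDist u v (sampleIter η est (x₀, y₀) s ω) t (t + 1) ^ 2) 0 T 1]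
    rfl
  have hDn : ∀ n ∈ Finset.range T,
      Integrable (fun ω => 2 * G * D n ω + 2 * L * D n ω ^ 2) Pr := fun n hn =>
    ((hDi n hn).1.1.const_mul _).add ((hDi n hn).2.1.const_mul _)
  have hsumi := integrable_finsetSum _ hDn
  have hbi := hsumi.add (integrable_const (μ := Pr) (2 * L * (G / m) ^ 2 * (2 * √T)))
  have hmeas : Measurable (fun ω =>
      regretVar P F T (sampleIter η est (x₀, y₀) s ω) (u (T + 1)) (v (T + 1))) := by
    have h1 : Measurable (fun ω => ∑ t ∈ Finset.Icc 1 T,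
        meanF P F t (sampleIter η est (x₀, y₀) s ω t).1 (sampleIter η est (x₀, y₀) s ω t).2) :=
      Finset.measurable_fun_sum _ fun t ht =>
        (hF t (Finset.mem_Icc.1 ht).1 (Finset.mem_Icc.1 ht).2).comp
          (hN.measurable_iter (by have := (Finset.mem_Icc.1 ht).2; omega))
    exact (h1.sub_const _).abs
  have hint : Integrable (fun ω =>
      regretVar P F T (sampleIter η est (x₀, y₀) s ω) (u (T + 1)) (v (T + 1))) Pr :=
    hbi.mono' hmeas.aestronglyMeasurable (.of_forall fun ω => by
      have h0 : 0 ≤ regretVar P F T (sampleIter η est (x₀, y₀) s ω) (u (T + 1)) (v (T + 1)) :=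
        abs_nonneg _
      rw [Real.norm_of_nonneg h0]
      exact hpt ω)
  refine ⟨hint, (integral_mono hint hbi hpt).trans ?_⟩
  have h1 : ∫ ω, (∑ n ∈ Finset.range T, (2 * G * D n ω + 2 * L * D n ω ^ 2) +
      2 * L * (G / m) ^ 2 * (2 * √T)) ∂Pr ≤
      ∑ n ∈ Finset.range T, (2 * G * α n + 2 * L * α n ^ 2) +
        2 * L * (G / m) ^ 2 * (2 * √T) := by
    rw [integral_add hsumi (integrable_const _), integral_const, probReal_univ, one_smul,
      integral_finsetSum _ hDn]
    refine add_le_add_left (Finset.sum_le_sum fun n hn => ?_) _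
    rw [integral_add ((hDi n hn).1.1.const_mul (2 * G)) ((hDi n hn).2.1.const_mul (2 * L)),
      integral_const_mul, integral_const_mul]
    have h2 := (hDi n hn).1.2
    have h3 := (hDi n hn).2.2
    gcongr
  refine h1.trans ?_
  rw [Finset.sum_add_distrib, ← Finset.mul_sum, ← Finset.mul_sum]
  have h2 : √(T : ℝ) ≤ (T : ℝ) ^ (3 / 4 : ℝ) := by
    rw [Real.sqrt_eq_rpow]
    exact Real.rpow_le_rpow_of_exponent_le hT1 (by norm_num)
  have h3 := mul_le_mul_of_nonneg_left hK₁ (by positivity : 0 ≤ 2 * G)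
  have h4 := mul_le_mul_of_nonneg_left hK₂ (by positivity : 0 ≤ 2 * L)
  have h5 := mul_le_mul_of_nonneg_left h2 (by positivity : 0 ≤ 4 * L * (G / m) ^ 2)
  linarith

end Regret

/-! ### Parameters and oracle calls -/

section Parameters

theorem stepSize_pos {μ : ℝ} (hμ : 0 < μ) {T : ℕ} (hT : 1 ≤ T) : 0 < stepSize μ T := by
  have : (0 : ℝ) < T := by exact_mod_cast hT
  rw [stepSize]
  positivity

theorem stepSize_le {μ : ℝ} (hμ : 0 < μ) {T : ℕ} (hT : 1 ≤ T) : stepSize μ T ≤ 4 / μ := by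
  have hT1 : (1 : ℝ) ≤ T := by exact_mod_cast hT
  rw [stepSize]
  have h : (T : ℝ) ^ (-(1 / 4) : ℝ) ≤ 1 := Real.rpow_le_one_of_one_le_of_nonpos hT1 (by norm_num)
  gcongr
  linarith

/-- The three summands of the constant cover the cases: `1` for `η² ≤ (cη)²`, `η₀` for `η² ≤ cη`
(and, squared, `η⁴ ≤ (cη)²`), `η₀³` for `η⁴ ≤ cη`. -/
theorem pow_le_of_le {p : ℕ} (hp : p = 2 ∨ p = 4) {η η₀ : ℝ} (hη : 0 < η) (h : η ≤ η₀) :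
    η ^ p ≤ ((1 + η₀ + η₀ ^ 3) * η) ^ 2 ∧ η ^ p ≤ (1 + η₀ + η₀ ^ 3) * η := by
  have hη₀ : 0 < η₀ := hη.trans_le h
  have h3 : 0 < η₀ ^ 3 := by positivity
  have h1 : η ≤ (1 + η₀ + η₀ ^ 3) * η := le_mul_of_one_le_left hη.le (by linarith)
  have h2 : η ^ 2 ≤ (1 + η₀ + η₀ ^ 3) * η := by
    rw [pow_two]
    exact mul_le_mul_of_nonneg_right (by linarith) hη.le
  rcases hp with rfl | rfl
  · exact ⟨pow_le_pow_left₀ hη.le h1 2, h2⟩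
  · constructor
    · calc η ^ 4 = (η ^ 2) ^ 2 := by ring
        _ ≤ _ := pow_le_pow_left₀ (by positivity) h2 2
    · have h4 : η ^ 3 ≤ η₀ ^ 3 := pow_le_pow_left₀ hη.le h 3
      calc η ^ 4 = η ^ 3 * η := by ring
        _ ≤ _ := mul_le_mul_of_nonneg_right (by linarith) hη.le

/-- Uses `d + 5 ≤ 6d` and `η^{-p} = (μ/4)^p T^{p/4}`; the extra `1` comes from rounding up. -/
theorem batchZeroth_le {p d T : ℕ} {μ : ℝ} (hμ : 0 < μ) (hT : 1 ≤ T) (hd : 0 < d) :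
    (batchZeroth p (stepSize μ T) d : ℝ) ≤
      (6 * (μ / 4) ^ p + 1) * d * (T : ℝ) ^ ((p : ℝ) / 4) := by
  have hT1 : (1 : ℝ) ≤ T := by exact_mod_cast hT
  have hT0 : (0 : ℝ) < T := by linarith
  have hd1 : (1 : ℝ) ≤ d := by exact_mod_cast hd
  have hη := stepSize_pos hμ hT
  have h1 : (batchZeroth p (stepSize μ T) d : ℝ) < ((d : ℝ) + 5) / stepSize μ T ^ p + 1 :=
    Nat.ceil_lt_add_one (by positivity)
  have h2 : 1 / stepSize μ T ^ p = (μ / 4) ^ p * (T : ℝ) ^ ((p : ℝ) / 4) := by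
    have h3 : (T : ℝ) ^ ((p : ℝ) / 4) = ((T : ℝ) ^ (1 / 4 : ℝ)) ^ p := by
      rw [← Real.rpow_natCast, ← Real.rpow_mul hT0.le]
      congr 1
      ring
    rw [h3, ← mul_pow, ← one_div_pow, stepSize, Real.rpow_neg hT0.le]
    congr 1
    field_simp
  have h4 : (1 : ℝ) ≤ (T : ℝ) ^ ((p : ℝ) / 4) := Real.one_le_rpow hT1 (by positivity)
  rw [div_eq_mul_one_div, h2] at h1
  have h5 : 0 ≤ (μ / 4) ^ p * (T : ℝ) ^ ((p : ℝ) / 4) := by positivity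
  have h6 : ((d : ℝ) + 5) * ((μ / 4) ^ p * (T : ℝ) ^ ((p : ℝ) / 4)) ≤
      6 * d * ((μ / 4) ^ p * (T : ℝ) ^ ((p : ℝ) / 4)) :=
    mul_le_mul_of_nonneg_right (by linarith) h5
  have h7 : (1 : ℝ) ≤ d * (T : ℝ) ^ ((p : ℝ) / 4) := by nlinarith
  linarith

theorem totalZerothQueries_le {p dX dY T : ℕ} {μ : ℝ} (hμ : 0 < μ) (hT : 1 ≤ T) (hdX : 0 < dX)
    (hdY : 0 < dY) : (totalZerothQueries p μ T dX dY : ℝ) ≤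
      4 * (6 * (μ / 4) ^ p + 1) * (((dX : ℝ) + dY) * (T : ℝ) ^ (2 + (p : ℝ) / 4)) := by
  have hT0 : (0 : ℝ) < T := by exact_mod_cast hT
  have hX := batchZeroth_le (p := p) hμ hT hdX
  have hY := batchZeroth_le (p := p) hμ hT hdY
  have h1 : (totalZerothQueries p μ T dX dY : ℝ) ≤ T * (4 * T *
      ((batchZeroth p (stepSize μ T) dX : ℝ) + batchZeroth p (stepSize μ T) dY)) := by
    -- Round `t` makes two calls of `2t (m_X + m_Y)` evaluations each; then `t ≤ T` is used in all
    -- `T` rounds.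
    unfold totalZerothQueries zerothQueries
    push_cast
    rw [← nsmul_eq_mul]
    refine (Finset.sum_le_card_nsmul _ _ _ fun t ht => ?_).trans_eq (by rw [Finset.card_range])
    have ht' : (t : ℝ) ≤ T := by exact_mod_cast (Finset.mem_range.1 ht).le
    simp only [Finset.sum_const, Finset.card_range, Nat.card_Icc, add_tsub_cancel_right,
      nsmul_eq_mul, Finset.card_univ, Fintype.card_fin]
    have := mul_le_mul_of_nonneg_right ht' (by positivity :
      (0 : ℝ) ≤ 4 * ((batchZeroth p (stepSize μ T) dX : ℝ) + batchZeroth p (stepSize μ T) dY))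
    push_cast
    linarith
  refine h1.trans ?_
  have h2 : (T : ℝ) ^ (2 + (p : ℝ) / 4) = (T : ℝ) ^ 2 * (T : ℝ) ^ ((p : ℝ) / 4) := by
    rw [Real.rpow_add hT0, Real.rpow_ofNat]
  rw [h2]
  have h3 := mul_le_mul_of_nonneg_left (add_le_add hX hY) (by positivity : 0 ≤ 4 * (T : ℝ) ^ 2)
  linarith

end Parameters

/-! ### The two settings -/

section Settings

variable {dX dY : ℕ} {Ξ Ω : Type*} [MeasurableSpace Ξ] [MeasurableSpace Ω] {P : Measure Ξ}
  [IsProbabilityMeasure P] {Pr : Measure Ω} [IsProbabilityMeasure Pr] {T : ℕ}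
  {F : ℕ → Vec dX → Vec dY → Ξ → ℝ} {μX μY σ m L B : ℝ} {x₀ : Vec dX} {y₀ : Vec dY}

theorem measurable_meanF (hO : StochasticOracle T P F σ) {i : ℕ} (hi : 1 ≤ i) (hiT : i ≤ T) :
    Measurable (fun z : Vec dX × Vec dY => meanF P F i z.1 z.2) :=
  ((hO.measurable i hi hiT).stronglyMeasurable.integral_prod_right').measurable

theorem noiseBound_zeroth (hF : StronglyConvexConcave T F μX μY)
    (hO : StochasticOracle T P F σ) (hL : 0 ≤ L) (hB : 0 ≤ B)
    (hreg : ∀ i, 1 ≤ i → i ≤ T → ∀ᵐ ξ ∂P, RegularSaddle (fun x y => F i x y ξ)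
      (fun x y => gradX F i x y ξ) (fun x y => gradY F i x y ξ) m L B x₀ y₀)
    {p : ℕ} {η c : ℝ} (hη : 0 < η) (hc : 0 ≤ c) (hp : η ^ p ≤ (c * η) ^ 2)
    (hp' : η ^ p ≤ c * η) {s : SampleIdx → Ω → (Ξ × Vec dX) × (Ξ × Vec dY)}
    (hs : IsZerothSample Pr P s) :
    NoiseBound Pr (fun t w z => gradestZeroth F t (batchZeroth p η dX) (batchZeroth p η dY)
      (smoothing p η dX) (smoothing p η dY) w z) s T
      (fun i x y => ∫ ξ, gradX F i x y ξ ∂P) (fun i x y => ∫ ξ, gradY F i x y ξ ∂P) x₀ y₀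
      (noiseConst L B c) η where
  measurable_sample := hs.measurable
  indep := hs.indep
  measurable_est t ht := measurable_gradestZeroth hO ht _ _ _ _
  est_zero w z := by
    simp [gradestZeroth]
  -- Fixing the round and the call embeds the pairs `(i, j)` injectively into the sample indices, so
  -- independence is inherited.
  noise t ht htT k z := noise_gradestZeroth_le hF hO hL hB hreg hη hc hp hp' ht htT
    (s := fun i j => s (t, k, i, j)) (fun i j => hs.measurable _) (fun i j => hs.law _)
    (hs.indep.precomp (g := fun a : ℕ × ℕ => ((t, k, a.1, a.2) : SampleIdx))
      fun a b h => by simpa [Prod.ext_iff] using h) z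

theorem noiseBound_first (hF : StronglyConvexConcave T F μX μY)
    (hO : StochasticOracle T P F σ) (hL : 0 ≤ L) (hB : 0 ≤ B)
    (hreg : ∀ i, 1 ≤ i → i ≤ T → ∀ᵐ ξ ∂P, RegularSaddle (fun x y => F i x y ξ)
      (fun x y => gradX F i x y ξ) (fun x y => gradY F i x y ξ) m L B x₀ y₀)
    {p : ℕ} {η c : ℝ} (hη : 0 < η) (hc : 0 ≤ c) (hp : η ^ p ≤ (c * η) ^ 2)
    {s : SampleIdx → Ω → Ξ} (hs : IsFirstSample Pr P s) :
    NoiseBound Pr (fun t w z => gradestFirst F t (batchFirst p η) w z) s T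
      (fun i x y => ∫ ξ, gradX F i x y ξ ∂P) (fun i x y => ∫ ξ, gradY F i x y ξ ∂P) x₀ y₀
      (noiseConst L B c) η where
  measurable_sample := hs.measurable
  indep := hs.indep
  measurable_est t ht := measurable_gradestFirst hF hO ht _
  est_zero w z := by
    simp [gradestFirst]
  noise t ht htT k z := noise_gradestFirst_le hF hO hL hB hreg hη hc hp ht htT
    (s := fun i j => s (t, k, i, j)) (fun i j => hs.measurable _) (fun i j => hs.law _)
    (hs.indep.precomp (g := fun a : ℕ × ℕ => ((t, k, a.1, a.2) : SampleIdx))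
      fun a b h => by simpa [Prod.ext_iff] using h) z

end Settings

/-! ### Constants and the final assembly -/

theorem noiseConst_nonneg {L B c : ℝ} (hL : 0 ≤ L) (hB : 0 ≤ B) (hc : 0 ≤ c) :
    0 ≤ noiseConst L B c := by
  unfold noiseConst
  positivity

/-- Guarantees that the factor `1 - ηm + C η²` of the recursion is nonnegative for every step size.
-/
theorem sq_le_recConst {m L B κ η₀ : ℝ} (hm : 0 < m) (hL : 0 ≤ L) (hB : 0 ≤ B) (hκ : 0 ≤ κ)
    (hη₀ : 0 ≤ η₀) : m ^ 2 ≤ recConst m L B κ η₀ := by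
  have h1 : m ^ 2 ≤ (4 * L + m) ^ 2 := by gcongr; linarith
  have h2 : (1 : ℝ) ≤ 1 + 2 * B / m := le_add_of_nonneg_right (by positivity)
  have h3 : m ^ 2 ≤ 2 * (4 * L + m) ^ 2 + (4 * L + m) * κ * η₀ + κ * (1 + η₀ * (4 * L + m)) +
      κ ^ 2 * η₀ ^ 2 := by
    have h4 : 0 ≤ (4 * L + m) * κ * η₀ := by positivity
    have h5 : 0 ≤ κ * (1 + η₀ * (4 * L + m)) := by positivity
    have h6 : 0 ≤ κ ^ 2 * η₀ ^ 2 := by positivity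
    linarith [sq_nonneg (4 * L + m)]
  exact h3.trans (le_mul_of_one_le_right ((sq_nonneg m).trans h3) h2)

theorem RegretLE.mono {dX dY : ℕ} {Ξ Ω : Type*} [MeasurableSpace Ξ] [MeasurableSpace Ω]
    {Pr : Measure Ω} {P : Measure Ξ} {F : ℕ → Vec dX → Vec dY → Ξ → ℝ} {T : ℕ}
    {z : Ω → ℕ → Vec dX × Vec dY} {u : Vec dX} {v : Vec dY} {B B' : ℝ}
    (h : RegretLE Pr P F T z u v B) (hB : B ≤ B') : RegretLE Pr P F T z u v B' :=
  ⟨h.1, h.2.trans hB⟩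

end OnlineSaddle

open OnlineSaddle in
theorem mainTheorem2 (μX μY LX LY LGX LGY LXY LYX LH : ℝ) (hμX : 0 < μX) (hμY : 0 < μY) :
    ∃ C : ℝ, 0 < C ∧ ∀ (dX dY : ℕ), 0 < dX → 0 < dY → ∀ T : ℕ, 1 ≤ T →
      -- regret bounds
      (∀ (Ξ : Type*) [MeasurableSpace Ξ] (P : Measure Ξ) [IsProbabilityMeasure P]
        (F : ℕ → OnlineSaddle.Vec dX → OnlineSaddle.Vec dY → Ξ → ℝ) (σ : ℝ), 0 ≤ σ →
        ∀ (SX : Set (OnlineSaddle.Vec dX)) (SY : Set (OnlineSaddle.Vec dY)),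
        IsOpen SX → Convex ℝ SX → IsOpen SY → Convex ℝ SY →
        OnlineSaddle.StronglyConvexConcave T F μX μY →
        OnlineSaddle.LipschitzOnRegion T P F SX SY LX LY →
        OnlineSaddle.LipschitzGradient T P F LGX LGY →
        OnlineSaddle.LipschitzPartialGradient T P F LXY LYX →
        OnlineSaddle.BoundedThirdDerivative T P F LH →
        OnlineSaddle.StochasticOracle T P F σ →
        ∀ (x₀ : OnlineSaddle.Vec dX) (y₀ : OnlineSaddle.Vec dY), x₀ ∈ SX → y₀ ∈ SY →
        -- `(u (t + 1), v (t + 1))` is the saddle point of `J_t`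
        ∀ (u : ℕ → OnlineSaddle.Vec dX) (v : ℕ → OnlineSaddle.Vec dY),
        (∀ t, 1 ≤ t → t ≤ T →
          IsSaddlePointOn univ univ (OnlineSaddle.avgF P F t) (u (t + 1)) (v (t + 1)) ∧
          u (t + 1) ∈ SX ∧ v (t + 1) ∈ SY) →
        ∀ (Ω : Type*) [MeasurableSpace Ω] (Pr : Measure Ω) [IsProbabilityMeasure Pr],
        -- zeroth-order setting
        (∀ s : OnlineSaddle.SampleIdx → Ω →
            (Ξ × OnlineSaddle.Vec dX) × (Ξ × OnlineSaddle.Vec dY),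
          OnlineSaddle.IsZerothSample Pr P s →
          OnlineSaddle.RegretLE Pr P F T
            (OnlineSaddle.zerothIter 2 (min μX μY) T F (x₀, y₀) s) (u (T + 1)) (v (T + 1))
            (C * ((σ + 1) * (T : ℝ) ^ (3 / 4 : ℝ))) ∧
          OnlineSaddle.RegretLE Pr P F T
            (OnlineSaddle.zerothIter 4 (min μX μY) T F (x₀, y₀) s) (u (T + 1)) (v (T + 1))
            (C * (σ * (T : ℝ) ^ (1 / 2 : ℝ) + (T : ℝ) ^ (3 / 4 : ℝ)))) ∧
        -- first-order setting
        (∀ s : OnlineSaddle.SampleIdx → Ω → Ξ,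
          OnlineSaddle.IsFirstSample Pr P s →
          OnlineSaddle.RegretLE Pr P F T
            (OnlineSaddle.firstIter 2 (min μX μY) T F (x₀, y₀) s) (u (T + 1)) (v (T + 1))
            (C * ((σ + 1) * (T : ℝ) ^ (3 / 4 : ℝ))) ∧
          OnlineSaddle.RegretLE Pr P F T
            (OnlineSaddle.firstIter 4 (min μX μY) T F (x₀, y₀) s) (u (T + 1)) (v (T + 1))
            (C * (σ * (T : ℝ) ^ (1 / 2 : ℝ) + (T : ℝ) ^ (3 / 4 : ℝ))))) ∧
      -- oracle calls in the zeroth-order setting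
      (OnlineSaddle.totalZerothQueries 2 (min μX μY) T dX dY : ℝ) ≤
        C * (((dX : ℝ) + dY) * (T : ℝ) ^ (5 / 2 : ℝ)) ∧
      (OnlineSaddle.totalZerothQueries 4 (min μX μY) T dX dY : ℝ) ≤
        C * (((dX : ℝ) + dY) * (T : ℝ) ^ (3 : ℝ)) := by
  have hm : 0 < min μX μY := lt_min hμX hμY
  set m := min μX μY with hm_def
  obtain ⟨L, hL_def⟩ : ∃ L, L = |LGX| + |LGY| + |LXY| + |LYX| := ⟨_, rfl⟩
  obtain ⟨B, hB_def⟩ : ∃ B, B = |LX| + |LY| := ⟨_, rfl⟩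
  -- The largest possible step size, attained at `T = 1`. Taking it as `η₀` keeps all constants
  -- independent of the horizon.
  obtain ⟨η₀, hη₀_def⟩ : ∃ η₀, η₀ = 4 / m := ⟨_, rfl⟩
  have hL : 0 ≤ L := by rw [hL_def]; positivity
  have hB : 0 ≤ B := by rw [hB_def]; positivity
  have hη₀ : 0 < η₀ := by rw [hη₀_def]; positivity
  have hc : 0 ≤ 1 + η₀ + η₀ ^ 3 := by positivity
  have hκ := noiseConst_nonneg hL hB hc
  have hC₁ := sq_le_recConst hm hL hB hκ hη₀.le
  obtain ⟨K, hK, hsum⟩ := exists_sum_trackSeq_le (A := 2 * B / m)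
    (c := (2 * B + 4 * L * (2 * B / m)) / m) hm hC₁ (by positivity) (by positivity)
  obtain ⟨R, hR⟩ : ∃ R, R = (2 * (2 * B + 4 * L * (2 * B / m)) + 2 * L) * K +
    4 * L * ((2 * B + 4 * L * (2 * B / m)) / m) ^ 2 := ⟨_, rfl⟩
  have hR0 : 0 ≤ R := by rw [hR]; positivity
  obtain ⟨Q, hQ⟩ : ∃ Q : ℕ → ℝ, Q = fun p => 4 * (6 * (m / 4) ^ p + 1) := ⟨_, rfl⟩
  have hQ0 : ∀ p, 0 < Q p := fun p => by rw [hQ]; positivity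
  -- `R` is the regret constant, and `Q 2`, `Q 4` are the constants of the two query counts.
  refine ⟨R + Q 2 + Q 4, by linarith [hQ0 2, hQ0 4], fun dX dY hdX hdY T hT => ⟨?_, ?_, ?_⟩⟩
  · intro Ξ _ P _ F σ hσ SX SY hSX _ hSY _ hF hLip hG hGG _ hO x₀ y₀ hx₀ hy₀ u v huv Ω _ Pr _
    have hreg : ∀ i, 1 ≤ i → i ≤ T → ∀ᵐ ξ ∂P, RegularSaddle (fun x y => F i x y ξ)
        (fun x y => gradX F i x y ξ) (fun x y => gradY F i x y ξ) m L B x₀ y₀ := by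
      rw [hL_def, hB_def]
      exact fun i hi hiT => ae_regularSaddle hSX hSY hF hLip hG hGG hx₀ hy₀ hi hiT
    have hpath : SaddlePath T (meanF P F) (fun i x y => ∫ ξ, gradX F i x y ξ ∂P)
        (fun i x y => ∫ ξ, gradY F i x y ξ ∂P) m L B x₀ y₀ u v :=
      ⟨hm, hL, hB, fun i hi hiT => regularSaddle_meanF hO hi hiT (hreg i hi hiT),
        fun t ht htT => (huv t ht htT).1⟩
    have hη := stepSize_pos hm hT
    have hηη₀ : stepSize m T ≤ η₀ := hη₀_def ▸ stepSize_le hm hT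
    have hmeas : ∀ i, 1 ≤ i → i ≤ T →
        Measurable (fun z : Vec dX × Vec dY => meanF P F i z.1 z.2) := fun i hi hiT =>
      measurable_meanF hO hi hiT
    have hzeroth : ∀ p, p = 2 ∨ p = 4 → ∀ s : SampleIdx → Ω → (Ξ × Vec dX) × (Ξ × Vec dY),
        IsZerothSample Pr P s → RegretLE Pr P F T (zerothIter p m T F (x₀, y₀) s)
          (u (T + 1)) (v (T + 1)) (R * (T : ℝ) ^ (3 / 4 : ℝ)) := fun p hp s hs => by
      rw [hR]
      exact (noiseBound_zeroth hF hO hL hB hreg hη hc (pow_le_of_le hp hη hηη₀).1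
        (pow_le_of_le hp hη hηη₀).2 hs).regretLE hη hηη₀ hκ hpath hmeas hC₁ hT
        (hsum T hT).1 (hsum T hT).2
    have hfirst : ∀ p, p = 2 ∨ p = 4 → ∀ s : SampleIdx → Ω → Ξ,
        IsFirstSample Pr P s → RegretLE Pr P F T (firstIter p m T F (x₀, y₀) s)
          (u (T + 1)) (v (T + 1)) (R * (T : ℝ) ^ (3 / 4 : ℝ)) := fun p hp s hs => by
      rw [hR]
      exact (noiseBound_first hF hO hL hB hreg hη hc (pow_le_of_le hp hη hηη₀).1
        hs).regretLE hη hηη₀ hκ hpath hmeas hC₁ hT (hsum T hT).1 (hsum T hT).2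
    have hT0 : 0 ≤ (T : ℝ) ^ (3 / 4 : ℝ) := by positivity
    have hRC : R ≤ R + Q 2 + Q 4 := by linarith [hQ0 2, hQ0 4]
    -- Since `σ ≥ 0`, the bound `R T^{3/4}` lies below both right-hand sides.
    have h2 : R * (T : ℝ) ^ (3 / 4 : ℝ) ≤
        (R + Q 2 + Q 4) * ((σ + 1) * (T : ℝ) ^ (3 / 4 : ℝ)) :=
      mul_le_mul hRC (le_mul_of_one_le_left hT0 (by linarith)) hT0 (hR0.trans hRC)
    have h4 : R * (T : ℝ) ^ (3 / 4 : ℝ) ≤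
        (R + Q 2 + Q 4) * (σ * (T : ℝ) ^ (1 / 2 : ℝ) + (T : ℝ) ^ (3 / 4 : ℝ)) :=
      mul_le_mul hRC (le_add_of_nonneg_left (by positivity)) hT0 (hR0.trans hRC)
    exact ⟨fun s hs => ⟨(hzeroth 2 (.inl rfl) s hs).mono h2, (hzeroth 4 (.inr rfl) s hs).mono h4⟩,
      fun s hs => ⟨(hfirst 2 (.inl rfl) s hs).mono h2, (hfirst 4 (.inr rfl) s hs).mono h4⟩⟩
  · have h := totalZerothQueries_le (p := 2) hm hT hdX hdY
    rw [show (2 : ℝ) + ((2 : ℕ) : ℝ) / 4 = 5 / 2 by norm_num] at h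
    refine h.trans (mul_le_mul_of_nonneg_right ?_ (by positivity))
    have h2 : Q 2 = 4 * (6 * (m / 4) ^ 2 + 1) := by rw [hQ]
    linarith [hQ0 4]
  · have h := totalZerothQueries_le (p := 4) hm hT hdX hdY
    rw [show (2 : ℝ) + ((4 : ℕ) : ℝ) / 4 = 3 by norm_num] at h
    refine h.trans (mul_le_mul_of_nonneg_right ?_ (by positivity))
    have h4 : Q 4 = 4 * (6 * (m / 4) ^ 4 + 1) := by rw [hQ]
    linarith [hQ0 2]
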